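/- **Setting.** Let $d\ge 2$, let $\Omega\subset\mathbb R^d$ be bounded and open (for instance a bounded Lipschitz domain), $T>0$, $\nu\ge 0$. $L^2_\sigma$ and $H^1_{0,\sigma}$ are the closures of $C^\infty_{c,\sigma}(\Omega;\mathbb R^d)$ (smooth, compactly supported, divergence free; also written $C^\infty_{0,\sigma}$) in $L^2(\Omega)$ and $H^1(\Omega)$. Put $\mathbb X=L^\infty(0,T;L^2_\sigma)\cap L^2(0,T;H^1_{0,\sigma})$ and $\mathbb Y=\mathbb X\cap L^2(0,T;H^2)\cap L^1(0,T;W^{1,\infty})\cap H^1(0,T;(L^2_\sigma)^*)$ if $\nu>0$, and $\mathbb X=L^\infty(0,T;L^2_\sigma)$ and $\mathbb Y=\mathbb X\cap L^1(0,T;W^{1,\infty})\cap H^1(0,T;(L^2_\sigma)^*)$ if $\nu=0$. Let $f\in L^2(0,T;H^{-1})+L^1(0,T;L^2)$ if $\nu>0$ and $f\in L^1(0,T;L^2)$ if $\nu=0$. Put $\mathcal R(v|\tilde v)=\frac12\|v-\tilde v\|_{L^2}^2$, $\langle\mathcal A_\nu(\tilde v),z\rangle=(\partial_t\tilde v,z)+((\tilde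 v\cdot\nabla)\tilde v,z)+\nu(\nabla\tilde v,\nabla z)-\langle f,z\rangle$, and, for $\mathcal K:L^2_\sigma\to[0,\infty]$, $$\mathcal W_\nu(v|\tilde v)=\nu\|\nabla v-\nabla\tilde v\|_{L^2}^2-\int_\Omega((v-\tilde v)\cdot\nabla)(v-\tilde v)\cdot\tilde v\,dx+\mathcal K(\tilde v)\mathcal R(v|\tilde v)\quad(\nu>0),$$ $$\mathcal W_0(v|\tilde v)=\int_\Omega(v-\tilde v)\cdot(\nabla\tilde v)_{\rm sym}(v-\tilde v)\,dx+\mathcal K(\tilde v)\mathcal R(v|\tilde v).$$ Let $\mathcal D(\mathcal K)=\{\tilde v\in\mathbb X:\mathcal K(\tilde v)\in L^1(0,T)\}$. $\mathcal K$ is *admissible* if $\mathcal K(0)=0$; $\mathcal W_\nu(v|\tilde v)\ge0$ a.e. in $(0,T)$ for all $v\in\mathbb X$, $\tilde v\in\mathbb Y\cap\mathcal D(\mathcal K)$; $C^1([0,T];C^\infty_{c,\sigma})\subset\mathcal D(\mathcal K)$; and $\mathbb Y\cap\mathcal D(\mathcal K)$ has a topology in which $C^1([0,T];C^\infty_{c,\sigma})$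 is dense, which makes $\mathcal K:\mathbb Y\cap\mathcal D(\mathcal K)\to L^1(0,T)$ continuous, and which makes continuous the functionals $\tilde v\mapsto\int_0^T(\tilde v,g)\,dt$ for $g\in L^1(0,T;L^2)$, $\tilde v\mapsto\int_0^T(\partial_t\tilde v,h)\,dt$ for $h\in L^2(0,T;L^2_\sigma)$, $\tilde v\mapsto\int_0^T\!\int_\Omega\nabla\tilde v:M\,dx\,dt$ for $M\in L^\infty(0,T;L^1)$ and, if $\nu>0$, also for $M\in L^2(0,T;L^2)$. **Proposition.** Let $\mathcal K$ be admissible, $v\in\mathbb X$, $\xi\in L^\infty(0,T)$, $\xi\ge0$, and $E=\frac12\|v\|_{L^2}^2+\xi$. The following are equivalent. 1. (Relative energy inequality.) For all $\tilde v\in\mathbb Y\cap\mathcal D(\mathcal K)$ the function $F=\mathcal R(v|\tilde v)+\xi$ has essential one-sided limits everywhere in $[0,T]$ (at the end points both $F(t+)$ and $F(t-)$ denote the limit from inside), and for all $0\le s\le t\le T$ $$F(t+)+\int_s^t\Big(\mathcal W_\nu(v|\tilde v)+\langle\mathcal A_\nu(\tilde v),v-\tilde v\rangle-\mathcal K(\tilde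 v)(\mathcal R(v|\tilde v)+\xi)\Big)d\tau\le F(s-).$$ 2. (Locally in time.) For all $\tilde v\in\mathbb Y\cap\mathcal D(\mathcal K)$ the function $\mathcal R(v|\tilde v)+\xi$ is of bounded variation in $(0,T)$, and, as Radon measures on $(0,T)$, $$\frac{d}{dt}\big[\mathcal R(v|\tilde v)+\xi\big]+\mathcal W_\nu(v|\tilde v)+\langle\mathcal A_\nu(\tilde v),v-\tilde v\rangle-\mathcal K(\tilde v)\big[\mathcal R(v|\tilde v)+\xi\big]\le0.$$ 3. (Reduced.) For all time-independent $\tilde v\in C^\infty_{0,\sigma}(\Omega)$ the function $E-(v,\tilde v)$ is of bounded variation in $(0,T)$, and, as Radon measures on $(0,T)$, $$\partial_t\big(E-(v,\tilde v)\big)+\nu(\nabla v,\nabla v-\nabla\tilde v)+(v\otimes v;\nabla\tilde v)-\langle f,v-\tilde v\rangle+\mathcal K(\tilde v)\big(\tfrac12\|v\|_{L^2}^2-E\big)\le0.$$ In each of 1–3 the integrability on $(0,T)$ of the terms without time derivative is part of the assertion. -/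

import Mathlib

open MeasureTheory Set Filter Topology
open scoped ContDiff

noncomputable section

namespace EnergyVariational

/-- The Euclidean space of dimension `d`. -/
abbrev Vec (d : ℕ) : Type := EuclideanSpace ℝ (Fin d)

/-- Real `d × d` matrices with the Frobenius inner product. The entry `(i, j)` of a gradient is
the `j`-th partial derivative of the `i`-th component. -/
abbrev Mat (d : ℕ) : Type := EuclideanSpace ℝ (Fin d × Fin d)

/-- Third order tensors, for second derivatives of vector fields. -/
abbrev Tens (d : ℕ) : Type := EuclideanSpace ℝ (Fin d × Fin d × Fin d)

/-- Lebesgue measure on the time interval `(0, T)`. -/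
abbrev timeMeas (T : ℝ) : Measure ℝ := volume.restrict (Ioo 0 T)

/-- `L²(Ω; ℝᵈ)`. -/
abbrev L2 {d : ℕ} (Ω : Set (Vec d)) := Lp (Vec d) 2 (volume.restrict Ω)

/-- `L²(Ω; ℝᵈˣᵈ)`. -/
abbrev L2Mat {d : ℕ} (Ω : Set (Vec d)) := Lp (Mat d) 2 (volume.restrict Ω)

/-! ### Test fields in space, solenoidal spaces, weak derivatives -/

/-- Classical gradient of a vector field. -/
def gradField {d : ℕ} (φ : Vec d → Vec d) (x : Vec d) : Mat d :=
  WithLp.toLp 2 fun ij => fderiv ℝ φ x (EuclideanSpace.single ij.2 1) ij.1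

/-- Smooth vector fields with compact support in `Ω`. -/
structure TestField {d : ℕ} (Ω : Set (Vec d)) where
  toFun : Vec d → Vec d
  smooth : ContDiff ℝ ∞ toFun
  compactSupp : HasCompactSupport toFun
  supp_subset : tsupport toFun ⊆ Ω

/-- Smooth divergence free vector fields with compact support in `Ω`. -/
structure SolField {d : ℕ} (Ω : Set (Vec d)) extends TestField Ω where
  div_free : ∀ x, ∑ i, fderiv ℝ toFun x (EuclideanSpace.single i 1) i = 0

theorem TestField.memLp {d : ℕ} {Ω : Set (Vec d)} (φ : TestField Ω) :
    MemLp φ.toFun 2 (volume.restrict Ω) :=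
  φ.smooth.continuous.memLp_of_hasCompactSupport φ.compactSupp

theorem TestField.memLp_grad {d : ℕ} {Ω : Set (Vec d)} (φ : TestField Ω) :
    MemLp (gradField φ.toFun) 2 (volume.restrict Ω) := by
  refine Continuous.memLp_of_hasCompactSupport ?_ ?_
  · have h := φ.smooth.continuous_fderiv (by simp)
    unfold gradField
    fun_prop
  · have h := φ.compactSupp.fderiv (𝕜 := ℝ)
    refine h.mono ?_
    intro x hx
    contrapose! hx
    simp only [Function.mem_support, ne_eq, not_not] at hx ⊢
    ext ij
    simp [gradField, hx]

/-- The class of a test field in `L²`. -/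
def TestField.toL2 {d : ℕ} {Ω : Set (Vec d)} (φ : TestField Ω) : L2 Ω := φ.memLp.toLp

/-- The class of the gradient of a test field in `L²`. -/
def TestField.gradL2 {d : ℕ} {Ω : Set (Vec d)} (φ : TestField Ω) : L2Mat Ω := φ.memLp_grad.toLp

/-- `L²_σ(Ω)`: the closure in `L²` of the smooth compactly supported solenoidal fields (these form
a linear space, so that taking the span adds nothing). -/
abbrev L2sol {d : ℕ} (Ω : Set (Vec d)) : Submodule ℝ (L2 Ω) :=
  (Submodule.span ℝ (range fun φ : SolField Ω => φ.toL2)).topologicalClosure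

/-- A smooth compactly supported solenoidal field as an element of `L²_σ(Ω)`. -/
def SolField.toL2sol {d : ℕ} {Ω : Set (Vec d)} (φ : SolField Ω) : L2sol Ω :=
  ⟨φ.toL2, Submodule.le_topologicalClosure _ (Submodule.subset_span ⟨φ, rfl⟩)⟩

/-- `H¹₀(Ω; ℝᵈ)`, realised as the closure of the pairs `(φ, ∇φ)` in `L² × L²`, `φ` smooth with
compact support in `Ω` (the norm of the product is equivalent to the `H¹` norm). -/
abbrev H10 {d : ℕ} (Ω : Set (Vec d)) : Submodule ℝ (L2 Ω × L2Mat Ω) :=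
  (Submodule.span ℝ (range fun φ : TestField Ω => (φ.toL2, φ.gradL2))).topologicalClosure

/-- `g` is the weak `j`-th partial derivative of `f` in `Ω`. -/
def HasWeakPartial {d : ℕ} (Ω : Set (Vec d)) (f g : Vec d → ℝ) (j : Fin d) : Prop :=
  ∀ φ : Vec d → ℝ, ContDiff ℝ ∞ φ → HasCompactSupport φ → tsupport φ ⊆ Ω →
    ∫ x in Ω, f x * fderiv ℝ φ x (EuclideanSpace.single j 1) = -∫ x in Ω, g x * φ x

/-- `G` is the weak gradient of the vector field `u` in `Ω`. -/
def HasWeakGrad {d : ℕ} (Ω : Set (Vec d)) (u : Vec d → Vec d) (G : Vec d → Mat d) : Prop :=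
  ∀ i j, HasWeakPartial Ω (fun x => u x i) (fun x => G x (i, j)) j

open Classical in
/-- The weak gradient of `u`, if there is one in `L²` (it is then unique); `0` otherwise. -/
def grad {d : ℕ} {Ω : Set (Vec d)} (u : L2sol Ω) : L2Mat Ω :=
  if h : ∃ G : L2Mat Ω, HasWeakGrad Ω (u : L2 Ω) G then h.choose else 0

/-- `u ∈ H¹_{0,σ}(Ω)`: the pair `(u, ∇u)` is in the closure, with respect to the `H¹` norm, of the
smooth compactly supported solenoidal fields. -/
def MemH10sol {d : ℕ} {Ω : Set (Vec d)} (u : L2sol Ω) : Prop :=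
  ((u : L2 Ω), grad u) ∈ closure (range fun φ : SolField Ω => (φ.toL2, φ.gradL2))

/-! ### The function spaces in space and time -/

/-- The energy space `𝕏 = L^∞(0,T; L²_σ) ∩ L²(0,T; H¹_{0,σ})` for `ν > 0`, and
`𝕏₀ = L^∞(0,T; L²_σ)` for `ν = 0`. -/
structure MemX {d : ℕ} {Ω : Set (Vec d)} (ν T : ℝ) (v : ℝ → L2sol Ω) : Prop where
  bounded : MemLp v ⊤ (timeMeas T)
  memH10sol : 0 < ν → ∀ᵐ t ∂timeMeas T, MemH10sol (v t)
  grad_memLp : 0 < ν → MemLp (fun t => grad (v t)) 2 (timeMeas T)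

/-- `u ∈ L¹(0,T; W^{1,∞}(Ω))`, in the sense of Bochner. -/
def MemL1W1inf {d : ℕ} {Ω : Set (Vec d)} (T : ℝ) (u : ℝ → L2sol Ω) : Prop :=
  ∃ (U : ℝ → Lp (Vec d) ⊤ (volume.restrict Ω)) (G : ℝ → Lp (Mat d) ⊤ (volume.restrict Ω)),
    Integrable U (timeMeas T) ∧ Integrable G (timeMeas T) ∧
      ∀ᵐ t ∂timeMeas T, (U t =ᵐ[volume.restrict Ω] (u t : L2 Ω)) ∧
        HasWeakGrad Ω (u t : L2 Ω) (G t)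

/-- For `u` with first derivatives in `L²(0,T; L²)`: the second derivatives are in `L²(0,T; L²)`
too, so that `u ∈ L²(0,T; H²(Ω))`. -/
def MemL2H2 {d : ℕ} {Ω : Set (Vec d)} (T : ℝ) (u : ℝ → L2sol Ω) : Prop :=
  ∃ D : ℝ → Lp (Tens d) 2 (volume.restrict Ω), MemLp D 2 (timeMeas T) ∧
    ∀ᵐ t ∂timeMeas T, ∀ i j k,
      HasWeakPartial Ω (fun x => grad (u t) x (i, j)) (fun x => D t x (i, j, k)) k

/-- `u` lies in the space of test functions
`𝕐 = 𝕏 ∩ L²(0,T; H²) ∩ L¹(0,T; W^{1,∞}) ∩ H¹(0,T; (L²_σ)^*)` for `ν > 0`, respectively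
`𝕐₀ = 𝕏₀ ∩ L¹(0,T; W^{1,∞}) ∩ H¹(0,T; (L²_σ)^*)` for `ν = 0`, and `du` is its time derivative.
The dual of `L²_σ` is identified with `L²_σ` by the Riesz isomorphism, and `u` is taken as its
continuous representative on `[0, T]`. -/
structure MemY {d : ℕ} {Ω : Set (Vec d)} (ν T : ℝ) (u du : ℝ → L2sol Ω) : Prop where
  memX : MemX ν T u
  memL2H2 : 0 < ν → MemL2H2 T u
  memL1W1inf : MemL1W1inf T u
  deriv_memLp : MemLp du 2 (timeMeas T)
  eq_integral : ∀ t ∈ Icc 0 T, u t = u 0 + ∫ τ in (0 : ℝ)..t, du τ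

/-- `𝒦(u) ∈ L¹(0,T)`; the domain `𝒟(𝒦)` consists of the `u ∈ 𝕏` with this property. -/
def MemDom {d : ℕ} {Ω : Set (Vec d)} (T : ℝ) (K : L2sol Ω → ENNReal) (u : ℝ → L2sol Ω) : Prop :=
  AEMeasurable (fun t => K (u t)) (timeMeas T) ∧ ∫⁻ t, K (u t) ∂timeMeas T ≠ ⊤

/-- The set `𝕐 ∩ 𝒟(𝒦)`. Each element carries its time derivative. -/
structure TestFun {d : ℕ} {Ω : Set (Vec d)} (ν T : ℝ) (K : L2sol Ω → ENNReal) where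
  u : ℝ → L2sol Ω
  du : ℝ → L2sol Ω
  memY : MemY ν T u du
  memDom : MemDom T K u

theorem TestFun.integrable_K {d : ℕ} {Ω : Set (Vec d)} {ν T : ℝ} {K : L2sol Ω → ENNReal}
    (p : TestFun ν T K) : Integrable (fun t => (K (p.u t)).toReal) (timeMeas T) :=
  integrable_toReal_of_lintegral_ne_top p.memDom.1 p.memDom.2

/-- `w ∈ C¹([0,T]; C^∞_{c,σ}(Ω))` with time derivative `w'`: the supports stay in a fixed compact
subset of `Ω`, and all spatial derivatives of `w` are continuously differentiable in time. -/
structure IsC1Curve {d : ℕ} {Ω : Set (Vec d)} (T : ℝ) (w w' : ℝ → SolField Ω) : Prop where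
  common_supp : ∃ C : Set (Vec d), IsCompact C ∧ C ⊆ Ω ∧
    ∀ t ∈ Icc 0 T, tsupport (w t).toFun ⊆ C
  hasDeriv : ∀ (m : ℕ) (x : Vec d), ∀ t ∈ Icc 0 T,
    HasDerivWithinAt (fun τ => iteratedFDeriv ℝ m (w τ).toFun x)
      (iteratedFDeriv ℝ m (w' t).toFun x) (Icc 0 T) t
  cont : ∀ m : ℕ, ContinuousOn
    (fun q : ℝ × Vec d => iteratedFDeriv ℝ m (w q.1).toFun q.2) (Icc 0 T ×ˢ univ)
  cont_deriv : ∀ m : ℕ, ContinuousOn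
    (fun q : ℝ × Vec d => iteratedFDeriv ℝ m (w' q.1).toFun q.2) (Icc 0 T ×ˢ univ)

/-! ### Relative energy, relative form, system operator -/

/-- The relative energy `ℛ(v | w) = ½ ‖v - w‖²`. -/
def relEnergy {d : ℕ} {Ω : Set (Vec d)} (v w : L2sol Ω) : ℝ := 1 / 2 * ‖v - w‖ ^ 2

/-- `∫_Ω (a · ∇) b · c`, where `B` is the gradient of `b`. -/
def convection {d : ℕ} (Ω : Set (Vec d)) (a : Vec d → Vec d) (B : Vec d → Mat d)
    (c : Vec d → Vec d) : ℝ :=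
  ∫ x in Ω, ∑ i, ∑ j, a x j * B x (i, j) * c x i

/-- `∫_Ω a · (B_sym a)`, with the symmetric part `B_sym` of `B`. -/
def symForm {d : ℕ} (Ω : Set (Vec d)) (a : Vec d → Vec d) (B : Vec d → Mat d) : ℝ :=
  ∫ x in Ω, ∑ i, ∑ j, a x i * (1 / 2 * (B x (i, j) + B x (j, i))) * a x j

/-- The relative form `𝒲_ν(v | w)`, for `ν > 0` and for `ν = 0`. -/
def relForm {d : ℕ} {Ω : Set (Vec d)} (ν : ℝ) (K : L2sol Ω → ENNReal) (v w : L2sol Ω) : ℝ :=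
  if 0 < ν then
    ν * ‖grad v - grad w‖ ^ 2
      - convection Ω ((v - w : L2sol Ω) : L2 Ω) (grad v - grad w : L2Mat Ω) (w : L2 Ω)
      + (K w).toReal * relEnergy v w
  else
    symForm Ω ((v - w : L2sol Ω) : L2 Ω) (grad w) + (K w).toReal * relEnergy v w

/-- Right-hand sides: `f = f₁ + f₂ ∈ L²(0,T; H⁻¹) + L¹(0,T; L²)` for `ν > 0`, and
`f = f₂ ∈ L¹(0,T; L²)` for `ν = 0`. -/
structure Force {d : ℕ} (Ω : Set (Vec d)) (ν T : ℝ) where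
  f₁ : ℝ → StrongDual ℝ (H10 Ω)
  f₂ : ℝ → L2 Ω
  memLp₁ : MemLp f₁ 2 (timeMeas T)
  integrable₂ : Integrable f₂ (timeMeas T)
  inviscid : ν = 0 → f₁ = 0

open Classical in
/-- The duality pairing `⟨f(t), z⟩` (for `ν > 0` it is used for `z ∈ H¹_{0,σ} ⊆ H¹₀`). -/
def Force.pair {d : ℕ} {Ω : Set (Vec d)} {ν T : ℝ} (f : Force Ω ν T) (t : ℝ) (z : L2sol Ω) : ℝ :=
  (if h : ((z : L2 Ω), grad z) ∈ H10 Ω then f.f₁ t ⟨_, h⟩ else 0) + inner ℝ (f.f₂ t) (z : L2 Ω)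

/-- `⟨𝒜_ν(w), z⟩ = ⟨∂ₜw + (w · ∇)w - ν Δw - f, z⟩` at time `t`, with `dw` the time derivative of
`w`, and with the Laplacian in the weak sense. -/
def sysOp {d : ℕ} {Ω : Set (Vec d)} {ν T : ℝ} (f : Force Ω ν T) (t : ℝ) (w dw z : L2sol Ω) : ℝ :=
  inner ℝ dw z + convection Ω (w : L2 Ω) (grad w) (z : L2 Ω) + ν * inner ℝ (grad w) (grad z)
    - f.pair t z

/-! ### Admissible forms -/

/-- `𝒦 : L²_σ(Ω) → [0, ∞]` is an admissible form. The topology on the test functions is fine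
enough for `𝒦` to be continuous with values in `L¹(0,T)`, and for the test functions, their time
derivatives and their gradients to depend continuously on the test function in the weak topologies
of `L^∞(0,T; L²)`, `L²(0,T; L²_σ)`, `L¹(0,T; L^∞)` and (`ν > 0`) `L²(0,T; L²)`, these spaces being
tested against `L¹(0,T; L²)`, `L²(0,T; L²_σ)`, `L^∞(0,T; L¹)`, `L²(0,T; L²)`. -/
structure IsAdmissible {d : ℕ} {Ω : Set (Vec d)} (ν T : ℝ) (K : L2sol Ω → ENNReal) : Prop where
  map_zero : K 0 = 0
  curve_memDom : ∀ w w' : ℝ → SolField Ω, IsC1Curve T w w' → MemDom T K fun t => (w t).toL2sol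
  exists_topology : ∃ _τ : TopologicalSpace (TestFun ν T K),
    (Continuous fun p : TestFun ν T K => p.integrable_K.toL1) ∧
    (∀ g : ℝ → L2 Ω, Integrable g (timeMeas T) →
      Continuous fun p : TestFun ν T K => ∫ t in Ioo 0 T, inner ℝ (p.u t : L2 Ω) (g t)) ∧
    (∀ h : ℝ → L2sol Ω, MemLp h 2 (timeMeas T) →
      Continuous fun p : TestFun ν T K => ∫ t in Ioo 0 T, inner ℝ (p.du t) (h t)) ∧
    (∀ M : ℝ → Lp (Mat d) 1 (volume.restrict Ω), MemLp M ⊤ (timeMeas T) →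
      Continuous fun p : TestFun ν T K =>
        ∫ t in Ioo 0 T, ∫ x in Ω, inner ℝ (grad (p.u t) x) (M t x)) ∧
    (0 < ν → ∀ M : ℝ → L2Mat Ω, MemLp M 2 (timeMeas T) →
      Continuous fun p : TestFun ν T K => ∫ t in Ioo 0 T, inner ℝ (grad (p.u t)) (M t)) ∧
    Dense {p : TestFun ν T K | ∃ w w' : ℝ → SolField Ω, IsC1Curve T w w' ∧
      ∀ t ∈ Icc 0 T, p.u t = (w t).toL2sol}
  nonneg : ∀ v : ℝ → L2sol Ω, MemX ν T v → ∀ p : TestFun ν T K,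
    ∀ᵐ t ∂timeMeas T, 0 ≤ relForm ν K (v t) (p.u t)

/-! ### The three inequalities -/

/-- `a` is the limit from the right, `F(t+)`, of the (almost everywhere defined) function `F` on
`(0, T)`; at `t = T` it is the limit from inside the interval. -/
def IsRightLim (T : ℝ) (F : ℝ → ℝ) (t a : ℝ) : Prop :=
  Tendsto F (𝓝[if t < T then Ioo t T else Ioo 0 T] t ⊓ ae volume) (𝓝 a)

/-- `a` is the limit from the left, `F(t-)`, of the (almost everywhere defined) function `F` on
`(0, T)`; at `t = 0` it is the limit from inside the interval. -/
def IsLeftLim (T : ℝ) (F : ℝ → ℝ) (t a : ℝ) : Prop :=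
  Tendsto F (𝓝[if 0 < t then Ioo 0 t else Ioo 0 T] t ⊓ ae volume) (𝓝 a)

/-- `F` is of bounded variation on `(0, T)` and its distributional derivative is the finite signed
Radon measure `D`. -/
def HasBVDeriv (T : ℝ) (F : ℝ → ℝ) (D : SignedMeasure ℝ) : Prop :=
  IntegrableOn F (Ioo 0 T) ∧
    ∀ φ : ℝ → ℝ, ContDiff ℝ ∞ φ → HasCompactSupport φ → tsupport φ ⊆ Ioo 0 T →
      ∫ t in Ioo 0 T, deriv φ t * F t =
        -(∫ t, φ t ∂D.toJordanDecomposition.posPart - ∫ t, φ t ∂D.toJordanDecomposition.negPart)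

/-- `dF/dt + g ≤ 0` in `(0, T)`, where `F` is of bounded variation: an inequality between Radon
measures. -/
def DerivAddNonpos (T : ℝ) (F g : ℝ → ℝ) : Prop :=
  IntegrableOn g (Ioo 0 T) ∧ ∃ D : SignedMeasure ℝ, HasBVDeriv T F D ∧
    ∀ B : Set ℝ, MeasurableSet B → B ⊆ Ioo 0 T → D B + ∫ t in B, g t ≤ 0

/-- `𝒲_ν(v | w) + ⟨𝒜_ν(w), v - w⟩ - 𝒦(w) [ℛ(v | w) + ξ]` at time `t`. -/
def relRate {d : ℕ} {Ω : Set (Vec d)} {ν T : ℝ} {K : L2sol Ω → ENNReal} (f : Force Ω ν T)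
    (v : ℝ → L2sol Ω) (ξ : ℝ → ℝ) (p : TestFun ν T K) (t : ℝ) : ℝ :=
  relForm ν K (v t) (p.u t) + sysOp f t (p.u t) (p.du t) (v t - p.u t)
    - (K (p.u t)).toReal * (relEnergy (v t) (p.u t) + ξ t)

/-- The relative energy inequality. -/
def RelativeEnergyInequality {d : ℕ} {Ω : Set (Vec d)} {ν T : ℝ} (K : L2sol Ω → ENNReal)
    (f : Force Ω ν T) (v : ℝ → L2sol Ω) (ξ : ℝ → ℝ) : Prop :=
  ∀ p : TestFun ν T K, IntegrableOn (relRate f v ξ p) (Ioo 0 T) ∧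
    ∃ Fr Fl : ℝ → ℝ,
      (∀ t ∈ Icc 0 T, IsRightLim T (fun τ => relEnergy (v τ) (p.u τ) + ξ τ) t (Fr t)) ∧
      (∀ t ∈ Icc 0 T, IsLeftLim T (fun τ => relEnergy (v τ) (p.u τ) + ξ τ) t (Fl t)) ∧
      ∀ s ∈ Icc 0 T, ∀ t ∈ Icc s T, Fr t + ∫ τ in s..t, relRate f v ξ p τ ≤ Fl s

/-- The locally-in-time version. -/
def LocalInequality {d : ℕ} {Ω : Set (Vec d)} {ν T : ℝ} (K : L2sol Ω → ENNReal)
    (f : Force Ω ν T) (v : ℝ → L2sol Ω) (ξ : ℝ → ℝ) : Prop :=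
  ∀ p : TestFun ν T K,
    DerivAddNonpos T (fun t => relEnergy (v t) (p.u t) + ξ t) (relRate f v ξ p)

/-- The energy `E = ½ ‖v‖² + ξ`. -/
def energy {d : ℕ} {Ω : Set (Vec d)} (v : ℝ → L2sol Ω) (ξ : ℝ → ℝ) (t : ℝ) : ℝ :=
  1 / 2 * ‖v t‖ ^ 2 + ξ t

/-- The reduced locally-in-time version, with test functions that do not depend on time. -/
def ReducedInequality {d : ℕ} {Ω : Set (Vec d)} {ν T : ℝ} (K : L2sol Ω → ENNReal)
    (f : Force Ω ν T) (v : ℝ → L2sol Ω) (ξ : ℝ → ℝ) : Prop :=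
  ∀ φ : SolField Ω,
    DerivAddNonpos T (fun t => energy v ξ t - inner ℝ (v t) φ.toL2sol) fun t =>
      ν * inner ℝ (grad (v t)) (grad (v t) - φ.gradL2)
        + (∫ x in Ω, ∑ i, ∑ j,
            ((v t : L2 Ω) x i * (v t : L2 Ω) x j) * gradField φ.toFun x (i, j))
        - f.pair t (v t - φ.toL2sol)
        + (K φ.toL2sol).toReal * (1 / 2 * ‖v t‖ ^ 2 - energy v ξ t)

end EnergyVariational

end

/-! All three statements are compared through inequalities in the sense of distributions in time.
For bounded `F` and integrable `g`, the relation `dF/dt + g ≤ 0` can be read against nonnegative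
test functions, as an inequality of measures, or through essential one-sided limits. Each reading
amounts to `F + ∫ g` agreeing a.e. with a nonincreasing function (`WeakNonpos.exists_antitone`,
`derivAddNonpos_iff_weakNonpos`, `limNonpos_iff_weakNonpos`). This gives 1 ⇔ 2, one test function at
a time.

For the comparison with 3, the rate is expanded. Since `v` is solenoidal and `ṽ` has a bounded weak
gradient, `((v · ∇)ṽ, ṽ) = 0`. Therefore relative form plus system operator collapses to an
expression affine in `ṽ`, apart from `(∂ₜṽ, v - ṽ)` and the terms with `𝒦(ṽ)` (`relForm_add_sysOp`,
`exists_isRate`); of the latter, `𝒦(ṽ)ℛ` cancels. Likewise `ℛ + ξ = (E - (v, ṽ)) + ½‖ṽ‖²`, and the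
last summand is removed by the energy identity for `ṽ` (`energy_identity`). So 2 says that
`weakForm` is nonpositive for all `θ ≥ 0` and all `ṽ`. Time-independent smooth `ṽ` give 3.

Conversely, 3 is extended to `ṽ ∈ C¹([0,T]; C^∞_{c,σ})` by doubling the time variable. The
inequality for the frozen field `ṽ(s)` is tested with `θ(t) ρₙ(t - s)` and integrated in `s`. The
derivative of `ρₙ` becomes a derivative in `s`, falls on `ṽ(s)` and produces `(v, ∂ₜṽ)`; as `n → ∞`
only the diagonal remains (`weak_of_frozen`). Each averaged product has one factor bounded and one
integrable in time (`mollifies_bilin`), so no continuity of `t ↦ 𝒦(ṽ(t))` is needed. Finally, for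
fixed `θ` the weak form is continuous in the topology of admissibility (`IsRate.weakForm_eq`), and
density of the smooth curves concludes. -/

noncomputable section

namespace EnergyVariational

/-! ### Mollifiers -/

/-- A sequence of smooth bump functions shrinking to the origin. -/
def moll (E : Type*) [NormedAddCommGroup E] [InnerProductSpace ℝ E] (n : ℕ) :
    ContDiffBump (0 : E) where
  rIn := 1 / ((n : ℝ) + 1)
  rOut := 2 / ((n : ℝ) + 1)
  rIn_pos := by positivity
  rIn_lt_rOut := by gcongr; norm_num

theorem tendsto_moll_rOut (E : Type*) [NormedAddCommGroup E] [InnerProductSpace ℝ E] :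
    Tendsto (fun n => (moll E n).rOut) atTop (𝓝 0) := by
  have h := (tendsto_one_div_add_atTop_nhds_zero_nat (𝕜 := ℝ)).const_mul 2
  simpa [moll, div_eq_mul_inv] using h

section Mollification

variable {E : Type*} [NormedAddCommGroup E] [InnerProductSpace ℝ E] [FiniteDimensional ℝ E]
  [MeasurableSpace E] [BorelSpace E]

/-- The normalised mollifiers. -/
def mker (E : Type*) [NormedAddCommGroup E] [InnerProductSpace ℝ E] [FiniteDimensional ℝ E]
    [MeasurableSpace E] [BorelSpace E] (n : ℕ) : E → ℝ :=
  (moll E n).normed volume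

theorem mker_nonneg (n : ℕ) (x : E) : 0 ≤ mker E n x := (moll E n).nonneg_normed x

theorem mker_neg (n : ℕ) (x : E) : mker E n (-x) = mker E n x := (moll E n).normed_neg x

theorem mker_sub_comm (n : ℕ) (x y : E) : mker E n (x - y) = mker E n (y - x) := by
  rw [← mker_neg, neg_sub]

theorem contDiff_mker (n : ℕ) : ContDiff ℝ ∞ (mker E n) := (moll E n).contDiff_normed

theorem continuous_mker (n : ℕ) : Continuous (mker E n) := (contDiff_mker n).continuous

theorem hasCompactSupport_mker (n : ℕ) : HasCompactSupport (mker E n) :=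
  (moll E n).hasCompactSupport_normed

theorem mker_eq_zero {n : ℕ} {x : E} (h : (moll E n).rOut ≤ ‖x‖) : mker E n x = 0 := by
  have := (moll E n).support_normed_eq (μ := volume)
  by_contra h'
  have h2 : x ∈ Function.support ((moll E n).normed volume) := h'
  rw [this, Metric.mem_ball, dist_zero_right] at h2
  linarith

theorem integral_mker (n : ℕ) : ∫ x, mker E n x = 1 := (moll E n).integral_normed

theorem integrable_mker (n : ℕ) : Integrable (mker E n) := (moll E n).integrable_normed

theorem integrable_mker_sub (n : ℕ) (x : E) : Integrable (fun y => mker E n (x - y)) :=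
  (integrable_mker n).comp_sub_left x

theorem integral_mker_sub (n : ℕ) (x : E) : ∫ y, mker E n (x - y) = 1 := by
  rw [integral_sub_left_eq_self (mker E n) volume x, integral_mker]

theorem exists_mker_bound (n : ℕ) : ∃ C, ∀ x, ‖mker E n x‖ ≤ C :=
  (continuous_mker n).bounded_above_of_compact_support (hasCompactSupport_mker n)

/-- Mollifications converge almost everywhere. -/
theorem ae_tendsto_mollification {X : Type*} [NormedAddCommGroup X] [NormedSpace ℝ X]
    [CompleteSpace X] {g : E → X} (hg : LocallyIntegrable g) :
    ∀ᵐ x, Tendsto (fun n => ∫ y, mker E n (x - y) • g y) atTop (𝓝 (g x)) := by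
  -- `K = 2` bounds the ratio of outer to inner radius, which is exactly 2 for every `n`.
  have h := ContDiffBump.ae_convolution_tendsto_right_of_locallyIntegrable (K := 2)
    (tendsto_moll_rOut E) (Eventually.of_forall fun n => by simp [moll, div_eq_mul_inv]) hg
  filter_upwards [h] with x hx
  refine hx.congr fun n => ?_
  rw [convolution_eq_swap]
  rfl

/-- The kernel is nonnegative with integral one, so averaging preserves an essential bound. This
supplies the dominating functions below. -/
theorem norm_mollification_le {X : Type*} [NormedAddCommGroup X] [NormedSpace ℝ X]
    {g : E → X} {C : ℝ} (hg : ∀ᵐ y, ‖g y‖ ≤ C) (n : ℕ) (x : E) :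
    ‖∫ y, mker E n (x - y) • g y‖ ≤ C := by
  calc ‖∫ y, mker E n (x - y) • g y‖ ≤ ∫ y, mker E n (x - y) * C := by
        refine norm_integral_le_of_norm_le ((integrable_mker_sub n x).mul_const C) ?_
        filter_upwards [hg] with y hy
        rw [norm_smul, Real.norm_of_nonneg (mker_nonneg n _)]
        exact mul_le_mul_of_nonneg_left hy (mker_nonneg n _)
    _ = C := by rw [integral_mul_const, integral_mker_sub, one_mul]

end Mollification

theorem _root_.MeasureTheory.MemLp.exists_ae_bound {α X : Type*} [MeasurableSpace α] {μ : Measure α}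
    [NormedAddCommGroup X] {f : α → X} (hf : MemLp f ⊤ μ) : ∃ C, ∀ᵐ x ∂μ, ‖f x‖ ≤ C := by
  refine ⟨(eLpNormEssSup f μ).toReal, ?_⟩
  have h : eLpNormEssSup f μ < ⊤ := by simpa using hf.2
  filter_upwards [ae_le_eLpNormEssSup (f := f) (μ := μ)] with x hx
  have := ENNReal.toReal_mono h.ne hx
  simpa using this

/-! ### Functions of bounded variation in time -/

/-- Integration by parts against a primitive. -/
theorem integral_deriv_mul_primitive {T : ℝ} (hT : 0 < T) {c : ℝ → ℝ}
    (hc : IntegrableOn c (Ioo 0 T)) {χ : ℝ → ℝ} (hχ : ContDiff ℝ ∞ χ) (h0 : χ 0 = 0)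
    (h1 : χ T = 0) (c₀ : ℝ) :
    ∫ t in Ioo 0 T, deriv χ t * (c₀ + ∫ s in (0 : ℝ)..t, c s) = -∫ t in Ioo 0 T, χ t * c t := by
  have hci : IntervalIntegrable c volume 0 T :=
    (intervalIntegrable_iff_integrableOn_Ioo_of_le hT.le).2 hc
  -- A primitive of an integrable function is absolutely continuous, which suffices for integration
  -- by parts; its derivative is `c` only a.e. The constant `c₀` contributes `χ T - χ 0 = 0`.
  have hac := hci.absolutelyContinuousOnInterval_intervalIntegral (c := 0) (by simp)
  have hac' : AbsolutelyContinuousOnInterval χ 0 T :=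
    (hχ.of_le (by simp)).contDiffOn.absolutelyContinuousOnInterval
  have h := hac'.integral_mul_deriv_eq_deriv_mul hac
  have hder : ∫ t in (0 : ℝ)..T, χ t * deriv (fun x => ∫ s in (0 : ℝ)..x, c s) t
      = ∫ t in (0 : ℝ)..T, χ t * c t := by
    refine intervalIntegral.integral_congr_ae ?_
    filter_upwards [hci.ae_hasDerivAt_integral] with t ht htm
    rw [(ht (uIoc_subset_uIcc htm) 0 (by simp)).deriv]
  rw [hder, h0, h1] at h
  have hcd : Continuous (deriv χ) := hχ.continuous_deriv (by simp)
  have h2 : ∫ t in (0 : ℝ)..T, deriv χ t = 0 := by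
    rw [intervalIntegral.integral_deriv_eq_sub (fun x _ => (hχ.differentiable (by simp)) x)
      (hcd.intervalIntegrable _ _), h0, h1, sub_zero]
  rw [← integral_Ioc_eq_integral_Ioo, ← integral_Ioc_eq_integral_Ioo,
    ← intervalIntegral.integral_of_le hT.le, ← intervalIntegral.integral_of_le hT.le, h]
  simp_rw [mul_add]
  rw [intervalIntegral.integral_add, intervalIntegral.integral_mul_const, h2]
  · simp
  · exact (hcd.intervalIntegrable _ _).mul_const _
  · exact (hac.continuousOn.intervalIntegrable).continuousOn_mul hcd.continuousOn

/-- Smooth functions with compact support in `(0, T)`. -/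
structure IsTimeTest (T : ℝ) (θ : ℝ → ℝ) : Prop where
  smooth : ContDiff ℝ ∞ θ
  compactSupp : HasCompactSupport θ
  supp_subset : tsupport θ ⊆ Ioo 0 T

/-- The inequality `dF/dt + g ≤ 0` in the sense of distributions on `(0, T)`. -/
def WeakNonpos (T : ℝ) (F g : ℝ → ℝ) : Prop :=
  ∀ θ, IsTimeTest T θ → (∀ t, 0 ≤ θ t) →
    -(∫ t in Ioo 0 T, deriv θ t * F t) + ∫ t in Ioo 0 T, θ t * g t ≤ 0

theorem IsTimeTest.eq_zero {T : ℝ} {θ : ℝ → ℝ} (h : IsTimeTest T θ) {t : ℝ}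
    (ht : t ∉ Ioo 0 T) : θ t = 0 :=
  image_eq_zero_of_notMem_tsupport fun h' => ht (h.supp_subset h')

theorem IsTimeTest.continuous_deriv {T : ℝ} {θ : ℝ → ℝ} (h : IsTimeTest T θ) :
    Continuous (deriv θ) := h.smooth.continuous_deriv (by simp)

theorem IsTimeTest.exists_bound {T : ℝ} {θ : ℝ → ℝ} (h : IsTimeTest T θ) :
    ∃ C, ∀ t, ‖θ t‖ ≤ C :=
  h.smooth.continuous.bounded_above_of_compact_support h.compactSupp

theorem IsTimeTest.exists_bound_deriv {T : ℝ} {θ : ℝ → ℝ} (h : IsTimeTest T θ) :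
    ∃ C, ∀ t, ‖deriv θ t‖ ≤ C :=
  h.continuous_deriv.bounded_above_of_compact_support h.compactSupp.deriv

theorem IsTimeTest.memLp_top {T : ℝ} {θ : ℝ → ℝ} (h : IsTimeTest T θ) :
    MemLp θ ⊤ (timeMeas T) := by
  obtain ⟨C, hC⟩ := h.exists_bound
  exact memLp_top_of_bound h.smooth.continuous.aestronglyMeasurable C (Eventually.of_forall hC)

theorem IsTimeTest.memLp_top_deriv {T : ℝ} {θ : ℝ → ℝ} (h : IsTimeTest T θ) :
    MemLp (deriv θ) ⊤ (timeMeas T) := by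
  obtain ⟨C, hC⟩ := h.exists_bound_deriv
  exact memLp_top_of_bound h.continuous_deriv.aestronglyMeasurable C (Eventually.of_forall hC)

theorem IsTimeTest.integrable_mul {T : ℝ} {θ : ℝ → ℝ} (h : IsTimeTest T θ) {g : ℝ → ℝ}
    (hg : IntegrableOn g (Ioo 0 T)) : IntegrableOn (fun t => θ t * g t) (Ioo 0 T) := by
  obtain ⟨C, hC⟩ := h.exists_bound
  exact hg.bdd_mul (c := C) h.smooth.continuous.aestronglyMeasurable (Eventually.of_forall hC)

theorem IsTimeTest.integrable_deriv_mul {T : ℝ} {θ : ℝ → ℝ} (h : IsTimeTest T θ) {g : ℝ → ℝ}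
    (hg : IntegrableOn g (Ioo 0 T)) : IntegrableOn (fun t => deriv θ t * g t) (Ioo 0 T) := by
  obtain ⟨C, hC⟩ := h.exists_bound_deriv
  exact hg.bdd_mul (c := C) h.continuous_deriv.aestronglyMeasurable (Eventually.of_forall hC)

/-- The primitive vanishing at the origin. -/
def prim (g : ℝ → ℝ) (t : ℝ) : ℝ := ∫ s in (0 : ℝ)..t, g s

theorem continuousOn_prim {T : ℝ} (hT : 0 < T) {g : ℝ → ℝ} (hg : IntegrableOn g (Ioo 0 T)) :
    ContinuousOn (prim g) (Icc 0 T) := by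
  have hgi : IntegrableOn g (Icc 0 T) := (integrableOn_Icc_iff_integrableOn_Ioo).2 hg
  have h := intervalIntegral.continuousOn_primitive_interval (by rwa [uIcc_of_le hT.le])
  rwa [uIcc_of_le hT.le] at h

theorem integrableOn_prim {T : ℝ} (hT : 0 < T) {g : ℝ → ℝ} (hg : IntegrableOn g (Ioo 0 T)) :
    IntegrableOn (prim g) (Ioo 0 T) :=
  ((continuousOn_prim hT hg).integrableOn_Icc).mono_set Ioo_subset_Icc_self

theorem prim_sub {T : ℝ} {g : ℝ → ℝ} (hg : IntegrableOn g (Ioo 0 T)) {s t : ℝ}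
    (hs : s ∈ Icc 0 T) (ht : t ∈ Icc 0 T) : ∫ τ in s..t, g τ = prim g t - prim g s := by
  have hgi : IntegrableOn g (Icc 0 T) := (integrableOn_Icc_iff_integrableOn_Ioo).2 hg
  have key : ∀ r ∈ Icc 0 T, IntervalIntegrable g volume 0 r := fun r hr =>
    (intervalIntegrable_iff_integrableOn_Icc_of_le hr.1).2
      (hgi.mono_set (Icc_subset_Icc_right hr.2))
  exact (intervalIntegral.integral_interval_sub_left (key t ht) (key s hs)).symm

theorem exists_prim_bound {T : ℝ} (hT : 0 < T) {g : ℝ → ℝ} (hg : IntegrableOn g (Ioo 0 T)) :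
    ∃ C, ∀ t ∈ Icc 0 T, ‖prim g t‖ ≤ C :=
  isCompact_Icc.exists_bound_of_continuousOn (continuousOn_prim hT hg)

/-- The distributional inequality in terms of `F + ∫ g`. -/
theorem weak_eq_prim {T : ℝ} (hT : 0 < T) {F g θ : ℝ → ℝ} (hF : IntegrableOn F (Ioo 0 T))
    (hg : IntegrableOn g (Ioo 0 T)) (hθ : IsTimeTest T θ) :
    -(∫ t in Ioo 0 T, deriv θ t * F t) + ∫ t in Ioo 0 T, θ t * g t
      = -∫ t in Ioo 0 T, deriv θ t * (F t + prim g t) := by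
  have h := integral_deriv_mul_primitive hT hg hθ.smooth (hθ.eq_zero (by simp))
    (hθ.eq_zero (by simp)) 0
  simp only [zero_add] at h
  simp_rw [mul_add]
  rw [integral_add (hθ.integrable_deriv_mul hF)
    (hθ.integrable_deriv_mul (integrableOn_prim hT hg))]
  change _ = -(_ + ∫ t in Ioo 0 T, deriv θ t * ∫ s in (0 : ℝ)..t, g s)
  rw [h]
  ring

/-- A bounded function which is nonincreasing on a set of full measure agrees almost everywhere
with a nonincreasing function. -/
theorem exists_antitone_of_antitoneOn {T C : ℝ} {H : ℝ → ℝ} {S : Set ℝ} (hS : AntitoneOn H S)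
    (hC : ∀ t ∈ S, ‖H t‖ ≤ C) (hae : ∀ᵐ t ∂timeMeas T, t ∈ S) :
    ∃ h : ℝ → ℝ, Antitone h ∧ H =ᵐ[timeMeas T] h := by
  obtain ⟨h, hh, heq⟩ := hS.exists_antitone_extension
    ⟨-C, by rintro _ ⟨t, ht, rfl⟩; exact (abs_le.1 (hC t ht)).1⟩
    ⟨C, by rintro _ ⟨t, ht, rfl⟩; exact (abs_le.1 (hC t ht)).2⟩
  exact ⟨h, hh, hae.mono fun t ht => heq ht⟩

/-- The smooth approximation of the indicator function of `[s, t]` is a test function. -/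
theorem exists_timeTest {T s t : ℝ} (hst : s ≤ t) {n : ℕ} (h0 : (moll ℝ n).rOut < s)
    (h1 : t + (moll ℝ n).rOut < T) :
    ∃ θ, IsTimeTest T θ ∧ (∀ x, 0 ≤ θ x) ∧ ∀ x, deriv θ x = mker ℝ n (x - s) - mker ℝ n (x - t) := by
  set r := (moll ℝ n).rOut with hr
  have hr0 : 0 < r := (moll ℝ n).rOut_pos
  -- A smooth step, constant outside `[-r, r]`; `θ` is the difference of its translates to `s` and
  -- `t`, nonnegative because `Φ` is monotone.
  set Φ : ℝ → ℝ := fun x => ∫ y in (0 : ℝ)..x, mker ℝ n y with hΦ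
  have hcont := continuous_mker (E := ℝ) n
  have hder : ∀ x, HasDerivAt Φ (mker ℝ n x) x := fun x =>
    intervalIntegral.integral_hasDerivAt_right (hcont.intervalIntegrable _ _)
      hcont.stronglyMeasurable.stronglyMeasurableAtFilter hcont.continuousAt
  have hderiv : deriv Φ = mker ℝ n := funext fun x => (hder x).deriv
  have hsm : ContDiff ℝ ∞ Φ := by
    rw [contDiff_infty_iff_deriv, hderiv]
    exact ⟨fun x => (hder x).differentiableAt, contDiff_mker n⟩
  have hmono : Monotone Φ := monotone_of_deriv_nonneg (fun x => (hder x).differentiableAt)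
    fun x => by rw [hderiv]; exact mker_nonneg n x
  have hdiff : ∀ x y, Φ y - Φ x = ∫ z in x..y, mker ℝ n z := fun x y =>
    intervalIntegral.integral_interval_sub_left (hcont.intervalIntegrable _ _)
      (hcont.intervalIntegrable _ _)
  have hbig : ∀ x y, r ≤ x → x ≤ y → Φ x = Φ y := by
    intro x y hx hxy
    have : Φ y - Φ x = 0 := by
      rw [hdiff, intervalIntegral.integral_congr (g := fun _ => 0), intervalIntegral.integral_zero]
      intro z hz
      rw [uIcc_of_le hxy] at hz
      exact mker_eq_zero (by rw [Real.norm_eq_abs]; exact (hx.trans hz.1).trans (le_abs_self z))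
    linarith
  have hsmall : ∀ x y, y ≤ -r → x ≤ y → Φ x = Φ y := by
    intro x y hy hxy
    have : Φ y - Φ x = 0 := by
      rw [hdiff, intervalIntegral.integral_congr (g := fun _ => 0), intervalIntegral.integral_zero]
      intro z hz
      rw [uIcc_of_le hxy] at hz
      refine mker_eq_zero ?_
      rw [Real.norm_eq_abs]
      have := neg_le_abs z
      linarith [hz.2]
    linarith
  have hsup : Function.support (fun x => Φ (x - s) - Φ (x - t)) ⊆ Icc (s - r) (t + r) := by
    intro x hx
    by_contra hx'
    apply hx
    rw [mem_Icc, not_and_or, not_le, not_le] at hx'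
    rcases hx' with h | h
    · simp only
      rw [hsmall (x - t) (x - s) (by linarith) (by linarith), sub_self]
    · simp only
      rw [hbig (x - t) (x - s) (by linarith) (by linarith), sub_self]
  have htsup : tsupport (fun x => Φ (x - s) - Φ (x - t)) ⊆ Icc (s - r) (t + r) :=
    closure_minimal hsup isClosed_Icc
  refine ⟨fun x => Φ (x - s) - Φ (x - t), ⟨?_, ?_, ?_⟩, ?_, ?_⟩
  · exact (hsm.comp (contDiff_id.sub contDiff_const)).sub
      (hsm.comp (contDiff_id.sub contDiff_const))
  · exact HasCompactSupport.of_support_subset_isCompact isCompact_Icc hsup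
  · exact htsup.trans (Icc_subset_Ioo (by linarith) h1)
  · intro x
    exact sub_nonneg.2 (hmono (by linarith))
  · intro x
    exact (((hder _).comp_sub_const x s).sub ((hder _).comp_sub_const x t)).deriv

/-- Testing with the smoothed indicator of `[s, t]` shows that the mollification of `H = F + prim g`
at `t` is at most that at `s`. Shrinking the kernel gives `H t ≤ H s` wherever the mollifications
converge to `H`, hence on a set of full measure. -/
theorem WeakNonpos.exists_antitone {T : ℝ} (hT : 0 < T) {F g : ℝ → ℝ}
    (hF : MemLp F ⊤ (timeMeas T)) (hg : IntegrableOn g (Ioo 0 T)) (h : WeakNonpos T F g) :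
    ∃ k : ℝ → ℝ, Antitone k ∧ (fun t => F t + prim g t) =ᵐ[timeMeas T] k := by
  have hFi : IntegrableOn F (Ioo 0 T) := hF.integrable le_top
  obtain ⟨C₁, hC₁⟩ := hF.exists_ae_bound
  obtain ⟨C₂, hC₂⟩ := exists_prim_bound hT hg
  set H : ℝ → ℝ := fun t => F t + prim g t with hH
  have hHi : IntegrableOn H (Ioo 0 T) := hFi.add (integrableOn_prim hT hg)
  have hI : Integrable ((Ioo 0 T).indicator H) :=
    (integrable_indicator_iff measurableSet_Ioo).2 hHi
  refine exists_antitone_of_antitoneOn (C := C₁ + C₂)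
    (S := {t | t ∈ Ioo 0 T ∧ ‖H t‖ ≤ C₁ + C₂ ∧ Tendsto
      (fun n => ∫ y, mker ℝ n (t - y) • (Ioo 0 T).indicator H y) atTop (𝓝 (H t))}) ?_ ?_ ?_
  · intro s hs t ht hst
    refine le_of_tendsto_of_tendsto ht.2.2 hs.2.2 ?_
    have hr := tendsto_moll_rOut ℝ
    filter_upwards [hr.eventually_lt_const hs.1.1,
      hr.eventually_lt_const (sub_pos.2 ht.1.2)] with n hn0 hn1
    obtain ⟨θ, hθ, hθ0, hd⟩ := exists_timeTest (T := T) hst hn0 (by linarith)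
    have h1 := h θ hθ hθ0
    rw [weak_eq_prim hT hFi hg hθ] at h1
    have key : ∀ x, ∫ y, mker ℝ n (x - y) • (Ioo 0 T).indicator H y
        = ∫ y in Ioo 0 T, mker ℝ n (y - x) * H y := by
      intro x
      rw [← integral_indicator measurableSet_Ioo]
      congr 1
      ext y
      rw [indicator_mul_right, mker_sub_comm, smul_eq_mul]
    have hInt : ∀ x, IntegrableOn (fun y => mker ℝ n (y - x) * H y) (Ioo 0 T) := by
      intro x
      obtain ⟨C, hC⟩ := exists_mker_bound (E := ℝ) n
      exact hHi.bdd_mul (c := C)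
        ((continuous_mker n).comp (continuous_id.sub continuous_const)).aestronglyMeasurable
        (Eventually.of_forall fun y => hC _)
    rw [key, key]
    simp_rw [hd, sub_mul] at h1
    rw [integral_sub (hInt s) (hInt t)] at h1
    linarith
  · exact fun t ht => ht.2.1
  · have h3 := ae_restrict_of_ae (s := Ioo 0 T) (ae_tendsto_mollification hI.locallyIntegrable)
    filter_upwards [h3, hC₁, ae_restrict_mem measurableSet_Ioo] with t ht1 ht2 ht3
    refine ⟨ht3, (norm_add_le _ _).trans (add_le_add ht2 (hC₂ t (Ioo_subset_Icc_self ht3))), ?_⟩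
    rwa [indicator_of_mem ht3] at ht1

/-- The distribution function of a finite measure has this measure as its derivative. -/
theorem integral_deriv_mul_measure_Ioc {T : ℝ} {μ : Measure ℝ} [IsFiniteMeasure μ]
    {φ : ℝ → ℝ} (hφ : IsTimeTest T φ) :
    ∫ t in Ioo 0 T, deriv φ t * μ.real (Ioc 0 t) = -∫ t, φ t ∂μ := by
  obtain ⟨C, hC⟩ := hφ.exists_bound_deriv
  have hd := hφ.continuous_deriv
  have hmeas : MeasurableSet {q : ℝ × ℝ | q.2 ∈ Ioc 0 q.1} := by
    have : {q : ℝ × ℝ | q.2 ∈ Ioc 0 q.1} = {q | 0 < q.2} ∩ {q | q.2 ≤ q.1} := rfl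
    rw [this]
    exact (measurableSet_lt measurable_const measurable_snd).inter
      (measurableSet_le measurable_snd measurable_fst)
  have h1 : ∀ t, deriv φ t * μ.real (Ioc 0 t)
      = ∫ s, {q : ℝ × ℝ | q.2 ∈ Ioc 0 q.1}.indicator (fun q => deriv φ q.1) (t, s) ∂μ := by
    intro t
    have : (fun s => {q : ℝ × ℝ | q.2 ∈ Ioc 0 q.1}.indicator (fun q => deriv φ q.1) (t, s))
        = (Ioc 0 t).indicator fun _ => deriv φ t := by
      ext s
      simp [indicator]
    rw [this, integral_indicator measurableSet_Ioc, setIntegral_const, smul_eq_mul, mul_comm]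
  simp_rw [h1]
  -- After Fubini the inner integral is that of `φ'` over `[s, T)`, which is `-φ s`; for `s` outside
  -- `(0, T)` both sides vanish.
  rw [integral_integral_swap]
  · rw [← integral_neg]
    congr 1
    ext s
    by_cases hs : s ∈ Ioo 0 T
    · have h2 : (fun t => {q : ℝ × ℝ | q.2 ∈ Ioc 0 q.1}.indicator (fun q => deriv φ q.1) (t, s))
          = (Ici s).indicator (deriv φ) := by
        ext t
        simp [indicator, hs.1]
      rw [h2, setIntegral_indicator measurableSet_Ici]
      have h3 : Ioo 0 T ∩ Ici s = Ico s T := by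
        ext t
        simp only [mem_inter_iff, mem_Ioo, mem_Ici, mem_Ico]
        exact ⟨fun h => ⟨h.2, h.1.2⟩, fun h => ⟨⟨hs.1.trans_le h.1, h.2⟩, h.1⟩⟩
      rw [h3, integral_Ico_eq_integral_Ioc, ← intervalIntegral.integral_of_le hs.2.le,
        intervalIntegral.integral_deriv_eq_sub
          (fun x _ => (hφ.smooth.differentiable (by simp)) x) (hd.intervalIntegrable _ _),
        hφ.eq_zero (t := T) (by simp), zero_sub]
    · rw [hφ.eq_zero hs, neg_zero]
      rw [integral_eq_zero_of_ae]
      filter_upwards [ae_restrict_mem measurableSet_Ioo] with t ht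
      simp only [indicator, mem_ofPred_eq, Pi.zero_apply, ite_eq_right_iff]
      intro hst
      exact absurd ⟨hst.1, hst.2.trans_lt ht.2⟩ hs
  · refine Integrable.of_bound (C := C) ?_ (Eventually.of_forall fun q => ?_)
    · exact ((hd.comp continuous_fst).measurable.indicator hmeas).aestronglyMeasurable
    · exact (norm_indicator_le_norm_self (s := {q : ℝ × ℝ | q.2 ∈ Ioc 0 q.1})
        (fun q : ℝ × ℝ => deriv φ q.1) q).trans (hC _)

theorem IsTimeTest.integrable_of_isFiniteMeasure {T : ℝ} {φ : ℝ → ℝ} (hφ : IsTimeTest T φ)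
    (μ : Measure ℝ) [IsFiniteMeasure μ] : Integrable φ μ := by
  obtain ⟨C, hC⟩ := hφ.exists_bound
  exact Integrable.of_bound hφ.smooth.continuous.aestronglyMeasurable C (Eventually.of_forall hC)

/-- The integral against a difference of finite measures can be computed from any
decomposition. -/
theorem integral_jordan_sub {α β : Measure ℝ} [IsFiniteMeasure α] [IsFiniteMeasure β]
    {φ : ℝ → ℝ} (hφ : ∀ μ : Measure ℝ, IsFiniteMeasure μ → Integrable φ μ) :
    ∫ t, φ t ∂(α.toSignedMeasure - β.toSignedMeasure).toJordanDecomposition.posPart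
      - ∫ t, φ t ∂(α.toSignedMeasure - β.toSignedMeasure).toJordanDecomposition.negPart
      = ∫ t, φ t ∂α - ∫ t, φ t ∂β := by
  set D := α.toSignedMeasure - β.toSignedMeasure with hD
  set p := D.toJordanDecomposition.posPart
  set n := D.toJordanDecomposition.negPart
  have h1 : p.toSignedMeasure - n.toSignedMeasure = D :=
    D.toSignedMeasure_toJordanDecomposition
  -- Moving the negative parts across gives an identity of positive measures, which can be
  -- integrated.
  have h2 : p + β = α + n := by
    rw [← Measure.toSignedMeasure_eq_toSignedMeasure_iff, Measure.toSignedMeasure_add,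
      Measure.toSignedMeasure_add]
    exact sub_eq_sub_iff_add_eq_add.1 (h1.trans hD)
  have h3 : ∫ t, φ t ∂(p + β) = ∫ t, φ t ∂(α + n) := by rw [h2]
  rw [integral_add_measure (hφ _ inferInstance) (hφ _ inferInstance),
    integral_add_measure (hφ _ inferInstance) (hφ _ inferInstance)] at h3
  linarith

/-- The absolutely continuous measure with density `g⁺` on `(0, T)`. -/
def posMeas (T : ℝ) (g : ℝ → ℝ) : Measure ℝ :=
  (timeMeas T).withDensity fun t => ENNReal.ofReal (g t)

theorem isFiniteMeasure_posMeas {T : ℝ} {g : ℝ → ℝ} (hg : IntegrableOn g (Ioo 0 T)) :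
    IsFiniteMeasure (posMeas T g) :=
  isFiniteMeasure_withDensity_ofReal hg.2

theorem posMeas_sub_posMeas {T : ℝ} {g : ℝ → ℝ} (hg : IntegrableOn g (Ioo 0 T)) {B : Set ℝ}
    (hB : MeasurableSet B) (hBs : B ⊆ Ioo 0 T) :
    (posMeas T g).real B - (posMeas T (-g)).real B = ∫ t in B, g t := by
  rw [integral_eq_lintegral_pos_part_sub_lintegral_neg_part (hg.mono_set hBs)]
  simp only [posMeas, Measure.real, Pi.neg_apply]
  rw [withDensity_apply _ hB, withDensity_apply _ hB, Measure.restrict_restrict hB,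
    inter_eq_left.2 hBs]

theorem integral_posMeas_sub {T : ℝ} {g φ : ℝ → ℝ} (hg : IntegrableOn g (Ioo 0 T))
    (hφ : IsTimeTest T φ) :
    ∫ t, φ t ∂posMeas T g - ∫ t, φ t ∂posMeas T (-g) = ∫ t in Ioo 0 T, φ t * g t := by
  have h : ∀ k : ℝ → ℝ, IntegrableOn k (Ioo 0 T) →
      ∫ t, φ t ∂posMeas T k = ∫ t in Ioo 0 T, φ t * max (k t) 0 := by
    intro k hk
    rw [posMeas, integral_withDensity_eq_integral_toReal_smul₀ hk.1.aemeasurable.ennreal_ofReal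
      (Eventually.of_forall fun t => ENNReal.ofReal_lt_top)]
    congr 1
    ext t
    rw [smul_eq_mul, mul_comm, ENNReal.toReal_ofReal']
  rw [h g hg, h (-g) hg.neg, ← integral_sub]
  · congr 1
    ext t
    rw [← mul_sub, Pi.neg_apply, max_zero_sub_max_neg_zero_eq_self]
  · exact hφ.integrable_mul hg.pos_part
  · exact hφ.integrable_mul hg.neg.pos_part

/-- With `μ` the Stieltjes measure of `-k`, the function `F = k - prim g` has the derivative `-μ -
g`, so adding `g` leaves `-μ ≤ 0`. -/
theorem derivAddNonpos_of_antitone {T : ℝ} (hT : 0 < T) {F g k : ℝ → ℝ}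
    (hF : IntegrableOn F (Ioo 0 T)) (hg : IntegrableOn g (Ioo 0 T)) (hk : Antitone k)
    (hFk : (fun t => F t + prim g t) =ᵐ[timeMeas T] k) : DerivAddNonpos T F g := by
  have hm : Monotone (fun t => -k t) := hk.neg
  set f := hm.stieltjesFunction with hf
  set μ : Measure ℝ := f.measure.restrict (Ioo 0 T) with hμ
  have : IsFiniteMeasure μ := by
    constructor
    rw [hμ, Measure.restrict_apply_univ, StieltjesFunction.measure_Ioo]
    exact ENNReal.ofReal_lt_top
  have := isFiniteMeasure_posMeas hg
  have := isFiniteMeasure_posMeas hg.neg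
  -- This is `-μ - g`, written as `g⁻ - (μ + g⁺)`, a difference of finite positive measures.
  refine ⟨hg, (posMeas T (-g)).toSignedMeasure - (μ + posMeas T g).toSignedMeasure,
    ⟨hF, fun φ h1 h2 h3 => ?_⟩, fun B hB hBs => ?_⟩
  · have hφ : IsTimeTest T φ := ⟨h1, h2, h3⟩
    rw [integral_jordan_sub fun ρ hρ => hφ.integrable_of_isFiniteMeasure ρ,
      integral_add_measure (hφ.integrable_of_isFiniteMeasure _)
        (hφ.integrable_of_isFiniteMeasure _)]
    have hA := integral_posMeas_sub hg hφ
    have hB := weak_eq_prim hT hF hg hφ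
    have hC := integral_deriv_mul_measure_Ioc (μ := μ) hφ
    have hE : ∫ t in Ioo 0 T, deriv φ t * (F t + prim g t)
        = ∫ t in Ioo 0 T, deriv φ t * (-f 0 - μ.real (Ioc 0 t)) := by
      refine integral_congr_ae ?_
      -- The Stieltjes function is the right limit of `-k`; away from the countably many jumps it is
      -- `-k` itself.
      have hcount : ∀ᵐ t ∂timeMeas T, ContinuousAt (fun t => -k t) t :=
        ae_restrict_of_ae (hm.countable_not_continuousAt.ae_notMem volume |>.mono
          fun t ht => by simpa using ht)
      filter_upwards [hFk, hcount, ae_restrict_mem measurableSet_Ioo] with t ht hc htm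
      rw [ht]
      congr 1
      have e1 : μ.real (Ioc 0 t) = f t - f 0 := by
        have hsub : Ioc 0 t ⊆ Ioo 0 T := fun x hx => ⟨hx.1, hx.2.trans_lt htm.2⟩
        rw [hμ, Measure.real, Measure.restrict_apply measurableSet_Ioc, inter_eq_left.2 hsub,
          StieltjesFunction.measure_Ioc,
          ENNReal.toReal_ofReal (sub_nonneg.2 (f.mono htm.1.le))]
      have e2 : f t = -k t := by
        rw [hf, hm.stieltjesFunction_eq]
        exact hc.continuousWithinAt.rightLim_eq
      rw [e1, e2]
      ring
    rw [hE] at hB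
    have hInt : IntegrableOn (fun t => μ.real (Ioc 0 t)) (Ioo 0 T) := by
      refine Integrable.of_bound (C := μ.real univ) ?_ (Eventually.of_forall fun t => ?_)
      · have : Monotone fun t => μ.real (Ioc 0 t) := fun s t hst =>
          measureReal_mono (Ioc_subset_Ioc_right hst)
        exact this.measurable.aestronglyMeasurable
      · rw [Real.norm_of_nonneg measureReal_nonneg]
        exact measureReal_mono (subset_univ _)
    simp_rw [mul_sub] at hB
    rw [integral_sub (hφ.integrable_deriv_mul (integrable_const _))
      (hφ.integrable_deriv_mul hInt), hC, integral_mul_const] at hB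
    have hz : ∫ t in Ioo 0 T, deriv φ t = 0 := by
      rw [← integral_Ioc_eq_integral_Ioo, ← intervalIntegral.integral_of_le hT.le,
        intervalIntegral.integral_deriv_eq_sub
          (fun x _ => (hφ.smooth.differentiable (by simp)) x)
          (hφ.continuous_deriv.intervalIntegrable _ _),
        hφ.eq_zero (t := T) (by simp), hφ.eq_zero (t := 0) (by simp), sub_zero]
    rw [hz] at hB
    linarith
  · have h1 := posMeas_sub_posMeas hg hB hBs
    rw [Measure.toSignedMeasure_sub_apply hB, measureReal_add_apply]
    have := measureReal_nonneg (μ := μ) (s := B)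
    linarith

/-- Split into positive and negative parts, the hypothesis reads `D⁺ + g⁺ ≤ D⁻ + g⁻` on `(0, T)`,
and positive measures can be integrated against `θ ≥ 0`. The parts of `D` may charge the complement
of `(0, T)`, but `θ` vanishes there. -/
theorem DerivAddNonpos.weakNonpos {T : ℝ} {F g : ℝ → ℝ} (h : DerivAddNonpos T F g) :
    WeakNonpos T F g := by
  obtain ⟨hg, D, ⟨hF, hD⟩, hneg⟩ := h
  intro θ hθ hθ0
  rw [hD θ hθ.smooth hθ.compactSupp hθ.supp_subset, neg_neg]
  have := isFiniteMeasure_posMeas hg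
  have := isFiniteMeasure_posMeas hg.neg
  set p := D.toJordanDecomposition.posPart
  set n := D.toJordanDecomposition.negPart
  have h1 : p.toSignedMeasure - n.toSignedMeasure = D :=
    D.toSignedMeasure_toJordanDecomposition
  have hle : (p + posMeas T g).restrict (Ioo 0 T) ≤ (n + posMeas T (-g)).restrict (Ioo 0 T) := by
    rw [Measure.le_iff]
    intro B hB
    rw [Measure.restrict_apply hB, Measure.restrict_apply hB]
    have hB' := hB.inter (measurableSet_Ioo (a := (0 : ℝ)) (b := T))
    have h2 := hneg _ hB' inter_subset_right
    rw [← h1, Measure.toSignedMeasure_sub_apply hB',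
      ← posMeas_sub_posMeas hg hB' inter_subset_right] at h2
    rw [← ENNReal.toReal_le_toReal (measure_ne_top _ _) (measure_ne_top _ _)]
    change (p + posMeas T g).real _ ≤ (n + posMeas T (-g)).real _
    rw [measureReal_add_apply, measureReal_add_apply]
    linarith
  have hsupp : ∀ ρ : Measure ℝ, ∫ t in Ioo 0 T, θ t ∂ρ = ∫ t, θ t ∂ρ := fun ρ =>
    setIntegral_eq_integral_of_forall_compl_eq_zero fun t ht => hθ.eq_zero ht
  have h3 := integral_mono_measure hle (Eventually.of_forall hθ0)
    (hθ.integrable_of_isFiniteMeasure _)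
  rw [hsupp, hsupp, integral_add_measure (hθ.integrable_of_isFiniteMeasure _)
    (hθ.integrable_of_isFiniteMeasure _), integral_add_measure
    (hθ.integrable_of_isFiniteMeasure _) (hθ.integrable_of_isFiniteMeasure _)] at h3
  have h4 := integral_posMeas_sub hg hθ
  linarith

theorem derivAddNonpos_iff_weakNonpos {T : ℝ} (hT : 0 < T) {F g : ℝ → ℝ}
    (hF : MemLp F ⊤ (timeMeas T)) (hg : IntegrableOn g (Ioo 0 T)) :
    DerivAddNonpos T F g ↔ WeakNonpos T F g := by
  refine ⟨fun h => h.weakNonpos, fun h => ?_⟩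
  obtain ⟨k, hk, hFk⟩ := h.exists_antitone hT hF hg
  exact derivAddNonpos_of_antitone hT (hF.integrable le_top) hg hk hFk

/-- The pointwise form of the inequality `dF/dt + g ≤ 0`, with essential one-sided limits. -/
def LimNonpos (T : ℝ) (F g : ℝ → ℝ) : Prop :=
  ∃ Fr Fl : ℝ → ℝ, (∀ t ∈ Icc 0 T, IsRightLim T F t (Fr t)) ∧
    (∀ t ∈ Icc 0 T, IsLeftLim T F t (Fl t)) ∧
      ∀ s ∈ Icc 0 T, ∀ t ∈ Icc s T, Fr t + ∫ τ in s..t, g τ ≤ Fl s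

/-- A monotone `k` has one-sided limits everywhere and `prim g` is continuous; the null set where `F
≠ k - prim g` is absorbed by the filter `ae volume`. The inequality is then monotonicity of `k`,
applied to one-sided limits at `s` and `t`. -/
theorem limNonpos_of_antitone {T : ℝ} (hT : 0 < T) {F g k : ℝ → ℝ}
    (hg : IntegrableOn g (Ioo 0 T)) (hk : Antitone k)
    (hFk : (fun t => F t + prim g t) =ᵐ[timeMeas T] k) : LimNonpos T F g := by
  have hFk' : ∀ᵐ t, t ∈ Ioo 0 T → F t = k t - prim g t := by
    have := (ae_restrict_iff' measurableSet_Ioo).1 hFk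
    filter_upwards [this] with t ht htm
    linarith [ht htm]
  have hcont := continuousOn_prim hT hg
  have key : ∀ (A : Set ℝ) (t a : ℝ), A ⊆ Ioo 0 T → t ∈ Icc 0 T → Tendsto k (𝓝[A] t) (𝓝 a) →
      Tendsto F (𝓝[A] t ⊓ ae volume) (𝓝 (a - prim g t)) := by
    intro A t a hA ht hka
    have hp : Tendsto (prim g) (𝓝[A] t) (𝓝 (prim g t)) :=
      (hcont t ht).mono_left (nhdsWithin_mono _ (hA.trans Ioo_subset_Icc_self))
    refine ((hka.sub hp).mono_left inf_le_left).congr' ?_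
    have h1 : ∀ᶠ x in 𝓝[A] t, x ∈ A := self_mem_nhdsWithin
    filter_upwards [h1.filter_mono inf_le_left, hFk'.filter_mono inf_le_right] with x hx hx2
    exact (hx2 (hA hx)).symm
  have hright : ∀ t, Tendsto k (𝓝[>] t) (𝓝 (Function.rightLim k t)) := hk.tendsto_rightLim
  have hleft : ∀ t, Tendsto k (𝓝[<] t) (𝓝 (Function.leftLim k t)) := hk.tendsto_leftLim
  refine ⟨fun t => (if t < T then Function.rightLim k t else Function.leftLim k t) - prim g t,
    fun t => (if 0 < t then Function.leftLim k t else Function.rightLim k t) - prim g t,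
    fun t ht => ?_, fun t ht => ?_, fun s hs t ht => ?_⟩
  · unfold IsRightLim
    split_ifs with h
    · simp only [if_pos h]
      exact key _ _ _ (Ioo_subset_Ioo_left ht.1) ht
        ((hright t).mono_left (nhdsWithin_mono _ Ioo_subset_Ioi_self))
    · obtain rfl : t = T := le_antisymm ht.2 (not_lt.1 h)
      simp only [if_neg h]
      exact key _ _ _ Subset.rfl ht
        ((hleft t).mono_left (nhdsWithin_mono _ Ioo_subset_Iio_self))
  · unfold IsLeftLim
    split_ifs with h
    · simp only [if_pos h]
      exact key _ _ _ (Ioo_subset_Ioo_right ht.2) ht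
        ((hleft t).mono_left (nhdsWithin_mono _ Ioo_subset_Iio_self))
    · obtain rfl : t = 0 := le_antisymm (not_lt.1 h) ht.1
      simp only [if_neg h]
      exact key _ _ _ Subset.rfl ht
        ((hright 0).mono_left (nhdsWithin_mono _ Ioo_subset_Ioi_self))
  · have ht' : t ∈ Icc 0 T := ⟨hs.1.trans ht.1, ht.2⟩
    rw [prim_sub hg hs ht']
    have : (if t < T then Function.rightLim k t else Function.leftLim k t)
        ≤ if 0 < s then Function.leftLim k s else Function.rightLim k s := by
      split_ifs with h1 h2 h2
      · exact hk.rightLim_le_leftLim ht.1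
      · exact hk.rightLim ht.1
      · exact hk.leftLim ht.1
      -- Here `s = 0` and `t = T`, with both limits taken from inside the interval; this uses `0 <
      -- T`.
      · exact hk.leftLim_le_rightLim (by linarith [hs.1])
    linarith

/-- The essential limits are tied back to `F` through its primitive: an essential one-sided limit of
`F` is a one-sided derivative of `∫ F`, whereas `∫ F` has derivative `F` almost everywhere. Hence
`Fr = F = Fl` a.e., and the inequality becomes monotonicity of `F + prim g` on a set of full
measure. -/
theorem LimNonpos.exists_antitone {T : ℝ} (hT : 0 < T) {F g : ℝ → ℝ}
    (hF : MemLp F ⊤ (timeMeas T)) (hg : IntegrableOn g (Ioo 0 T)) (h : LimNonpos T F g) :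
    ∃ k : ℝ → ℝ, Antitone k ∧ (fun t => F t + prim g t) =ᵐ[timeMeas T] k := by
  obtain ⟨Fr, Fl, hr, hl, hle⟩ := h
  obtain ⟨C₁, hC₁⟩ := hF.exists_ae_bound
  obtain ⟨C₂, hC₂⟩ := exists_prim_bound hT hg
  have hFi : IntegrableOn F (Ioo 0 T) := hF.integrable le_top
  have hFint : IntervalIntegrable F volume 0 T :=
    (intervalIntegrable_iff_integrableOn_Ioo_of_le hT.le).2 hFi
  have hII : ∀ t ∈ Ioo 0 T, IntervalIntegrable F volume 0 t := fun t ht =>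
    hFint.mono_set (by rw [uIcc_of_le hT.le, uIcc_of_le ht.1.le]; exact Icc_subset_Icc_right ht.2.le)
  have hmeas : ∀ t ∈ Ioo 0 T, StronglyMeasurableAtFilter F (𝓝 t) := fun t ht =>
    ⟨Ioo 0 T, Ioo_mem_nhds ht.1 ht.2, hFi.1⟩
  refine exists_antitone_of_antitoneOn (C := C₁ + C₂)
    (S := {t | t ∈ Ioo 0 T ∧ ‖F t‖ ≤ C₁ ∧ F t = Fr t ∧ F t = Fl t}) ?_ ?_ ?_
  · intro s hs t ht hst
    have h1 := hle s (Ioo_subset_Icc_self hs.1) t ⟨hst, ht.1.2.le⟩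
    rw [prim_sub hg (Ioo_subset_Icc_self hs.1) (Ioo_subset_Icc_self ht.1), ← ht.2.2.1,
      ← hs.2.2.2] at h1
    simp only
    linarith
  · intro t ht
    exact (norm_add_le _ _).trans (add_le_add ht.2.1 (hC₂ t (Ioo_subset_Icc_self ht.1)))
  · filter_upwards [hC₁, ae_restrict_mem measurableSet_Ioo,
      ae_restrict_of_ae hFint.ae_hasDerivAt_integral] with t ht1 ht2 ht3
    have hd := ht3 (by rw [uIcc_of_le hT.le]; exact Ioo_subset_Icc_self ht2) 0 (by simp)
    refine ⟨ht2, ht1, ?_, ?_⟩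
    · have h2 := hr t (Ioo_subset_Icc_self ht2)
      rw [IsRightLim, if_pos ht2.2, nhdsWithin_Ioo_eq_nhdsGT ht2.2] at h2
      have h3 := intervalIntegral.integral_hasDerivWithinAt_of_tendsto_ae_right (s := Ici t)
        (t := Ioi t) (hII t ht2) ((hmeas t ht2).filter_mono nhdsWithin_le_nhds) h2
      exact (uniqueDiffWithinAt_Ici t).eq_deriv _ hd.hasDerivWithinAt h3
    · have h2 := hl t (Ioo_subset_Icc_self ht2)
      rw [IsLeftLim, if_pos ht2.1, nhdsWithin_Ioo_eq_nhdsLT ht2.1] at h2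
      -- The derivative from the left is formulated with `𝓝[≤] t`; the point `t` itself is a null
      -- set and can be discarded.
      have hfil : 𝓝[≤] t ⊓ ae volume ≤ 𝓝[<] t := by
        refine le_inf (inf_le_left.trans nhdsWithin_le_nhds) (le_principal_iff.2 ?_)
        have e1 : ∀ᶠ x in 𝓝[≤] t, x ≤ t := self_mem_nhdsWithin
        have e2 : ∀ᵐ x, x ≠ t := by simp [ae_iff, measure_singleton]
        filter_upwards [e1.filter_mono inf_le_left, e2.filter_mono inf_le_right] with x hx hx'
        exact lt_of_le_of_ne hx hx'
      have h3 := intervalIntegral.integral_hasDerivWithinAt_of_tendsto_ae_right (s := Iic t)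
        (t := Iic t) (hII t ht2) ((hmeas t ht2).filter_mono nhdsWithin_le_nhds)
        (h2.mono_left (le_inf hfil inf_le_right))
      exact (uniqueDiffWithinAt_Iic t).eq_deriv _ hd.hasDerivWithinAt h3

theorem limNonpos_iff_weakNonpos {T : ℝ} (hT : 0 < T) {F g : ℝ → ℝ}
    (hF : MemLp F ⊤ (timeMeas T)) (hg : IntegrableOn g (Ioo 0 T)) :
    LimNonpos T F g ↔ WeakNonpos T F g := by
  constructor
  · intro h
    obtain ⟨k, hk, hFk⟩ := h.exists_antitone hT hF hg
    exact (derivAddNonpos_of_antitone hT (hF.integrable le_top) hg hk hFk).weakNonpos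
  · intro h
    obtain ⟨k, hk, hFk⟩ := h.exists_antitone hT hF hg
    exact limNonpos_of_antitone hT hg hk hFk

/-! ### Weak gradients -/

section WeakGradients

variable {d : ℕ} {Ω : Set (Vec d)}

/-- Classical divergence of a vector field. -/
def divField (Φ : Vec d → Vec d) (x : Vec d) : ℝ :=
  ∑ i, fderiv ℝ Φ x (EuclideanSpace.single i 1) i

theorem sum_fderiv_single {η : Vec d → ℝ} (x a : Vec d) :
    ∑ i, fderiv ℝ η x (EuclideanSpace.single i 1) * a i = fderiv ℝ η x a := by
  have ha : a = ∑ i, a i • EuclideanSpace.single i (1 : ℝ) := by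
    ext j
    simp [Finset.sum_apply, Pi.single_apply]
  conv_rhs => rw [ha, map_sum]
  simp [mul_comm]

theorem divField_smul {η : Vec d → ℝ} {Φ : Vec d → Vec d} {x : Vec d}
    (hη : DifferentiableAt ℝ η x) (hΦ : DifferentiableAt ℝ Φ x) :
    divField (fun y => η y • Φ y) x = fderiv ℝ η x (Φ x) + η x * divField Φ x := by
  unfold divField
  rw [fderiv_fun_smul hη hΦ, Finset.mul_sum, ← sum_fderiv_single x (Φ x),
    ← Finset.sum_add_distrib]
  refine Finset.sum_congr rfl fun i _ => ?_
  simp [add_comm]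

theorem fderiv_coord {Φ : Vec d → Vec d} {x : Vec d} (hΦ : DifferentiableAt ℝ Φ x)
    (i : Fin d) (a : Vec d) : fderiv ℝ (fun y => Φ y i) x a = fderiv ℝ Φ x a i := by
  have h := ((EuclideanSpace.proj i : Vec d →L[ℝ] ℝ).hasFDerivAt.comp x hΦ.hasFDerivAt).fderiv
  have h2 : (fun y => Φ y i) = (EuclideanSpace.proj i : Vec d →L[ℝ] ℝ) ∘ Φ := rfl
  rw [h2, h]
  rfl

theorem contDiff_coord {Φ : Vec d → Vec d} (hΦ : ContDiff ℝ ∞ Φ) (i : Fin d) :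
    ContDiff ℝ ∞ fun y => Φ y i :=
  (EuclideanSpace.proj i : Vec d →L[ℝ] ℝ).contDiff.comp hΦ

theorem hasCompactSupport_coord {Φ : Vec d → Vec d} (hΦ : HasCompactSupport Φ) (i : Fin d) :
    HasCompactSupport fun y => Φ y i :=
  hΦ.comp_left (g := fun z : Vec d => z i) rfl

theorem tsupport_coord_subset (Φ : Vec d → Vec d) (i : Fin d) :
    tsupport (fun y => Φ y i) ⊆ tsupport Φ :=
  closure_mono fun x hx h => hx (by simp [h])

theorem TestField.bounded (Φ : TestField Ω) : ∃ C, ∀ x, ‖Φ.toFun x‖ ≤ C :=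
  Φ.smooth.continuous.bounded_above_of_compact_support Φ.compactSupp

theorem continuous_fderiv_apply {η : Vec d → ℝ} (hη : ContDiff ℝ ∞ η) (a : Vec d) :
    Continuous fun x => fderiv ℝ η x a := by
  have h := hη.continuous_fderiv (by simp)
  fun_prop

theorem exists_bound_fderiv {η : Vec d → ℝ} (hη : ContDiff ℝ ∞ η) (hc : HasCompactSupport η) :
    ∃ C, ∀ x, ‖fderiv ℝ η x‖ ≤ C :=
  (hη.continuous_fderiv (by simp)).bounded_above_of_compact_support (hc.fderiv (𝕜 := ℝ))

theorem integrable_mul_bounded {w η : Vec d → ℝ} (hw : IntegrableOn w Ω) (hη : Continuous η)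
    {C : ℝ} (hC : ∀ x, ‖η x‖ ≤ C) : IntegrableOn (fun x => w x * η x) Ω :=
  hw.mul_bdd (c := C) hη.aestronglyMeasurable (Eventually.of_forall hC)

/-- Weak derivatives tested against smooth vector fields. -/
theorem integral_mul_divField {w : Vec d → ℝ} {G : Vec d → Vec d} (hw : IntegrableOn w Ω)
    (hG : ∀ j, IntegrableOn (fun x => G x j) Ω)
    (h : ∀ j, HasWeakPartial Ω w (fun x => G x j) j) (Φ : TestField Ω) :
    ∫ x in Ω, w x * divField Φ.toFun x = -∫ x in Ω, ∑ j, G x j * Φ.toFun x j := by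
  obtain ⟨C, hC⟩ := Φ.bounded
  have hd : Differentiable ℝ Φ.toFun := Φ.smooth.differentiable (by simp)
  have h1 : ∀ j, ∫ x in Ω, w x * fderiv ℝ Φ.toFun x (EuclideanSpace.single j 1) j
      = -∫ x in Ω, G x j * Φ.toFun x j := by
    intro j
    have := h j (fun x => Φ.toFun x j) (contDiff_coord Φ.smooth j)
      (hasCompactSupport_coord Φ.compactSupp j)
      ((tsupport_coord_subset _ j).trans Φ.supp_subset)
    simpa only [fderiv_coord (hd _)] using this
  unfold divField
  simp_rw [Finset.mul_sum]
  rw [integral_finsetSum, integral_finsetSum, ← Finset.sum_neg_distrib]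
  · exact Finset.sum_congr rfl fun j _ => h1 j
  · intro j _
    refine integrable_mul_bounded (hG j) (contDiff_coord Φ.smooth j).continuous (C := C)
      fun x => (PiLp.norm_apply_le _ _).trans (hC x)
  · intro j _
    obtain ⟨C', hC'⟩ := exists_bound_fderiv (contDiff_coord Φ.smooth j)
      (hasCompactSupport_coord Φ.compactSupp j)
    simp_rw [← fderiv_coord (hd _)]
    refine integrable_mul_bounded hw
      (continuous_fderiv_apply (contDiff_coord Φ.smooth j) _) (C := C') fun x => ?_
    refine ((fderiv ℝ (fun y => Φ.toFun y j) x).le_opNorm _).trans ?_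
    simpa using hC' x

/-- A scalar multiple of a smooth vector field as a test field. -/
def TestField.smulField (Φ : TestField Ω) {η : Vec d → ℝ} (hη : ContDiff ℝ ∞ η) : TestField Ω where
  toFun x := η x • Φ.toFun x
  smooth := ContDiff.smul hη Φ.smooth
  compactSupp := HasCompactSupport.smul_left (f := η) Φ.compactSupp
  supp_subset := (closure_mono (Function.support_smul_subset_right η _)).trans Φ.supp_subset

theorem SolField.divField_eq (φ : SolField Ω) (x : Vec d) : divField φ.toFun x = 0 := φ.div_free x

/-- Product of a smooth function and a solenoidal field, tested against a weak gradient. -/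
theorem integral_mul_fderiv_solField {w : Vec d → ℝ} {G : Vec d → Vec d} (hw : IntegrableOn w Ω)
    (hG : ∀ j, IntegrableOn (fun x => G x j) Ω)
    (h : ∀ j, HasWeakPartial Ω w (fun x => G x j) j) (φ : SolField Ω) {η : Vec d → ℝ}
    (hη : ContDiff ℝ ∞ η) :
    ∫ x in Ω, w x * fderiv ℝ η x (φ.toFun x)
      = -∫ x in Ω, η x * ∑ j, G x j * φ.toFun x j := by
  have h1 := integral_mul_divField hw hG h (φ.toTestField.smulField hη)
  -- Since `div φ = 0`, the divergence of `η φ` is the derivative of `η` along `φ`.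
  have h2 : ∀ x, divField (φ.toTestField.smulField hη).toFun x = fderiv ℝ η x (φ.toFun x) := by
    intro x
    change divField (fun y => η y • φ.toFun y) x = _
    rw [divField_smul (hη.differentiable (by simp) x) (φ.smooth.differentiable (by simp) x),
      φ.divField_eq, mul_zero, add_zero]
  simp_rw [h2] at h1
  rw [h1]
  congr 2
  ext x
  rw [Finset.mul_sum]
  refine Finset.sum_congr rfl fun j _ => ?_
  change G x j * (η x * φ.toFun x j) = _
  ring

/-- The convolution identity for weak derivatives: if the ball of radius of the mollifier around
`x` is contained in `Ω`, then derivatives can be moved onto the weak gradient. -/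
theorem integral_mul_fderiv_mker {w : Vec d → ℝ} {G : Vec d → Vec d} (hw : IntegrableOn w Ω)
    (hG : ∀ j, IntegrableOn (fun x => G x j) Ω)
    (h : ∀ j, HasWeakPartial Ω w (fun x => G x j) j) {n : ℕ} {x : Vec d}
    (hx : Metric.closedBall x (moll (Vec d) n).rOut ⊆ Ω) (a : Vec d) :
    ∫ y in Ω, w y * fderiv ℝ (mker (Vec d) n) (x - y) a
      = ∫ y in Ω, mker (Vec d) n (x - y) * ∑ j, G y j * a j := by
  have hsm : ContDiff ℝ ∞ fun y => mker (Vec d) n (x - y) :=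
    (contDiff_mker n).comp (contDiff_const.sub contDiff_id)
  have hsupp : tsupport (fun y => mker (Vec d) n (x - y) • a)
      ⊆ Metric.closedBall x (moll (Vec d) n).rOut := by
    refine closure_minimal (fun y hy => ?_) Metric.isClosed_closedBall
    by_contra hy'
    apply hy
    rw [Metric.mem_closedBall, not_le, dist_comm, dist_eq_norm] at hy'
    simp [mker_eq_zero hy'.le]
  let Φ : TestField Ω :=
    { toFun := fun y => mker (Vec d) n (x - y) • a
      smooth := hsm.smul contDiff_const
      compactSupp := HasCompactSupport.of_support_subset_isCompact
        (isCompact_closedBall x (moll (Vec d) n).rOut) ((subset_tsupport _).trans hsupp)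
      supp_subset := hsupp.trans hx }
  have h1 := integral_mul_divField hw hG h Φ
  have h2 : ∀ y, divField Φ.toFun y = -fderiv ℝ (mker (Vec d) n) (x - y) a := by
    intro y
    change divField (fun y => mker (Vec d) n (x - y) • (fun _ => a) y) y = _
    rw [divField_smul (hsm.differentiable (by simp) y) (differentiableAt_const _)]
    have h3 : fderiv ℝ (fun y => mker (Vec d) n (x - y)) y
        = -fderiv ℝ (mker (Vec d) n) (x - y) := by
      have h4 := (hasFDerivAt_id (𝕜 := ℝ) y).const_sub x
      have h5 := ((contDiff_mker (E := Vec d) n).differentiable (by simp)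
        (x - y)).hasFDerivAt.comp y h4
      refine h5.fderiv.trans ?_
      ext a
      simp
    rw [h3]
    simp [divField]
  simp_rw [h2, mul_neg, integral_neg] at h1
  rw [neg_inj] at h1
  rw [h1]
  congr 1
  ext y
  rw [Finset.mul_sum]
  refine Finset.sum_congr rfl fun j _ => ?_
  change G y j * (mker (Vec d) n (x - y) * a j) = _
  ring

/-- A bounded function with a bounded weak gradient is transported skew-symmetrically by
solenoidal fields. -/
theorem integral_solField_mul_grad_mul (hΩ : IsOpen Ω) (hΩb : Bornology.IsBounded Ω)
    {w : Vec d → ℝ} {G : Vec d → Vec d} (hw : MemLp w ⊤ (volume.restrict Ω))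
    (hG : MemLp G ⊤ (volume.restrict Ω))
    (h : ∀ j, HasWeakPartial Ω w (fun x => G x j) j) (φ : SolField Ω) :
    ∫ x in Ω, w x * ∑ j, G x j * φ.toFun x j = 0 := by
  have hfin : IsFiniteMeasure (volume.restrict Ω) :=
    ⟨by rw [Measure.restrict_apply_univ]; exact hΩb.measure_lt_top⟩
  have hwi : IntegrableOn w Ω := hw.integrable le_top
  have hGi : IntegrableOn G Ω := hG.integrable le_top
  have hGj : ∀ j, IntegrableOn (fun x => G x j) Ω := fun j =>
    (EuclideanSpace.proj j : Vec d →L[ℝ] ℝ).integrable_comp hGi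
  obtain ⟨Cw, hCw⟩ := hw.exists_ae_bound
  obtain ⟨CG, hCG⟩ := hG.exists_ae_bound
  obtain ⟨Cφ, hCφ⟩ := φ.toTestField.bounded
  set ρ := mker (Vec d) with hρ
  set w₀ := Ω.indicator w with hw₀
  set G₀ := Ω.indicator G with hG₀
  have hw₀i : Integrable w₀ := (integrable_indicator_iff hΩ.measurableSet).2 hwi
  have hG₀i : Integrable G₀ := (integrable_indicator_iff hΩ.measurableSet).2 hGi
  have hCw₀ : ∀ᵐ y, ‖w₀ y‖ ≤ max Cw 0 := by
    filter_upwards [(ae_restrict_iff' hΩ.measurableSet).1 hCw] with y hy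
    by_cases hyΩ : y ∈ Ω
    · rw [hw₀, indicator_of_mem hyΩ]; exact (hy hyΩ).trans (le_max_left _ _)
    · rw [hw₀, indicator_of_notMem hyΩ]; simp
  have hCG₀ : ∀ᵐ y, ‖G₀ y‖ ≤ max CG 0 := by
    filter_upwards [(ae_restrict_iff' hΩ.measurableSet).1 hCG] with y hy
    by_cases hyΩ : y ∈ Ω
    · rw [hG₀, indicator_of_mem hyΩ]; exact (hy hyΩ).trans (le_max_left _ _)
    · rw [hG₀, indicator_of_notMem hyΩ]; simp
  have hsum : ∀ a b : Vec d, ∑ j, a j * b j = inner ℝ b a := fun a b => by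
    simp [PiLp.inner_apply]
  have hinner : ∀ (x y : Vec d), inner ℝ (φ.toFun x) (G₀ y)
      = Ω.indicator (fun y => inner ℝ (φ.toFun x) (G y)) y := by
    intro x y
    by_cases hy : y ∈ Ω
    · rw [hG₀, indicator_of_mem hy, indicator_of_mem hy]
    · rw [hG₀, indicator_of_notMem hy, indicator_of_notMem hy, inner_zero_right]
  have hφc := φ.smooth.continuous
  obtain ⟨δ, hδ, hδΩ⟩ := φ.compactSupp.isCompact.exists_cthickening_subset_open hΩ φ.supp_subset
  -- Mollifying `G` or mollifying `w` gives two approximations of the integral of `w φ · G`. For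
  -- large `n` they are negatives of each other, so the limit is zero.
  have hlim1 : Tendsto (fun n => ∫ x in Ω, w x * inner ℝ (φ.toFun x)
      (∫ y, ρ n (x - y) • G₀ y)) atTop (𝓝 (∫ x in Ω, w x * inner ℝ (φ.toFun x) (G x))) := by
    refine tendsto_integral_of_dominated_convergence (fun x => ‖w x‖ * (Cφ * max CG 0))
      (fun n => ?_) (hwi.norm.mul_const _) (fun n => ?_) ?_
    · refine hwi.1.mul (hφc.aestronglyMeasurable.inner ?_)
      have : Continuous fun x => ∫ y, ρ n (x - y) • G₀ y := by
        have := (hasCompactSupport_mker (E := Vec d) n).continuous_convolution_left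
          (ContinuousLinearMap.lsmul ℝ ℝ) (continuous_mker n) hG₀i.locallyIntegrable
        refine this.congr fun x => ?_
        rw [convolution_eq_swap]
        rfl
      exact this.aestronglyMeasurable
    · refine Eventually.of_forall fun x => ?_
      rw [norm_mul]
      refine mul_le_mul_of_nonneg_left ((norm_inner_le_norm _ _).trans ?_) (norm_nonneg _)
      exact mul_le_mul (hCφ x) (norm_mollification_le hCG₀ n x) (norm_nonneg _)
        ((norm_nonneg _).trans (hCφ x))
    · filter_upwards [ae_restrict_of_ae (ae_tendsto_mollification hG₀i.locallyIntegrable),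
        ae_restrict_mem hΩ.measurableSet] with x hx hxΩ
      rw [hG₀, indicator_of_mem hxΩ] at hx
      exact (tendsto_const_nhds.inner hx).const_mul _
  have hlim2 : Tendsto (fun n => ∫ x in Ω, inner ℝ (φ.toFun x) (G x) *
      (∫ y, ρ n (x - y) • w₀ y)) atTop (𝓝 (∫ x in Ω, inner ℝ (φ.toFun x) (G x) * w x)) := by
    have hInt : IntegrableOn (fun x => inner ℝ (φ.toFun x) (G x)) Ω := by
      refine (hGi.norm.const_mul Cφ).mono' (hφc.aestronglyMeasurable.inner hGi.1)
        (Eventually.of_forall fun x => (norm_inner_le_norm _ _).trans ?_)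
      exact mul_le_mul_of_nonneg_right (hCφ x) (norm_nonneg _)
    refine tendsto_integral_of_dominated_convergence
      (fun x => ‖inner ℝ (φ.toFun x) (G x)‖ * max Cw 0)
      (fun n => ?_) (hInt.norm.mul_const _) (fun n => ?_) ?_
    · refine hInt.1.mul ?_
      have : Continuous fun x => ∫ y, ρ n (x - y) • w₀ y := by
        have := (hasCompactSupport_mker (E := Vec d) n).continuous_convolution_left
          (ContinuousLinearMap.lsmul ℝ ℝ) (continuous_mker n) hw₀i.locallyIntegrable
        refine this.congr fun x => ?_
        rw [convolution_eq_swap]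
        rfl
      exact this.aestronglyMeasurable
    · refine Eventually.of_forall fun x => ?_
      rw [norm_mul]
      exact mul_le_mul_of_nonneg_left (norm_mollification_le hCw₀ n x) (norm_nonneg _)
    · filter_upwards [ae_restrict_of_ae (ae_tendsto_mollification hw₀i.locallyIntegrable),
        ae_restrict_mem hΩ.measurableSet] with x hx hxΩ
      rw [hw₀, indicator_of_mem hxΩ] at hx
      exact hx.const_mul _
  -- The mollified `G` is rewritten as `w` against the derivative of the kernel. After exchanging
  -- the integrals, that derivative is moved onto the other factor `w` with the help of `div φ = 0`,
  -- at the cost of a sign. For large `n` the kernel around any point of the support of `φ` stays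
  -- inside `Ω`.
  have heq : ∀ᶠ n in atTop, ∫ x in Ω, w x * inner ℝ (φ.toFun x) (∫ y, ρ n (x - y) • G₀ y)
      = -∫ x in Ω, inner ℝ (φ.toFun x) (G x) * (∫ y, ρ n (x - y) • w₀ y) := by
    filter_upwards [(tendsto_moll_rOut (Vec d)).eventually_lt_const hδ] with n hn
    obtain ⟨Cρ, hCρ⟩ := exists_bound_fderiv (contDiff_mker (E := Vec d) n)
      (hasCompactSupport_mker n)
    obtain ⟨Cρ', hCρ'⟩ := exists_mker_bound (E := Vec d) n
    have hdc := (contDiff_mker (E := Vec d) n).continuous_fderiv (by simp)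
    have hball : ∀ x ∈ tsupport φ.toFun,
        Metric.closedBall x (moll (Vec d) n).rOut ⊆ Ω := fun x hx =>
      ((Metric.closedBall_subset_cthickening hx _).trans
        (Metric.cthickening_mono hn.le _)).trans hδΩ
    have hA : ∀ x, inner ℝ (φ.toFun x) (∫ y, ρ n (x - y) • G₀ y)
        = ∫ y in Ω, w y * fderiv ℝ (ρ n) (x - y) (φ.toFun x) := by
      intro x
      have hi : Integrable fun y => ρ n (x - y) • G₀ y := by
        refine hG₀i.bdd_smul Cρ' ?_ (Eventually.of_forall fun y => hCρ' _)
        exact ((continuous_mker n).comp (continuous_const.sub continuous_id)).aestronglyMeasurable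
      by_cases hx : x ∈ tsupport φ.toFun
      · rw [integral_mul_fderiv_mker hwi hGj h (hball x hx), ← integral_inner hi,
          ← integral_indicator hΩ.measurableSet]
        congr 1
        ext y
        rw [indicator_mul_right, inner_smul_right, hinner]
        simp only [hsum, hρ]
      · rw [image_eq_zero_of_notMem_tsupport hx]
        simp
    have hB : ∀ x, inner ℝ (φ.toFun x) (G x) * (∫ y, ρ n (x - y) • w₀ y)
        = ∫ y in Ω, w y * (ρ n (x - y) * inner ℝ (φ.toFun x) (G x)) := by
      intro x
      rw [← integral_const_mul, ← integral_indicator hΩ.measurableSet]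
      congr 1
      ext y
      by_cases hy : y ∈ Ω
      · simp only [hw₀, indicator_of_mem hy, smul_eq_mul]; ring
      · simp only [hw₀, indicator_of_notMem hy, smul_zero, mul_zero]
    simp_rw [hA, hB, ← integral_const_mul]
    have hF1 : Integrable (Function.uncurry fun x y => w y * (ρ n (x - y) *
        inner ℝ (φ.toFun x) (G x))) ((volume.restrict Ω).prod (volume.restrict Ω)) := by
      refine Integrable.mono' (g := fun q : Vec d × Vec d => (Cρ' * Cφ) * (‖G q.1‖ * ‖w q.2‖))
        ((hGi.norm.mul_prod hwi.norm).const_mul _) ?_ (Eventually.of_forall fun q => ?_)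
      · refine hwi.1.comp_snd.mul (AEStronglyMeasurable.mul ?_ ?_)
        · exact ((continuous_mker n).comp
            (continuous_fst.sub continuous_snd)).aestronglyMeasurable
        · exact ((hφc.comp continuous_fst).aestronglyMeasurable).inner hGi.1.comp_fst
      · simp only [Function.uncurry, norm_mul]
        have e1 := hCρ' (q.1 - q.2)
        have e2 : ‖inner ℝ (φ.toFun q.1) (G q.1)‖ ≤ Cφ * ‖G q.1‖ :=
          (norm_inner_le_norm _ _).trans (mul_le_mul_of_nonneg_right (hCφ _) (norm_nonneg _))
        have e3 : ‖ρ n (q.1 - q.2)‖ * ‖inner ℝ (φ.toFun q.1) (G q.1)‖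
            ≤ Cρ' * (Cφ * ‖G q.1‖) :=
          mul_le_mul e1 e2 (norm_nonneg _) ((norm_nonneg _).trans e1)
        calc _ ≤ ‖w q.2‖ * (Cρ' * (Cφ * ‖G q.1‖)) :=
              mul_le_mul_of_nonneg_left e3 (norm_nonneg _)
          _ = _ := by ring
    have hF2 : Integrable (Function.uncurry fun x y => w x * (w y *
        fderiv ℝ (ρ n) (x - y) (φ.toFun x)))
        ((volume.restrict Ω).prod (volume.restrict Ω)) := by
      refine Integrable.mono' (g := fun q : Vec d × Vec d => (Cρ * Cφ) * (‖w q.1‖ * ‖w q.2‖))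
        ((hwi.norm.mul_prod hwi.norm).const_mul _) ?_ (Eventually.of_forall fun q => ?_)
      · refine hwi.1.comp_fst.mul (hwi.1.comp_snd.mul ?_)
        have : Continuous fun q : Vec d × Vec d => fderiv ℝ (ρ n) (q.1 - q.2) (φ.toFun q.1) :=
          (hdc.comp (continuous_fst.sub continuous_snd)).clm_apply (hφc.comp continuous_fst)
        exact this.aestronglyMeasurable
      · simp only [Function.uncurry, norm_mul]
        have e1 : ‖fderiv ℝ (ρ n) (q.1 - q.2) (φ.toFun q.1)‖ ≤ Cρ * Cφ :=
          ((fderiv ℝ (ρ n) (q.1 - q.2)).le_opNorm _).trans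
            (mul_le_mul (hCρ _) (hCφ _) (norm_nonneg _) ((norm_nonneg _).trans (hCρ 0)))
        calc _ ≤ ‖w q.1‖ * (‖w q.2‖ * (Cρ * Cφ)) :=
              mul_le_mul_of_nonneg_left (mul_le_mul_of_nonneg_left e1 (norm_nonneg _))
                (norm_nonneg _)
          _ = _ := by ring
    rw [integral_integral_swap hF1, integral_integral_swap hF2, ← integral_neg]
    refine integral_congr_ae (Eventually.of_forall fun y => ?_)
    have h1 := integral_mul_fderiv_solField hwi hGj h φ
      (η := fun x => ρ n (x - y)) ((contDiff_mker n).comp (contDiff_id.sub contDiff_const))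
    have h2 : ∀ x, fderiv ℝ (fun x => ρ n (x - y)) x = fderiv ℝ (ρ n) (x - y) := fun x =>
      fderiv_comp_sub y
    simp_rw [h2, hsum] at h1
    simp only [integral_const_mul]
    have h3 : ∀ x, w x * (w y * fderiv ℝ (ρ n) (x - y) (φ.toFun x))
        = w y * (w x * fderiv ℝ (ρ n) (x - y) (φ.toFun x)) := fun x => by ring
    simp_rw [h3, integral_const_mul]
    rw [h1, mul_neg]
  have hfin2 := tendsto_nhds_unique (hlim1.congr' heq) hlim2.neg
  simp_rw [hsum]
  have h5 : ∀ x, inner ℝ (φ.toFun x) (G x) * w x = w x * inner ℝ (φ.toFun x) (G x) :=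
    fun x => mul_comm _ _
  simp_rw [h5] at hfin2
  linarith

end WeakGradients

/-- The inner product of a real space as a continuous bilinear form. -/
def innerB (E : Type*) [NormedAddCommGroup E] [InnerProductSpace ℝ E] : E →L[ℝ] E →L[ℝ] ℝ :=
  innerSL ℝ

theorem innerB_apply {E : Type*} [NormedAddCommGroup E] [InnerProductSpace ℝ E] (x y : E) :
    innerB E x y = inner ℝ x y := rfl

/-! ### Weak gradients of square integrable fields -/

section FunctionSpaces

variable {d : ℕ} {Ω : Set (Vec d)}

theorem isFiniteMeasure_restrict (hΩb : Bornology.IsBounded Ω) :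
    IsFiniteMeasure (volume.restrict Ω) :=
  ⟨by rw [Measure.restrict_apply_univ]; exact hΩb.measure_lt_top⟩

theorem memLp_single {ι : Type*} [Fintype ι] [DecidableEq ι] {η : Vec d → ℝ}
    (hη : Continuous η) (hc : HasCompactSupport η) (k : ι) :
    MemLp (fun x => EuclideanSpace.single k (η x)) 2 (volume.restrict Ω) := by
  have h : Continuous fun r : ℝ => EuclideanSpace.single k r :=
    (PiLp.continuous_toLp 2 _).comp (continuous_single (A := fun _ => ℝ) k)
  exact (h.comp hη).memLp_of_hasCompactSupport (hc.comp_left (by simp))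

theorem inner_toLp_single {ι : Type*} [Fintype ι] [DecidableEq ι] {η : Vec d → ℝ}
    (hη : Continuous η) (hc : HasCompactSupport η) (k : ι)
    (u : Lp (EuclideanSpace ℝ ι) 2 (volume.restrict Ω)) :
    inner ℝ (memLp_single hη hc k).toLp u = ∫ x in Ω, u x k * η x := by
  rw [L2.inner_def]
  refine integral_congr_ae ?_
  filter_upwards [(memLp_single (Ω := Ω) hη hc k).coeFn_toLp] with x hx
  rw [hx, EuclideanSpace.inner_single_left]
  simp [mul_comm]

theorem hasCompactSupport_fderiv_apply {η : Vec d → ℝ} (hc : HasCompactSupport η) (a : Vec d) :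
    HasCompactSupport fun x => fderiv ℝ η x a :=
  (hc.fderiv (𝕜 := ℝ)).comp_left (g := fun L : Vec d →L[ℝ] ℝ => L a) rfl

/-- The functional on `L² × L²` which vanishes on pairs of a field and its weak gradient. -/
def weakFunctional (Ω : Set (Vec d)) {η : Vec d → ℝ} (hη : ContDiff ℝ ∞ η)
    (hc : HasCompactSupport η) (i j : Fin d) : (L2 Ω × L2Mat Ω) →L[ℝ] ℝ :=
  (innerSL ℝ (memLp_single (Ω := Ω) (continuous_fderiv_apply hη (EuclideanSpace.single j 1))
      (hasCompactSupport_fderiv_apply hc _) i).toLp).comp (ContinuousLinearMap.fst ℝ _ _)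
    + (innerSL ℝ (memLp_single (Ω := Ω) hη.continuous hc (i, j)).toLp).comp
      (ContinuousLinearMap.snd ℝ _ _)

theorem weakFunctional_eq_zero_iff {η : Vec d → ℝ} (hη : ContDiff ℝ ∞ η)
    (hc : HasCompactSupport η) (i j : Fin d) (p : L2 Ω × L2Mat Ω) :
    weakFunctional Ω hη hc i j p = 0 ↔
      ∫ x in Ω, p.1 x i * fderiv ℝ η x (EuclideanSpace.single j 1)
        = -∫ x in Ω, p.2 x (i, j) * η x := by
  rw [← inner_toLp_single (continuous_fderiv_apply hη _) (hasCompactSupport_fderiv_apply hc _),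
    ← inner_toLp_single hη.continuous hc, eq_neg_iff_add_eq_zero]
  rfl

theorem HasWeakGrad.congr {u u' : Vec d → Vec d} {G G' : Vec d → Mat d} (h : HasWeakGrad Ω u G)
    (hu : u =ᵐ[volume.restrict Ω] u') (hG : G =ᵐ[volume.restrict Ω] G') :
    HasWeakGrad Ω u' G' := by
  intro i j η h1 h2 h3
  have h4 := h i j η h1 h2 h3
  rw [integral_congr_ae (g := fun x => u x i * fderiv ℝ η x (EuclideanSpace.single j 1)),
    h4, integral_congr_ae]
  · filter_upwards [hG] with x hx
    rw [hx]
  · filter_upwards [hu] with x hx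
    rw [hx]

theorem TestField.hasWeakGrad (φ : TestField Ω) :
    HasWeakGrad Ω φ.toFun (gradField φ.toFun) := by
  intro i j η h1 h2 h3
  have hd := φ.smooth.differentiable (by simp)
  have hsm := contDiff_coord φ.smooth i
  have hcs := hasCompactSupport_coord φ.compactSupp i
  have key := integral_mul_fderiv_eq_neg_fderiv_mul_of_integrable (μ := volume)
    (f := fun x => φ.toFun x i) (g := η) (v := EuclideanSpace.single j (1 : ℝ))
    (((continuous_fderiv_apply hsm _).mul h1.continuous).integrable_of_hasCompactSupport
      h2.mul_left)
    ((hsm.continuous.mul (continuous_fderiv_apply h1 _)).integrable_of_hasCompactSupport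
      hcs.mul_right)
    ((hsm.continuous.mul h1.continuous).integrable_of_hasCompactSupport hcs.mul_right)
    (fun x _ => hsm.differentiable (by simp) x) (fun x _ => h1.differentiable (by simp) x)
  rw [setIntegral_eq_integral_of_forall_compl_eq_zero, key,
    setIntegral_eq_integral_of_forall_compl_eq_zero]
  · congr 2
    ext x
    rw [fderiv_coord (hd x)]
    rfl
  · intro x hx
    rw [image_eq_zero_of_notMem_tsupport fun h => hx (h3 h), mul_zero]
  · intro x hx
    simp [image_eq_zero_of_notMem_tsupport fun h => hx (φ.supp_subset h)]

/-- For each fixed test function the defining identity is the vanishing of a continuous functional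
on `L² × L²`, so it passes from smooth pairs to the closure of their span. -/
theorem hasWeakGrad_of_mem_H10 {p : L2 Ω × L2Mat Ω} (hp : p ∈ H10 Ω) :
    HasWeakGrad Ω p.1 p.2 := by
  intro i j η h1 h2 h3
  rw [← weakFunctional_eq_zero_iff h1 h2]
  have hle : H10 Ω ≤ (weakFunctional Ω h1 h2 i j : L2 Ω × L2Mat Ω →ₗ[ℝ] ℝ).ker := by
    refine Submodule.topologicalClosure_minimal _ (Submodule.span_le.2 ?_)
      (ContinuousLinearMap.isClosed_ker _)
    rintro _ ⟨φ, rfl⟩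
    refine (weakFunctional_eq_zero_iff h1 h2 i j _).2 ?_
    exact φ.hasWeakGrad.congr φ.memLp.coeFn_toLp.symm φ.memLp_grad.coeFn_toLp.symm i j η h1 h2 h3
  exact hle hp

/-- Corresponding components have equal integrals against every test function, so the fundamental
lemma of the calculus of variations applies. -/
theorem HasWeakGrad.ae_eq (hΩ : IsOpen Ω) {u : Vec d → Vec d} {G G' : Vec d → Mat d}
    (h : HasWeakGrad Ω u G) (h' : HasWeakGrad Ω u G') (hG : IntegrableOn G Ω)
    (hG' : IntegrableOn G' Ω) : G =ᵐ[volume.restrict Ω] G' := by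
  have key : ∀ k : Fin d × Fin d, ∀ᵐ x ∂volume.restrict Ω, G x k = G' x k := by
    rintro ⟨i, j⟩
    have hi : IntegrableOn (fun x => G x (i, j)) Ω :=
      (EuclideanSpace.proj (i, j) : Mat d →L[ℝ] ℝ).integrable_comp hG
    have hi' : IntegrableOn (fun x => G' x (i, j)) Ω :=
      (EuclideanSpace.proj (i, j) : Mat d →L[ℝ] ℝ).integrable_comp hG'
    have hz := hΩ.ae_eq_zero_of_integral_contDiff_smul_eq_zero (μ := volume)
      (f := fun x => G x (i, j) - G' x (i, j)) (hi.sub hi').locallyIntegrableOn ?_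
    · rw [ae_restrict_iff' hΩ.measurableSet]
      filter_upwards [hz] with x hx hxΩ
      exact sub_eq_zero.1 (hx hxΩ)
    · intro η h1 h2 h3
      obtain ⟨C, hC⟩ := h1.continuous.bounded_above_of_compact_support h2
      have e1 := h i j η h1 h2 h3
      have e2 := h' i j η h1 h2 h3
      rw [← setIntegral_eq_integral_of_forall_compl_eq_zero (s := Ω)]
      · simp_rw [smul_eq_mul, mul_sub, mul_comm (η _)]
        rw [integral_sub (integrable_mul_bounded hi h1.continuous hC)
          (integrable_mul_bounded hi' h1.continuous hC)]
        linarith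
      · intro x hx
        rw [image_eq_zero_of_notMem_tsupport fun h => hx (h3 h), zero_smul]
  filter_upwards [ae_all_iff.2 key] with x hx
  ext k
  exact hx k

/-- Uniqueness removes the choice made in `grad`; boundedness of `Ω` provides the integrability that
uniqueness requires. -/
theorem grad_eq (hΩ : IsOpen Ω) (hΩb : Bornology.IsBounded Ω) {u : L2sol Ω} {G : L2Mat Ω}
    (h : HasWeakGrad Ω (u : L2 Ω) G) : grad u = G := by
  have := isFiniteMeasure_restrict hΩb
  have hex : ∃ G : L2Mat Ω, HasWeakGrad Ω (u : L2 Ω) G := ⟨G, h⟩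
  have hg : HasWeakGrad Ω (u : L2 Ω) (grad u) := by
    rw [grad, dif_pos hex]
    exact hex.choose_spec
  exact Lp.ext (hg.ae_eq hΩ h ((Lp.memLp _).integrable one_le_two)
    ((Lp.memLp _).integrable one_le_two))

theorem grad_ae_eq (hΩ : IsOpen Ω) (hΩb : Bornology.IsBounded Ω) {u : L2sol Ω}
    {G : Lp (Mat d) ⊤ (volume.restrict Ω)} (h : HasWeakGrad Ω (u : L2 Ω) G) :
    grad u =ᵐ[volume.restrict Ω] G := by
  have := isFiniteMeasure_restrict hΩb
  have hG : MemLp G 2 (volume.restrict Ω) := (Lp.memLp G).mono_exponent le_top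
  rw [grad_eq hΩ hΩb (h.congr EventuallyEq.rfl hG.coeFn_toLp.symm)]
  exact hG.coeFn_toLp

theorem grad_eq_of_mem_H10 (hΩ : IsOpen Ω) (hΩb : Bornology.IsBounded Ω) {u : L2sol Ω}
    {G : L2Mat Ω} (h : ((u : L2 Ω), G) ∈ H10 Ω) : grad u = G :=
  grad_eq hΩ hΩb (hasWeakGrad_of_mem_H10 h)

theorem SolField.pair_mem_H10 (φ : SolField Ω) : (φ.toL2, φ.gradL2) ∈ H10 Ω :=
  Submodule.le_topologicalClosure _ (Submodule.subset_span ⟨φ.toTestField, rfl⟩)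

theorem SolField.grad_toL2sol (hΩ : IsOpen Ω) (hΩb : Bornology.IsBounded Ω) (φ : SolField Ω) :
    grad φ.toL2sol = φ.gradL2 :=
  grad_eq_of_mem_H10 hΩ hΩb φ.pair_mem_H10

theorem SolField.memH10sol (hΩ : IsOpen Ω) (hΩb : Bornology.IsBounded Ω) (φ : SolField Ω) :
    MemH10sol φ.toL2sol := by
  rw [MemH10sol, φ.grad_toL2sol hΩ hΩb]
  exact subset_closure ⟨φ, rfl⟩

theorem MemH10sol.mem_H10 {u : L2sol Ω} (h : MemH10sol u) : ((u : L2 Ω), grad u) ∈ H10 Ω := by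
  have hcl : IsClosed (H10 Ω : Set (L2 Ω × L2Mat Ω)) := Submodule.isClosed_topologicalClosure _
  refine closure_minimal ?_ hcl h
  rintro _ ⟨φ, rfl⟩
  exact φ.pair_mem_H10

theorem MemH10sol.sub_mem_H10 {u w : L2sol Ω} (hu : MemH10sol u) (hw : MemH10sol w) :
    (((u - w : L2sol Ω) : L2 Ω), grad u - grad w) ∈ H10 Ω :=
  (H10 Ω).sub_mem hu.mem_H10 hw.mem_H10

/-- Being defined by choice, `grad` is not linear by construction. For pairs in `H10` the difference
of the gradients is a weak gradient of the difference, and uniqueness applies. -/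
theorem MemH10sol.grad_sub (hΩ : IsOpen Ω) (hΩb : Bornology.IsBounded Ω) {u w : L2sol Ω}
    (hu : MemH10sol u) (hw : MemH10sol w) : grad (u - w) = grad u - grad w :=
  grad_eq_of_mem_H10 hΩ hΩb (hu.sub_mem_H10 hw)

/-! ### The convective form -/

/-- The outer product of vectors. -/
def outer (d : ℕ) : Vec d →L[ℝ] Vec d →L[ℝ] Mat d :=
  LinearMap.toContinuousBilinearMap <| LinearMap.mk₂ ℝ
    (fun a b => WithLp.toLp 2 fun ij : Fin d × Fin d => a ij.1 * b ij.2)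
    (fun a a' b => by ext; simp [add_mul]) (fun c a b => by ext; simp [mul_assoc])
    (fun a b b' => by ext; simp [mul_add]) (fun c a b => by ext; simp [mul_left_comm])

theorem outer_apply (a b : Vec d) (ij : Fin d × Fin d) : outer d a b ij = a ij.1 * b ij.2 := rfl

theorem inner_outer (B : Mat d) (a b : Vec d) :
    inner ℝ B (outer d a b) = ∑ i, ∑ j, b j * B (i, j) * a i := by
  rw [PiLp.inner_apply, Fintype.sum_prod_type]
  refine Finset.sum_congr rfl fun i _ => Finset.sum_congr rfl fun j _ => ?_
  rw [outer_apply]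
  simp only [RCLike.inner_apply, conj_trivial]
  ring

/-- The tensor product of two fields in `L²`. -/
def tensor (Ω : Set (Vec d)) : L2 Ω →L[ℝ] L2 Ω →L[ℝ] Lp (Mat d) 1 (volume.restrict Ω) :=
  (outer d).holderL (volume.restrict Ω) 2 2 1

theorem coeFn_tensor (a b : L2 Ω) :
    tensor Ω a b =ᵐ[volume.restrict Ω] fun x => outer d (a x) (b x) :=
  (outer d).coeFn_holder a b

/-- The pairing of `L^∞` and `L¹`. -/
def matPair (Ω : Set (Vec d)) :
    Lp (Mat d) ⊤ (volume.restrict Ω) →L[ℝ] Lp (Mat d) 1 (volume.restrict Ω) →L[ℝ] ℝ :=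
  (innerB (Mat d)).lpPairing (volume.restrict Ω) ⊤ 1

theorem matPair_eq (G : Lp (Mat d) ⊤ (volume.restrict Ω)) (M : Lp (Mat d) 1 (volume.restrict Ω)) :
    matPair Ω G M = ∫ x in Ω, inner ℝ (G x) (M x) :=
  ContinuousLinearMap.lpPairing_eq_integral _ G M

theorem matPair_tensor (G : Lp (Mat d) ⊤ (volume.restrict Ω)) (a b : L2 Ω) :
    matPair Ω G (tensor Ω a b) = ∫ x in Ω, ∑ i, ∑ j, b x j * G x (i, j) * a x i := by
  rw [matPair_eq]
  refine integral_congr_ae ?_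
  filter_upwards [coeFn_tensor a b] with x hx
  rw [hx, inner_outer]

theorem convection_eq {G : Lp (Mat d) ⊤ (volume.restrict Ω)} {B : Vec d → Mat d}
    (hB : B =ᵐ[volume.restrict Ω] G) (a c : L2 Ω) :
    convection Ω a B c = matPair Ω G (tensor Ω c a) := by
  rw [matPair_tensor, convection]
  refine integral_congr_ae ?_
  filter_upwards [hB] with x hx
  rw [hx]

/-- A quadratic form sees only the symmetric part of its matrix. This brings the inviscid relative
form into the convective shape used in the viscous case. -/
theorem symForm_eq_convection (a : Vec d → Vec d) (B : Vec d → Mat d) :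
    symForm Ω a B = convection Ω a B a := by
  unfold symForm convection
  congr 1
  ext x
  have h1 : ∀ i j, a x i * (1 / 2 * (B x (i, j) + B x (j, i))) * a x j
      = 1 / 2 * (a x j * B x (i, j) * a x i) + 1 / 2 * (a x i * B x (j, i) * a x j) :=
    fun i j => by ring
  simp_rw [h1, Finset.sum_add_distrib, ← Finset.mul_sum]
  rw [Finset.sum_comm (f := fun i j => a x i * B x (j, i) * a x j)]
  ring

/-- The `i`-th row of a matrix field. -/
def matRow (i : Fin d) : Mat d →L[ℝ] Vec d :=
  LinearMap.toContinuousLinearMap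
    { toFun := fun B => WithLp.toLp 2 fun j => B (i, j)
      map_add' := fun _ _ => rfl
      map_smul' := fun _ _ => rfl }

theorem matRow_apply (i j : Fin d) (B : Mat d) : matRow i B j = B (i, j) := rfl

/-- `u` is a bounded field with the bounded weak gradient `G`. -/
structure IsW1inf (u : L2 Ω) (U : Lp (Vec d) ⊤ (volume.restrict Ω))
    (G : Lp (Mat d) ⊤ (volume.restrict Ω)) : Prop where
  ae_eq : U =ᵐ[volume.restrict Ω] u
  hasWeakGrad : HasWeakGrad Ω u G

theorem integrableOn_sum_row (hΩb : Bornology.IsBounded Ω)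
    {u : Vec d → ℝ} {r : Vec d → Vec d} (hu : MemLp u ⊤ (volume.restrict Ω))
    (hr : MemLp r ⊤ (volume.restrict Ω)) (φ : TestField Ω) :
    IntegrableOn (fun x => u x * ∑ j, r x j * φ.toFun x j) Ω := by
  have := isFiniteMeasure_restrict hΩb
  have hf : ∀ j, MemLp (fun x => φ.toFun x j) ⊤ (volume.restrict Ω) := fun j => by
    obtain ⟨C, hC⟩ := φ.bounded
    exact memLp_top_of_bound (contDiff_coord φ.smooth j).continuous.aestronglyMeasurable C
      (Eventually.of_forall fun x => (PiLp.norm_apply_le _ _).trans (hC x))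
  have hrj : ∀ j, MemLp (fun x => r x j) ⊤ (volume.restrict Ω) := fun j =>
    hr.continuousLinearMap_comp (EuclideanSpace.proj j : Vec d →L[ℝ] ℝ)
  have h1 : MemLp (fun x => ∑ j, r x j * φ.toFun x j) ⊤ (volume.restrict Ω) :=
    memLp_finsetSum _ fun j _ => (hf j).mul (hrj j)
  exact (h1.mul hu : MemLp _ ⊤ _).integrable le_top

/-- The convective form `((v · ∇) u, u)` vanishes for solenoidal `v`. -/
theorem IsW1inf.matPair_tensor_eq_zero (hΩ : IsOpen Ω) (hΩb : Bornology.IsBounded Ω) {u : L2 Ω}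
    {U : Lp (Vec d) ⊤ (volume.restrict Ω)} {G : Lp (Mat d) ⊤ (volume.restrict Ω)}
    (h : IsW1inf u U G) (v : L2sol Ω) : matPair Ω G (tensor Ω u v) = 0 := by
  -- By continuity in `v` a smooth solenoidal field suffices; then every component of `U` is a
  -- bounded function with bounded weak gradient, transported skew-symmetrically.
  have hle : L2sol Ω ≤ ((matPair Ω G).comp (tensor Ω u) : L2 Ω →ₗ[ℝ] ℝ).ker := by
    refine Submodule.topologicalClosure_minimal _ (Submodule.span_le.2 ?_)
      (ContinuousLinearMap.isClosed_ker _)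
    rintro _ ⟨φ, rfl⟩
    change matPair Ω G (tensor Ω u φ.toL2) = 0
    have hU : ∀ i, MemLp (fun x => U x i) ⊤ (volume.restrict Ω) := fun i =>
      (Lp.memLp U).continuousLinearMap_comp (EuclideanSpace.proj i : Vec d →L[ℝ] ℝ)
    have hGr : ∀ i, MemLp (fun x => matRow i (G x)) ⊤ (volume.restrict Ω) := fun i =>
      (Lp.memLp G).continuousLinearMap_comp (matRow i)
    have hw := h.hasWeakGrad.congr h.ae_eq.symm (EventuallyEq.refl _ G)
    have h1 : ∀ i, ∫ x in Ω, U x i * ∑ j, matRow i (G x) j * φ.toFun x j = 0 := fun i =>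
      integral_solField_mul_grad_mul hΩ hΩb (hU i) (hGr i) (fun j => hw i j) φ
    rw [matPair_tensor, integral_congr_ae
      (g := fun x => ∑ i, U x i * ∑ j, matRow i (G x) j * φ.toFun x j),
      integral_finsetSum]
    · exact Finset.sum_eq_zero fun i _ => h1 i
    · exact fun i _ => integrableOn_sum_row hΩb (hU i) (hGr i) φ.toTestField
    · filter_upwards [h.ae_eq, φ.memLp.coeFn_toLp] with x hx hx2
      have hx2' : φ.toL2 x = φ.toFun x := hx2
      rw [hx2', ← hx]
      refine Finset.sum_congr rfl fun i _ => ?_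
      rw [Finset.mul_sum]
      refine Finset.sum_congr rfl fun j _ => ?_
      rw [matRow_apply]
      ring
  exact hle v.2

/-- The product of a bounded and a square integrable field. -/
def tensorTop (Ω : Set (Vec d)) :
    Lp (Vec d) ⊤ (volume.restrict Ω) →L[ℝ] L2 Ω →L[ℝ] L2Mat Ω :=
  (outer d).holderL (volume.restrict Ω) ⊤ 2 2

theorem inner_tensorTop (U : Lp (Vec d) ⊤ (volume.restrict Ω)) (a : L2 Ω) (B : L2Mat Ω) :
    inner ℝ B (tensorTop Ω U a) = ∫ x in Ω, ∑ i, ∑ j, a x j * B x (i, j) * U x i := by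
  rw [L2.inner_def]
  refine integral_congr_ae ?_
  have h : tensorTop Ω U a =ᵐ[volume.restrict Ω] fun x => outer d (U x) (a x) :=
    (outer d).coeFn_holder U a
  filter_upwards [h] with x hx
  rw [hx, inner_outer]

/-- Componentwise this is `integral_mul_fderiv_solField` with `w = U_i` and the smooth multiplier `η
= ψ_i`. Limits in `ψ` and `φ` are taken in `IsW1inf.inner_tensorTop_eq`. -/
theorem IsW1inf.inner_tensorTop_testField (hΩb : Bornology.IsBounded Ω) {u : L2 Ω}
    {U : Lp (Vec d) ⊤ (volume.restrict Ω)} {G : Lp (Mat d) ⊤ (volume.restrict Ω)}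
    (h : IsW1inf u U G) (ψ : TestField Ω) (φ : SolField Ω) :
    inner ℝ ψ.gradL2 (tensorTop Ω U φ.toL2) = -matPair Ω G (tensor Ω ψ.toL2 φ.toL2) := by
  have := isFiniteMeasure_restrict hΩb
  have hU : ∀ i, MemLp (fun x => U x i) ⊤ (volume.restrict Ω) := fun i =>
    (Lp.memLp U).continuousLinearMap_comp (EuclideanSpace.proj i : Vec d →L[ℝ] ℝ)
  have hGr : ∀ i, MemLp (fun x => matRow i (G x)) ⊤ (volume.restrict Ω) := fun i =>
    (Lp.memLp G).continuousLinearMap_comp (matRow i)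
  have hGij : ∀ i j, IntegrableOn (fun x => matRow i (G x) j) Ω := fun i j =>
    (EuclideanSpace.proj j : Vec d →L[ℝ] ℝ).integrable_comp ((hGr i).integrable le_top)
  have hw := h.hasWeakGrad.congr h.ae_eq.symm (EventuallyEq.refl _ G)
  have h1 : ∀ i, ∫ x in Ω, U x i * fderiv ℝ (fun y => ψ.toFun y i) x (φ.toFun x)
      = -∫ x in Ω, ψ.toFun x i * ∑ j, matRow i (G x) j * φ.toFun x j := fun i =>
    integral_mul_fderiv_solField ((hU i).integrable le_top) (hGij i) (fun j => hw i j) φ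
      (contDiff_coord ψ.smooth i)
  obtain ⟨C, hC⟩ := φ.toTestField.bounded
  obtain ⟨C₁, hC₁⟩ := ψ.bounded
  have hψ : ∀ i, MemLp (fun x => ψ.toFun x i) ⊤ (volume.restrict Ω) := fun i =>
    memLp_top_of_bound (contDiff_coord ψ.smooth i).continuous.aestronglyMeasurable C₁
      (Eventually.of_forall fun x => (PiLp.norm_apply_le _ _).trans (hC₁ x))
  have hA : ∫ x in Ω, ∑ i, ∑ j, φ.toL2 x j * ψ.gradL2 x (i, j) * U x i
      = ∑ i, ∫ x in Ω, U x i * fderiv ℝ (fun y => ψ.toFun y i) x (φ.toFun x) := by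
    rw [← integral_finsetSum]
    · refine integral_congr_ae ?_
      filter_upwards [φ.memLp.coeFn_toLp, ψ.memLp_grad.coeFn_toLp] with x hx2 hx3
      have hx2' : φ.toL2 x = φ.toFun x := hx2
      have hx3' : ψ.gradL2 x = gradField ψ.toFun x := hx3
      rw [hx2', hx3']
      refine Finset.sum_congr rfl fun i _ => ?_
      rw [← sum_fderiv_single, Finset.mul_sum]
      refine Finset.sum_congr rfl fun j _ => ?_
      rw [fderiv_coord (ψ.smooth.differentiable (by simp) x)]
      change φ.toFun x j * fderiv ℝ ψ.toFun x (EuclideanSpace.single j 1) i * U x i = _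
      ring
    · intro i _
      obtain ⟨C', hC'⟩ := exists_bound_fderiv (contDiff_coord ψ.smooth i)
        (hasCompactSupport_coord ψ.compactSupp i)
      have hc := (contDiff_coord ψ.smooth i).continuous_fderiv (by simp)
      refine integrable_mul_bounded ((hU i).integrable le_top) (hc.clm_apply φ.smooth.continuous)
        (C := C' * C) fun x => ?_
      exact ((fderiv ℝ (fun y => ψ.toFun y i) x).le_opNorm _).trans
        (mul_le_mul (hC' x) (hC x) (norm_nonneg _) ((norm_nonneg _).trans (hC' x)))
  have hB : ∫ x in Ω, ∑ i, ∑ j, φ.toL2 x j * G x (i, j) * ψ.toL2 x i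
      = ∑ i, ∫ x in Ω, ψ.toFun x i * ∑ j, matRow i (G x) j * φ.toFun x j := by
    rw [← integral_finsetSum]
    · refine integral_congr_ae ?_
      filter_upwards [φ.memLp.coeFn_toLp, ψ.memLp.coeFn_toLp] with x hx2 hx3
      have hx2' : φ.toL2 x = φ.toFun x := hx2
      have hx3' : ψ.toL2 x = ψ.toFun x := hx3
      rw [hx2', hx3']
      refine Finset.sum_congr rfl fun i _ => ?_
      rw [Finset.mul_sum]
      refine Finset.sum_congr rfl fun j _ => ?_
      rw [matRow_apply]
      ring
    · exact fun i _ => integrableOn_sum_row hΩb (hψ i) (hGr i) φ.toTestField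
  rw [inner_tensorTop, matPair_tensor, hA, hB, ← Finset.sum_neg_distrib]
  exact Finset.sum_congr rfl fun i _ => h1 i

/-- A continuous bilinear form vanishing on generators of two closed spans vanishes. -/
theorem bilin_eq_zero_of_span {E F : Type*} [NormedAddCommGroup E] [NormedSpace ℝ E]
    [NormedAddCommGroup F] [NormedSpace ℝ F] (B : E →L[ℝ] F →L[ℝ] ℝ) {s : Set E} {t : Set F}
    (h : ∀ x ∈ s, ∀ y ∈ t, B x y = 0) {x : E} {y : F}
    (hx : x ∈ (Submodule.span ℝ s).topologicalClosure)
    (hy : y ∈ (Submodule.span ℝ t).topologicalClosure) : B x y = 0 := by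
  have h1 : ∀ x ∈ s, B x y = 0 := by
    intro x hx
    have hle : (Submodule.span ℝ t).topologicalClosure ≤ (B x : F →ₗ[ℝ] ℝ).ker :=
      Submodule.topologicalClosure_minimal _ (Submodule.span_le.2 fun z hz => h x hx z hz)
        (ContinuousLinearMap.isClosed_ker _)
    exact hle hy
  have hle : (Submodule.span ℝ s).topologicalClosure ≤ (B.flip y : E →ₗ[ℝ] ℝ).ker :=
    Submodule.topologicalClosure_minimal _ (Submodule.span_le.2 fun z hz => h1 z hz)
      (ContinuousLinearMap.isClosed_ker _)
  exact hle hx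

/-- Integration by parts in the convective form. -/
theorem IsW1inf.inner_tensorTop_eq (hΩb : Bornology.IsBounded Ω) {u : L2 Ω}
    {U : Lp (Vec d) ⊤ (volume.restrict Ω)} {G : Lp (Mat d) ⊤ (volume.restrict Ω)}
    (h : IsW1inf u U G) {p : L2 Ω × L2Mat Ω} (hp : p ∈ H10 Ω) {a : L2 Ω} (ha : a ∈ L2sol Ω) :
    inner ℝ p.2 (tensorTop Ω U a) = -matPair Ω G (tensor Ω p.1 a) := by
  -- The form is the sum of `inner ℝ p.2 (tensorTop Ω U a)` and `matPair Ω G (tensor Ω p.1 a)`,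
  -- continuous and bilinear in `(p, a)`.
  have key := bilin_eq_zero_of_span
    ((((innerB (L2Mat Ω)).flip.comp (tensorTop Ω U)).flip.comp
      (ContinuousLinearMap.snd ℝ (L2 Ω) (L2Mat Ω)))
      + ((ContinuousLinearMap.compL ℝ (L2 Ω) (Lp (Mat d) 1 (volume.restrict Ω)) ℝ
        (matPair Ω G)).comp ((tensor Ω).comp (ContinuousLinearMap.fst ℝ (L2 Ω) (L2Mat Ω)))))
    (s := range fun ψ : TestField Ω => (ψ.toL2, ψ.gradL2))
    (t := range fun φ : SolField Ω => φ.toL2) ?_ hp ha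
  · exact eq_neg_of_add_eq_zero_left key
  · rintro _ ⟨ψ, rfl⟩ _ ⟨φ, rfl⟩
    exact eq_neg_iff_add_eq_zero.1 (h.inner_tensorTop_testField hΩb ψ φ)

/-- In the viscous relative form the derivative falls on `v - w`, whose gradient is only in `L²`.
Here it is moved onto `w`, whose gradient is bounded. -/
theorem IsW1inf.convection_eq_neg (hΩb : Bornology.IsBounded Ω) {u : L2 Ω}
    {U : Lp (Vec d) ⊤ (volume.restrict Ω)} {G : Lp (Mat d) ⊤ (volume.restrict Ω)}
    (h : IsW1inf u U G) {b : L2 Ω} {B : L2Mat Ω} (hb : (b, B) ∈ H10 Ω) (a : L2sol Ω) :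
    convection Ω (a : L2 Ω) B u = -matPair Ω G (tensor Ω b a) := by
  rw [← h.inner_tensorTop_eq hΩb hb a.2, inner_tensorTop, convection]
  refine integral_congr_ae ?_
  filter_upwards [h.ae_eq] with x hx
  rw [hx]

attribute [irreducible] tensor matPair tensorTop

end FunctionSpaces

/-! ### Representation of the force and expansion of the rate -/

/-- Functionals on a closed subspace of a product of Hilbert spaces are represented by pairs,
which depend linearly and continuously on the functional. -/
theorem exists_riesz_prod {E F : Type*} [NormedAddCommGroup E] [InnerProductSpace ℝ E]
    [CompleteSpace E] [NormedAddCommGroup F] [InnerProductSpace ℝ F] [CompleteSpace F]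
    (S : Submodule ℝ (E × F)) (hS : IsClosed (S : Set (E × F))) :
    ∃ (R₁ : StrongDual ℝ S →L[ℝ] E) (R₂ : StrongDual ℝ S →L[ℝ] F), ∀ (ℓ : StrongDual ℝ S) (z : S),
      ℓ z = inner ℝ (R₁ ℓ) (z : E × F).1 + inner ℝ (R₂ ℓ) (z : E × F).2 := by
  -- The product carries the sup norm, which is not Hilbertian; Riesz's theorem is applied in the
  -- equivalent `ℓ²` product and transported back.
  set e := WithLp.prodContinuousLinearEquiv 2 ℝ E F with he
  set S' : Submodule ℝ (WithLp 2 (E × F)) := S.comap (e : WithLp 2 (E × F) →ₗ[ℝ] E × F) with hS'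
  have hcl : IsClosed (S' : Set (WithLp 2 (E × F))) := hS.preimage e.continuous
  have : CompleteSpace S' := hcl.completeSpace_coe
  let r : S' →L[ℝ] S := ((e : WithLp 2 (E × F) →L[ℝ] E × F).comp S'.subtypeL).codRestrict S
    fun x => x.2
  let P : StrongDual ℝ S →L[ℝ] StrongDual ℝ S' := ContinuousLinearMap.precomp ℝ r
  let D : StrongDual ℝ S' →L[ℝ] S' :=
    { toFun := (InnerProductSpace.toDual ℝ S').symm
      map_add' := fun x y => map_add _ x y
      map_smul' := fun c x => by simp
      cont := (InnerProductSpace.toDual ℝ S').symm.continuous }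
  let R := (e : WithLp 2 (E × F) →L[ℝ] E × F).comp (S'.subtypeL.comp (D.comp P))
  refine ⟨(ContinuousLinearMap.fst ℝ E F).comp R, (ContinuousLinearMap.snd ℝ E F).comp R, fun ℓ z => ?_⟩
  have hz : e.symm (z : E × F) ∈ S' := by
    change e (e.symm (z : E × F)) ∈ S
    rw [e.apply_symm_apply]
    exact z.2
  have h1 : inner ℝ (D (P ℓ)) (⟨e.symm (z : E × F), hz⟩ : S') = P ℓ ⟨e.symm (z : E × F), hz⟩ :=
    InnerProductSpace.toDual_symm_apply (𝕜 := ℝ) (E := S')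
  have h2 : P ℓ ⟨e.symm (z : E × F), hz⟩ = ℓ z := by
    change ℓ (r ⟨e.symm (z : E × F), hz⟩) = ℓ z
    exact congrArg ℓ (Subtype.ext (e.apply_symm_apply _))
  rw [← h2, ← h1, Submodule.coe_inner, WithLp.prod_inner_apply]
  rfl

/-- For the tensor product: `a ⊗ a + a ⊗ w = a ⊗ v = v ⊗ v - w ⊗ v`, and the last term is the
convection that vanishes for solenoidal `v`. -/
theorem bilin_sub_identity {E F : Type*} [NormedAddCommGroup E] [NormedSpace ℝ E]
    [NormedAddCommGroup F] [NormedSpace ℝ F] (m : F →L[ℝ] ℝ) (B : E →L[ℝ] E →L[ℝ] F) {v w a : E}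
    (ha : a = v - w) (h : m (B w v) = 0) : m (B a a) + m (B a w) = m (B v v) := by
  subst ha
  simp only [map_sub, sub_apply, h]
  ring

theorem memLp_clm_comp {α E F : Type*} [MeasurableSpace α] {μ : Measure α} {p : ENNReal}
    [NormedAddCommGroup E] [NormedSpace ℝ E] [NormedAddCommGroup F] [NormedSpace ℝ F]
    {f : α → StrongDual ℝ E} (hf : MemLp f p μ) (R : StrongDual ℝ E →L[ℝ] F) :
    MemLp (fun t => R (f t)) p μ :=
  hf.continuousLinearMap_comp R

section Rates

variable {d : ℕ} {Ω : Set (Vec d)} {ν T : ℝ}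

/-- The gradient, where it plays a role in the viscous case. -/
def vgrad (ν : ℝ) (u : L2sol Ω) : L2Mat Ω := if 0 < ν then grad u else 0

theorem vgrad_of_pos (hν : 0 < ν) (u : L2sol Ω) : vgrad ν u = grad u := if_pos hν

theorem vgrad_of_not_pos (hν : ¬ 0 < ν) (u : L2sol Ω) : vgrad ν u = 0 := if_neg hν

/-- Riesz turns the `H⁻¹` part into two fields that are square integrable in time; the zeroth order
one joins `f₂`. The pairing becomes a sum of inner products with the field and its gradient. -/
theorem Force.exists_repr (f : Force Ω ν T) (hν : 0 ≤ ν) :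
    ∃ (g : ℝ → L2 Ω) (g₁ : ℝ → L2Mat Ω), IntegrableOn g (Ioo 0 T) ∧ MemLp g₁ 2 (timeMeas T) ∧
      ∀ (t : ℝ) (z : L2sol Ω), (0 < ν → ((z : L2 Ω), grad z) ∈ H10 Ω) →
        f.pair t z = inner ℝ (g t) (z : L2 Ω) + inner ℝ (g₁ t) (vgrad ν z) := by
  rcases hν.eq_or_lt with h0 | hpos
  · refine ⟨f.f₂, 0, f.integrable₂, MemLp.zero, fun t z _ => ?_⟩
    simp [Force.pair, f.inviscid h0.symm]
  · obtain ⟨R₁, R₂, hR⟩ := exists_riesz_prod (H10 Ω) (Submodule.isClosed_topologicalClosure _)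
    have hm1 : MemLp (fun t => R₁ (f.f₁ t)) 2 (timeMeas T) :=
      memLp_clm_comp f.memLp₁ R₁
    have hm2 : MemLp (fun t => R₂ (f.f₁ t)) 2 (timeMeas T) :=
      memLp_clm_comp f.memLp₁ R₂
    refine ⟨fun t => R₁ (f.f₁ t) + f.f₂ t, fun t => R₂ (f.f₁ t),
      (hm1.integrable one_le_two).add f.integrable₂, hm2, fun t z hz => ?_⟩
    have e1 : f.pair t z = f.f₁ t ⟨_, hz hpos⟩ + inner ℝ (f.f₂ t) (z : L2 Ω) := by
      unfold Force.pair
      rw [dif_pos (hz hpos)]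
    have e2 := hR (f.f₁ t) ⟨_, hz hpos⟩
    have e3 := inner_add_left (𝕜 := ℝ) (R₁ (f.f₁ t)) (f.f₂ t) (z : L2 Ω)
    have e4 := congrArg (inner ℝ (R₂ (f.f₁ t))) (vgrad_of_pos hpos z)
    have arith : ∀ {p a b c x y s : ℝ}, p = a + b → a = c + x → s = c + b → y = x → p = s + y := by
      intros; linarith
    exact arith e1 e2 e3 e4

/-- The part of the rate which does not contain the time derivative of the test function. -/
def formRate (ν : ℝ) (v : L2sol Ω) (A : L2Mat Ω) (w : L2sol Ω) (B : L2Mat Ω)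
    (G : Lp (Mat d) ⊤ (volume.restrict Ω)) (g : L2 Ω) (g₁ : L2Mat Ω) : ℝ :=
  ν * inner ℝ A (A - B) + matPair Ω G (tensor Ω v v)
    - (inner ℝ g ((v - w : L2sol Ω) : L2 Ω) + inner ℝ g₁ (A - B))

/-- The algebraic core. The viscous terms combine by `‖A - B‖² + (B, A - B) = (A, A - B)`. The
convective part of the relative form equals `∇w : (v - w) ⊗ (v - w)`, by integration by parts if `ν
> 0` and by symmetry if `ν = 0`. Adding `∇w : (v - w) ⊗ w` from the system operator leaves `∇w : v ⊗
v`, because `w ⊗ v` contributes nothing. What remains is affine in `w`, except for the terms with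
`dw` and `K`. -/
theorem relForm_add_sysOp (hΩ : IsOpen Ω) (hΩb : Bornology.IsBounded Ω) (hν : 0 ≤ ν)
    (K : L2sol Ω → ENNReal) (f : Force Ω ν T) {t : ℝ} {v w dw : L2sol Ω}
    (hv : 0 < ν → MemH10sol v) (hw : 0 < ν → MemH10sol w)
    {U : Lp (Vec d) ⊤ (volume.restrict Ω)} {G : Lp (Mat d) ⊤ (volume.restrict Ω)}
    (h : IsW1inf (w : L2 Ω) U G) {g : L2 Ω} {g₁ : L2Mat Ω}
    (hf : ∀ z : L2sol Ω, (0 < ν → ((z : L2 Ω), grad z) ∈ H10 Ω) →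
        f.pair t z = inner ℝ g (z : L2 Ω) + inner ℝ g₁ (vgrad ν z)) :
    relForm ν K v w + sysOp f t w dw (v - w)
      = formRate ν v (vgrad ν v) w (vgrad ν w) G g g₁ + inner ℝ dw (v - w)
        + (K w).toReal * relEnergy v w := by
  have hG := grad_ae_eq hΩ hΩb h.hasWeakGrad
  have hz := h.matPair_tensor_eq_zero hΩ hΩb v
  have hc := convection_eq hG (w : L2 Ω) ((v - w : L2sol Ω) : L2 Ω)
  have hsum := bilin_sub_identity (matPair Ω G) (tensor Ω) (a := ((v - w : L2sol Ω) : L2 Ω))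
    (v := (v : L2 Ω)) (w := (w : L2 Ω)) (Submodule.coe_sub _ v w) hz
  rcases hν.eq_or_lt with h0 | hpos
  · have hn : ¬ 0 < ν := by rw [← h0]; exact lt_irrefl 0
    have h3 := hf (v - w) fun h => absurd h hn
    have hs : symForm Ω ((v - w : L2sol Ω) : L2 Ω) (grad w)
        = matPair Ω G (tensor Ω ((v - w : L2sol Ω) : L2 Ω) ((v - w : L2sol Ω) : L2 Ω)) :=
      (symForm_eq_convection _ _).trans (convection_eq hG _ _)
    have e1 : relForm ν K v w = symForm Ω ((v - w : L2sol Ω) : L2 Ω) (grad w)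
        + (K w).toReal * relEnergy v w := if_neg hn
    have e2 : sysOp f t w dw (v - w) = inner ℝ dw (v - w)
        + convection Ω (w : L2 Ω) (grad w) ((v - w : L2sol Ω) : L2 Ω)
        + ν * inner ℝ (grad w) (grad (v - w)) - f.pair t (v - w) := rfl
    have e3 : formRate ν v (vgrad ν v) w (vgrad ν w) G g g₁
        = ν * inner ℝ (vgrad ν v) (vgrad ν v - vgrad ν w) + matPair Ω G (tensor Ω v v)
          - (inner ℝ g ((v - w : L2sol Ω) : L2 Ω) + inner ℝ g₁ (vgrad ν v - vgrad ν w)) := rfl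
    have e4 : inner ℝ g₁ (vgrad ν (v - w)) = (0 : ℝ) := by
      rw [vgrad_of_not_pos hn]; exact inner_zero_right _
    have e5 : inner ℝ g₁ (vgrad ν v - vgrad ν w) = (0 : ℝ) := by
      rw [vgrad_of_not_pos hn, vgrad_of_not_pos hn, sub_self]; exact inner_zero_right _
    have arith : ∀ {r c q x y z s i n p j ζ ο η σ : ℝ}, r = s + q → x = i + c + ν * n - p →
        y = ν * j + z - (ζ + ο) → s = σ → c = η → p = ζ + ο → σ + η = z →
        r + x = y + i + q := by
      intros
      subst h0
      linarith
    exact arith e1 e2 e3 hs hc (h3.trans (congrArg (_ + ·) (e4.trans e5.symm))) hsum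
  · have hgr : grad (v - w) = grad v - grad w := (hv hpos).grad_sub hΩ hΩb (hw hpos)
    have hmem := (hv hpos).sub_mem_H10 (hw hpos)
    have h3 := hf (v - w) fun _ => by rwa [hgr]
    have hs : convection Ω ((v - w : L2sol Ω) : L2 Ω) (grad v - grad w : L2Mat Ω) (w : L2 Ω)
        = -matPair Ω G (tensor Ω ((v - w : L2sol Ω) : L2 Ω) ((v - w : L2sol Ω) : L2 Ω)) :=
      h.convection_eq_neg hΩb hmem (v - w)
    have hn : ‖grad v - grad w‖ ^ 2
        = inner ℝ (grad v) (grad v - grad w) - inner ℝ (grad w) (grad v - grad w) :=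
      (real_inner_self_eq_norm_sq _).symm.trans (inner_sub_left _ _ _)
    have e1 : relForm ν K v w = ν * ‖grad v - grad w‖ ^ 2
        - convection Ω ((v - w : L2sol Ω) : L2 Ω) (grad v - grad w : L2Mat Ω) (w : L2 Ω)
        + (K w).toReal * relEnergy v w := if_pos hpos
    have e2 : sysOp f t w dw (v - w) = inner ℝ dw (v - w)
        + convection Ω (w : L2 Ω) (grad w) ((v - w : L2sol Ω) : L2 Ω)
        + ν * inner ℝ (grad w) (grad (v - w)) - f.pair t (v - w) := rfl
    have e3 : formRate ν v (vgrad ν v) w (vgrad ν w) G g g₁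
        = ν * inner ℝ (vgrad ν v) (vgrad ν v - vgrad ν w) + matPair Ω G (tensor Ω v v)
          - (inner ℝ g ((v - w : L2sol Ω) : L2 Ω) + inner ℝ g₁ (vgrad ν v - vgrad ν w)) := rfl
    have arith : ∀ {r n₂ s q x i c n p y z j ζ ο σ η α : ℝ}, r = ν * n₂ - s + q →
        x = i + c + ν * n - p → y = ν * j + z - (ζ + ο) → s = -σ → n₂ = α - n → c = η →
        p = ζ + ο → j = α → σ + η = z → r + x = y + i + q := by
      intros
      subst_vars
      ring
    have e4 : inner ℝ g₁ (vgrad ν (v - w)) = inner ℝ g₁ (vgrad ν v - vgrad ν w) :=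
      congrArg (inner ℝ g₁) (((vgrad_of_pos hpos _).trans hgr).trans
        (congrArg₂ (· - ·) (vgrad_of_pos hpos v) (vgrad_of_pos hpos w)).symm)
    have e5 : inner ℝ (vgrad ν v) (vgrad ν v - vgrad ν w)
        = inner ℝ (grad v) (grad v - grad w) :=
      congrArg₂ (fun x y => inner ℝ x (x - y)) (vgrad_of_pos hpos v) (vgrad_of_pos hpos w)
    have hn' : ‖grad v - grad w‖ ^ 2
        = inner ℝ (grad v) (grad v - grad w) - inner ℝ (grad w) (grad (v - w)) :=
      hn.trans (congrArg (_ - ·) (congrArg (inner ℝ (grad w)) hgr.symm))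
    exact arith e1 e2 e3 hs hn' hc (h3.trans (congrArg (_ + ·) e4)) e5 hsum

end Rates

/-! ### Doubling the time variable -/

/-- The averages of `β` with respect to the mollifiers in `t - s` converge to the integral over
the diagonal. -/
structure Mollifies (T : ℝ) (β : ℝ → ℝ → ℝ) : Prop where
  integrable_diag : IntegrableOn (fun t => β t t) (Ioo 0 T)
  integrable : ∀ n, Integrable (fun q : ℝ × ℝ => mker ℝ n (q.2 - q.1) * β q.1 q.2)
    ((timeMeas T).prod (timeMeas T))
  tendsto : Tendsto (fun n => ∫ s in Ioo 0 T, ∫ t in Ioo 0 T, mker ℝ n (t - s) * β s t) atTop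
    (𝓝 (∫ t in Ioo 0 T, β t t))

theorem Mollifies.neg {T : ℝ} {β : ℝ → ℝ → ℝ} (h : Mollifies T β) :
    Mollifies T fun s t => -β s t where
  integrable_diag := h.integrable_diag.neg
  integrable n := (h.integrable n).neg.congr
    (Eventually.of_forall fun q => (mul_neg _ _).symm)
  tendsto := by simpa only [mul_neg, integral_neg] using h.tendsto.neg

theorem Mollifies.add {T : ℝ} {β γ : ℝ → ℝ → ℝ} (h : Mollifies T β) (h' : Mollifies T γ) :
    Mollifies T fun s t => β s t + γ s t where
  integrable_diag := h.integrable_diag.add h'.integrable_diag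
  integrable n := ((h.integrable n).add (h'.integrable n)).congr
    (Eventually.of_forall fun q => (mul_add _ _ _).symm)
  tendsto := by
    rw [integral_add h.integrable_diag h'.integrable_diag]
    refine (h.tendsto.add h'.tendsto).congr fun n => ?_
    rw [← integral_add (h.integrable n).integral_prod_left (h'.integrable n).integral_prod_left]
    refine integral_congr_ae ?_
    filter_upwards [(h.integrable n).prod_right_ae, (h'.integrable n).prod_right_ae] with s h1 h2
    simp only [mul_add]
    rw [integral_add h1 h2]

theorem Mollifies.sub {T : ℝ} {β γ : ℝ → ℝ → ℝ} (h : Mollifies T β) (h' : Mollifies T γ) :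
    Mollifies T fun s t => β s t - γ s t := by
  simpa only [sub_eq_add_neg] using h.add h'.neg

/-- The kernel is even, so the two times play symmetric roles. -/
theorem Mollifies.swap {T : ℝ} {β : ℝ → ℝ → ℝ} (h : Mollifies T β) :
    Mollifies T fun s t => β t s where
  integrable_diag := h.integrable_diag
  integrable n := by
    refine (h.integrable n).swap.congr (Eventually.of_forall fun q => ?_)
    simp only [Function.comp_apply, Prod.fst_swap, Prod.snd_swap]
    rw [mker_sub_comm]
  tendsto := by
    refine h.tendsto.congr fun n => ?_
    rw [integral_integral_swap (h.integrable n)]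
    refine integral_congr_ae (Eventually.of_forall fun s => ?_)
    refine integral_congr_ae (Eventually.of_forall fun t => ?_)
    simp only
    rw [mker_sub_comm]

/-- After Fubini the average over `s` is the mollification of `a`, which converges a.e. and keeps
the bound of `a`, while a multiple of `‖b‖` dominates. No regularity in time is needed. -/
theorem mollifies_bilin {T : ℝ} {X Y : Type*} [NormedAddCommGroup X] [NormedSpace ℝ X]
    [CompleteSpace X] [NormedAddCommGroup Y] [NormedSpace ℝ Y] (B : X →L[ℝ] Y →L[ℝ] ℝ)
    {a : ℝ → X} {b : ℝ → Y} (ha : MemLp a ⊤ (timeMeas T)) (hb : Integrable b (timeMeas T)) :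
    Mollifies T fun s t => B (a s) (b t) := by
  have hai : IntegrableOn a (Ioo 0 T) := ha.integrable le_top
  obtain ⟨C, hC⟩ := ha.exists_ae_bound
  have hInt : ∀ n, Integrable (fun q : ℝ × ℝ => mker ℝ n (q.2 - q.1) * B (a q.1) (b q.2))
      ((timeMeas T).prod (timeMeas T)) := by
    intro n
    obtain ⟨Cρ, hCρ⟩ := exists_mker_bound (E := ℝ) n
    refine Integrable.mono' (g := fun q : ℝ × ℝ => (Cρ * ‖B‖) * (‖a q.1‖ * ‖b q.2‖))
      ((hai.norm.mul_prod hb.norm).const_mul _) ?_ (Eventually.of_forall fun q => ?_)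
    · refine AEStronglyMeasurable.mul ?_ ?_
      · exact ((continuous_mker n).comp
          (continuous_snd.sub continuous_fst)).aestronglyMeasurable
      · exact B.aestronglyMeasurable_comp₂ ha.1.comp_fst hb.1.comp_snd
    · rw [norm_mul]
      have e1 := hCρ (q.2 - q.1)
      have e2 := B.le_opNorm₂ (a q.1) (b q.2)
      calc _ ≤ Cρ * (‖B‖ * ‖a q.1‖ * ‖b q.2‖) :=
            mul_le_mul e1 e2 (norm_nonneg _) ((norm_nonneg _).trans e1)
        _ = _ := by ring
  have hdiag : ∀ {c : ℝ → X}, AEStronglyMeasurable c (timeMeas T) →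
      (∀ᵐ t ∂timeMeas T, ‖c t‖ ≤ max C 0) →
      AEStronglyMeasurable (fun t => B (c t) (b t)) (timeMeas T) ∧
      ∀ᵐ t ∂timeMeas T, ‖B (c t) (b t)‖ ≤ ‖B‖ * max C 0 * ‖b t‖ := by
    intro c hc hcb
    refine ⟨B.aestronglyMeasurable_comp₂ hc hb.1, ?_⟩
    filter_upwards [hcb] with t ht
    refine (B.le_opNorm₂ _ _).trans ?_
    gcongr
  have hmaj : Integrable (fun t => ‖B‖ * max C 0 * ‖b t‖) (timeMeas T) := hb.norm.const_mul _
  have hC' : ∀ᵐ t ∂timeMeas T, ‖a t‖ ≤ max C 0 := hC.mono fun t ht => ht.trans (le_max_left _ _)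
  refine ⟨?_, hInt, ?_⟩
  · obtain ⟨h1, h2⟩ := hdiag ha.1 hC'
    exact hmaj.mono' h1 h2
  · set a₀ := (Ioo 0 T).indicator a with ha₀
    have ha₀i : Integrable a₀ := (integrable_indicator_iff measurableSet_Ioo).2 hai
    have ha₀C : ∀ᵐ y, ‖a₀ y‖ ≤ max C 0 := by
      filter_upwards [(ae_restrict_iff' measurableSet_Ioo).1 hC'] with y hy
      by_cases hyΩ : y ∈ Ioo 0 T
      · rw [ha₀, indicator_of_mem hyΩ]; exact hy hyΩ
      · rw [ha₀, indicator_of_notMem hyΩ]; simp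
    have heq : ∀ n, ∫ s in Ioo 0 T, ∫ t in Ioo 0 T, mker ℝ n (t - s) * B (a s) (b t)
        = ∫ t in Ioo 0 T, B (∫ y, mker ℝ n (t - y) • a₀ y) (b t) := by
      intro n
      obtain ⟨Cρ, hCρ⟩ := exists_mker_bound (E := ℝ) n
      rw [integral_integral_swap (hInt n)]
      refine integral_congr_ae (Eventually.of_forall fun t => ?_)
      have hi : Integrable fun y => mker ℝ n (t - y) • a₀ y :=
        ha₀i.bdd_smul Cρ ((continuous_mker n).comp
          (continuous_const.sub continuous_id)).aestronglyMeasurable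
          (Eventually.of_forall fun y => hCρ _)
      have h1 := (B.flip (b t)).integral_comp_comm hi
      change _ = B.flip (b t) (∫ y, mker ℝ n (t - y) • a₀ y)
      rw [← h1]
      change ∫ s in Ioo 0 T, mker ℝ n (t - s) * B (a s) (b t) = _
      rw [← integral_indicator measurableSet_Ioo]
      refine integral_congr_ae (Eventually.of_forall fun y => ?_)
      by_cases hy : y ∈ Ioo 0 T
      · simp [ha₀, indicator_of_mem hy]
      · simp [ha₀, indicator_of_notMem hy]
    simp_rw [heq]
    have hmeas : ∀ n, AEStronglyMeasurable (fun t => ∫ y, mker ℝ n (t - y) • a₀ y)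
        (timeMeas T) := by
      intro n
      have := (hasCompactSupport_mker (E := ℝ) n).continuous_convolution_left
        (ContinuousLinearMap.lsmul ℝ ℝ) (continuous_mker n) ha₀i.locallyIntegrable
      have h2 : Continuous fun t => ∫ y, mker ℝ n (t - y) • a₀ y := by
        refine this.congr fun x => ?_
        rw [convolution_eq_swap]
        rfl
      exact h2.aestronglyMeasurable
    refine tendsto_integral_of_dominated_convergence (fun t => ‖B‖ * max C 0 * ‖b t‖)
      (fun n => ?_) hmaj (fun n => ?_) ?_
    · exact (hdiag (hmeas n) (Eventually.of_forall fun t => norm_mollification_le ha₀C n t)).1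
    · exact (hdiag (hmeas n) (Eventually.of_forall fun t => norm_mollification_le ha₀C n t)).2
    · filter_upwards [ae_restrict_of_ae (ae_tendsto_mollification ha₀i.locallyIntegrable),
        ae_restrict_mem measurableSet_Ioo] with t ht htm
      rw [ha₀, indicator_of_mem htm] at ht
      exact ((B.flip (b t)).continuous.tendsto _).comp ht

theorem IsTimeTest.exists_margin {T : ℝ} {θ : ℝ → ℝ} (h : IsTimeTest T θ) :
    ∃ δ > 0, ∀ t, θ t ≠ 0 → δ < t ∧ t < T - δ := by
  obtain ⟨δ, hδ, hsub⟩ := h.compactSupp.isCompact.exists_cthickening_subset_open isOpen_Ioo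
    h.supp_subset
  refine ⟨δ, hδ, fun t ht => ?_⟩
  have hb := (Metric.closedBall_subset_cthickening (subset_tsupport _ ht) δ).trans hsub
  have h1 : t - δ ∈ Ioo 0 T := hb (by simp [abs_of_pos hδ])
  have h2 : t + δ ∈ Ioo 0 T := hb (by simp [abs_of_pos hδ])
  exact ⟨by linarith [h1.1], by linarith [h2.2]⟩

theorem continuous_bounded_deriv {ρ : ℝ → ℝ} (h : ContDiff ℝ ∞ ρ) (hc : HasCompactSupport ρ) :
    Continuous (deriv ρ) ∧ ∃ C, ∀ t, ‖deriv ρ t‖ ≤ C :=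
  have hd : Continuous (deriv ρ) := h.continuous_deriv (by simp)
  ⟨hd, hd.bounded_above_of_compact_support hc.deriv⟩

theorem integrable_frozen {T : ℝ} {V : Type*} [NormedAddCommGroup V] [InnerProductSpace ℝ V]
    {E : ℝ → ℝ} {v w : ℝ → V} (hE : Integrable E (timeMeas T)) (hv : Integrable v (timeMeas T))
    (hw : Integrable w (timeMeas T)) {θ κ : ℝ → ℝ} (hθ : Continuous θ) (hκ : Continuous κ)
    {Cθ Cκ : ℝ} (hCθ : ∀ t, ‖θ t‖ ≤ Cθ) (hCκ : ∀ t, ‖κ t‖ ≤ Cκ) :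
    Integrable (fun q : ℝ × ℝ => θ q.2 * κ (q.2 - q.1) * (E q.2 - inner ℝ (v q.2) (w q.1)))
      ((timeMeas T).prod (timeMeas T)) := by
  have hprod : Integrable (fun q : ℝ × ℝ => E q.2 - inner ℝ (v q.2) (w q.1))
      ((timeMeas T).prod (timeMeas T)) := by
    refine (hE.comp_snd _).sub ?_
    refine Integrable.mono' (g := fun q : ℝ × ℝ => ‖w q.1‖ * ‖v q.2‖)
      (hw.norm.mul_prod hv.norm) (hv.1.comp_snd.inner hw.1.comp_fst)
      (Eventually.of_forall fun q => ?_)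
    rw [mul_comm]
    exact norm_inner_le_norm _ _
  refine hprod.bdd_mul (c := Cθ * Cκ) ?_ (Eventually.of_forall fun q => ?_)
  · exact ((hθ.comp continuous_snd).mul
      (hκ.comp (continuous_snd.sub continuous_fst))).aestronglyMeasurable
  · rw [norm_mul]
    exact mul_le_mul (hCθ _) (hCκ _) (norm_nonneg _) ((norm_nonneg _).trans (hCθ 0))

theorem integral_deriv_mul_inner_primitive {T : ℝ} (hT : 0 < T) {V : Type*}
    [NormedAddCommGroup V] [InnerProductSpace ℝ V] [CompleteSpace V] {w dw : ℝ → V}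
    (hdw : IntegrableOn dw (Ioo 0 T))
    (hwdw : ∀ t ∈ Icc 0 T, w t = w 0 + ∫ τ in (0 : ℝ)..t, dw τ)
    {χ : ℝ → ℝ} (hχ : ContDiff ℝ ∞ χ) (h0 : χ 0 = 0) (h1 : χ T = 0) (e : ℝ) (x : V) :
    ∫ s in Ioo 0 T, deriv χ s * (e - inner ℝ x (w s))
      = ∫ s in Ioo 0 T, χ s * inner ℝ x (dw s) := by
  have hpr := integral_deriv_mul_primitive hT (c := fun s => -inner ℝ x (dw s))
    (hdw.const_inner x).neg hχ h0 h1 (e - inner ℝ x (w 0))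
  have e1 : ∫ s in Ioo 0 T, deriv χ s * (e - inner ℝ x (w s))
      = ∫ s in Ioo 0 T, deriv χ s * (e - inner ℝ x (w 0)
        + ∫ τ in (0 : ℝ)..s, -inner ℝ x (dw τ)) := by
    refine setIntegral_congr_fun measurableSet_Ioo fun s hs => ?_
    have hsub : IntervalIntegrable dw volume 0 s :=
      (intervalIntegrable_iff_integrableOn_Ioo_of_le hs.1.le).2
        (hdw.mono_set (Ioo_subset_Ioo_right hs.2.le))
    have e2 : ∫ τ in (0 : ℝ)..s, inner ℝ x (dw τ) = inner ℝ x (∫ τ in (0 : ℝ)..s, dw τ) :=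
      (innerSL ℝ x).intervalIntegral_comp_comm hsub
    rw [intervalIntegral.integral_neg, e2, hwdw s (Ioo_subset_Icc_self hs), inner_add_right]
    ring
  rw [e1, hpr]
  simp only [mul_neg, integral_neg, neg_neg]

/-- The inequality is tested with `θ ρ`. The product rule isolates the derivative of `ρ`, which
becomes singular as the kernel shrinks and is treated separately. -/
theorem frozen_test {T : ℝ} {θ ρ L e : ℝ → ℝ} (hθ : IsTimeTest T θ) (hθ0 : ∀ t, 0 ≤ θ t)
    (hρ : ContDiff ℝ ∞ ρ) (hρ0 : ∀ t, 0 ≤ ρ t)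
    (h1 : Integrable (fun t => ρ t * (θ t * L t)) (timeMeas T))
    (h2 : Integrable (fun t => ρ t * (deriv θ t * e t)) (timeMeas T))
    (h3 : Integrable (fun t => θ t * deriv ρ t * e t) (timeMeas T)) (h : WeakNonpos T e L) :
    (∫ t in Ioo 0 T, ρ t * (θ t * L t - deriv θ t * e t))
      - ∫ t in Ioo 0 T, θ t * deriv ρ t * e t ≤ 0 := by
  have hη : IsTimeTest T fun t => θ t * ρ t :=
    ⟨hθ.smooth.mul hρ, hθ.compactSupp.mul_right, tsupport_mul_subset_left.trans hθ.supp_subset⟩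
  have h4 := h _ hη fun t => mul_nonneg (hθ0 t) (hρ0 t)
  have e1 : ∫ t in Ioo 0 T, deriv (fun t => θ t * ρ t) t * e t
      = (∫ t in Ioo 0 T, ρ t * (deriv θ t * e t)) + ∫ t in Ioo 0 T, θ t * deriv ρ t * e t := by
    rw [← integral_add h2 h3]
    congr 1
    ext t
    rw [deriv_fun_mul (hθ.smooth.differentiable (by simp) t) (hρ.differentiable (by simp) t)]
    ring
  have e2 : ∫ t in Ioo 0 T, θ t * ρ t * L t = ∫ t in Ioo 0 T, ρ t * (θ t * L t) := by
    congr 1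
    ext t
    ring
  have e3 : ∫ t in Ioo 0 T, ρ t * (θ t * L t - deriv θ t * e t)
      = (∫ t in Ioo 0 T, ρ t * (θ t * L t)) - ∫ t in Ioo 0 T, ρ t * (deriv θ t * e t) := by
    rw [← integral_sub h1 h2]
    congr 1
    ext t
    ring
  rw [e1, e2] at h4
  rw [e3]
  linarith

theorem mollifies_energy {T : ℝ} {V : Type*} [NormedAddCommGroup V] [InnerProductSpace ℝ V]
    [CompleteSpace V] {E χ : ℝ → ℝ} {v w : ℝ → V} (hE : MemLp E ⊤ (timeMeas T))
    (hv : MemLp v ⊤ (timeMeas T)) (hw : MemLp w ⊤ (timeMeas T)) (hχ : MemLp χ ⊤ (timeMeas T)) :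
    Mollifies T fun s t => χ t * (E t - inner ℝ (v t) (w s)) := by
  -- The energy does not involve `s`: it is paired with the constant 1, and `swap` places it at the
  -- time `t`.
  have e1 : Mollifies T fun s t => (ContinuousLinearMap.mul ℝ ℝ) (χ t * E t) 1 :=
    (mollifies_bilin (ContinuousLinearMap.mul ℝ ℝ) (hE.mul hχ : MemLp (χ * E) ⊤ _)
      (integrable_const (1 : ℝ))).swap
  have e2 : Mollifies T fun s t => innerB V (χ t • v t) (w s) :=
    (mollifies_bilin (innerB V) (hv.smul hχ : MemLp (χ • v) ⊤ _) (hw.integrable le_top)).swap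
  have e3 := e1.sub e2
  have e4 : (fun s t => χ t * (E t - inner ℝ (v t) (w s))) = fun s t =>
      (ContinuousLinearMap.mul ℝ ℝ) (χ t * E t) 1 - innerB V (χ t • v t) (w s) := by
    ext s t
    rw [innerB_apply, real_inner_smul_left, ContinuousLinearMap.mul_apply', mul_one, mul_sub]
  rwa [e4]

theorem mollifies_inner {T : ℝ} {V : Type*} [NormedAddCommGroup V] [InnerProductSpace ℝ V]
    [CompleteSpace V] {χ : ℝ → ℝ} {v dw : ℝ → V} (hv : MemLp v ⊤ (timeMeas T))
    (hdw : Integrable dw (timeMeas T)) (hχ : MemLp χ ⊤ (timeMeas T)) :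
    Mollifies T fun s t => χ t * inner ℝ (v t) (dw s) := by
  have e2 : Mollifies T fun s t => innerB V (χ t • v t) (dw s) :=
    (mollifies_bilin (innerB V) (hv.smul hχ : MemLp (χ • v) ⊤ _) hdw).swap
  have e4 : (fun s t => χ t * inner ℝ (v t) (dw s)) = fun s t => innerB V (χ t • v t) (dw s) := by
    ext s t
    rw [innerB_apply, real_inner_smul_left]
  rwa [e4]

/-- The kernel depends on `t - s`, so its derivative in `t` is minus that in `s`, and integration by
parts in `s` moves it onto `w`. Boundary terms vanish: where `θ t ≠ 0`, the ends of the interval are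
farther than `δ` from `t`, beyond the reach of the kernel. -/
theorem integral_frozen_eq {T : ℝ} (hT : 0 < T) {V : Type*} [NormedAddCommGroup V]
    [InnerProductSpace ℝ V] [CompleteSpace V] {E : ℝ → ℝ} {v w dw : ℝ → V}
    (hdw : IntegrableOn dw (Ioo 0 T))
    (hwdw : ∀ t ∈ Icc 0 T, w t = w 0 + ∫ τ in (0 : ℝ)..t, dw τ)
    {θ : ℝ → ℝ} {δ : ℝ} (hδ : 0 < δ) (hmargin : ∀ t, θ t ≠ 0 → δ < t ∧ t < T - δ) {n : ℕ}
    (hn : (moll ℝ n).rOut < δ) (t : ℝ) :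
    ∫ s in Ioo 0 T, θ t * deriv (mker ℝ n) (t - s) * (E t - inner ℝ (v t) (w s))
      = -∫ s in Ioo 0 T, mker ℝ n (t - s) * (θ t * inner ℝ (v t) (dw s)) := by
  by_cases ht : θ t = 0
  · simp [ht]
  obtain ⟨ht1, ht2⟩ := hmargin t ht
  have hχ : ContDiff ℝ ∞ fun s => mker ℝ n (t - s) :=
    (contDiff_mker n).comp (contDiff_const.sub contDiff_id)
  have hpr := integral_deriv_mul_inner_primitive hT hdw hwdw hχ (mker_eq_zero (by
      rw [Real.norm_eq_abs, sub_zero, abs_of_pos (hδ.trans ht1)]; exact (hn.trans ht1).le))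
    (mker_eq_zero (by
      rw [Real.norm_eq_abs, abs_sub_comm, abs_of_pos (by linarith)]; linarith)) (E t) (v t)
  have hχd : ∀ s, deriv (fun s => mker ℝ n (t - s)) s = -deriv (mker ℝ n) (t - s) := fun s =>
    deriv_comp_const_sub (mker ℝ n) t s
  have e1 : ∫ s in Ioo 0 T, θ t * deriv (mker ℝ n) (t - s) * (E t - inner ℝ (v t) (w s))
      = -(θ t * ∫ s in Ioo 0 T, deriv (fun s => mker ℝ n (t - s)) s
        * (E t - inner ℝ (v t) (w s))) := by
    rw [← integral_const_mul, ← integral_neg]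
    congr 1
    ext s
    rw [hχd]
    ring
  rw [e1, hpr, ← integral_const_mul]
  congr 2
  ext s
  ring

/-- If the weak inequality holds for all frozen values `w s` of the test function, then it holds
for the test function `w` itself. -/
theorem weak_of_frozen {T : ℝ} (hT : 0 < T) {V : Type*} [NormedAddCommGroup V]
    [InnerProductSpace ℝ V] [CompleteSpace V] {E : ℝ → ℝ} {v w dw : ℝ → V} {L : ℝ → ℝ → ℝ}
    (hE : MemLp E ⊤ (timeMeas T)) (hv : MemLp v ⊤ (timeMeas T)) (hw : MemLp w ⊤ (timeMeas T))
    (hdw : IntegrableOn dw (Ioo 0 T))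
    (hwdw : ∀ t ∈ Icc 0 T, w t = w 0 + ∫ τ in (0 : ℝ)..t, dw τ)
    {θ : ℝ → ℝ} (hθ : IsTimeTest T θ) (hθ0 : ∀ t, 0 ≤ θ t)
    (hL : Mollifies T fun s t => θ t * L s t)
    (h : ∀ᵐ s ∂timeMeas T, WeakNonpos T (fun t => E t - inner ℝ (v t) (w s)) (L s)) :
    -(∫ t in Ioo 0 T, deriv θ t * (E t - inner ℝ (v t) (w t)))
      + ∫ t in Ioo 0 T, θ t * (L t t + inner ℝ (v t) (dw t)) ≤ 0 := by
  obtain ⟨δ, hδ, hmargin⟩ := hθ.exists_margin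
  obtain ⟨Cθ, hCθ⟩ := hθ.exists_bound
  have hEi : Integrable E (timeMeas T) := hE.integrable le_top
  have hvi : Integrable v (timeMeas T) := hv.integrable le_top
  have hwi : Integrable w (timeMeas T) := hw.integrable le_top
  have hβ₁ := mollifies_energy hE hv hw hθ.memLp_top_deriv
  have hβ₂ := mollifies_inner hv hdw hθ.memLp_top
  have hβ₀ := hL.sub hβ₁
  have hfin : (∫ t in Ioo 0 T, (θ t * L t t - deriv θ t * (E t - inner ℝ (v t) (w t))))
      + ∫ t in Ioo 0 T, θ t * inner ℝ (v t) (dw t) ≤ 0 := by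
    -- For each `n` this is the frozen inequality tested with `θ t * mker ℝ n (t - s)` and
    -- integrated in `s`. By `hI` the singular term is an average of `θ (v, dw)`, so every term
    -- converges to its diagonal.
    refine le_of_tendsto (hβ₀.tendsto.add hβ₂.tendsto) ?_
    filter_upwards [(tendsto_moll_rOut ℝ).eventually_lt_const hδ] with n hn
    obtain ⟨hρd, Cρ, hCρ⟩ :=
      continuous_bounded_deriv (contDiff_mker (E := ℝ) n) (hasCompactSupport_mker (E := ℝ) n)
    have hJ := integrable_frozen hEi hvi hwi hθ.smooth.continuous hρd hCθ hCρ
    have hI : ∫ s in Ioo 0 T, ∫ t in Ioo 0 T, θ t * deriv (mker ℝ n) (t - s)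
          * (E t - inner ℝ (v t) (w s))
        = -∫ s in Ioo 0 T, ∫ t in Ioo 0 T, mker ℝ n (t - s) * (θ t * inner ℝ (v t) (dw s)) := by
      refine (integral_integral_swap hJ).trans
        (Eq.trans ?_ (congrArg Neg.neg (integral_integral_swap (hβ₂.integrable n)).symm))
      rw [← integral_neg]
      exact integral_congr_ae (Eventually.of_forall fun t =>
        integral_frozen_eq hT hdw hwdw hδ hmargin hn t)
    have hae : ∀ᵐ s ∂timeMeas T,
        (∫ t in Ioo 0 T, mker ℝ n (t - s)
            * (θ t * L s t - deriv θ t * (E t - inner ℝ (v t) (w s))))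
          - ∫ t in Ioo 0 T, θ t * deriv (mker ℝ n) (t - s)
            * (E t - inner ℝ (v t) (w s)) ≤ 0 := by
      filter_upwards [h, (hL.integrable n).prod_right_ae, (hβ₁.integrable n).prod_right_ae,
        hJ.prod_right_ae] with s hs h1 h2 h3
      have hd : ∀ t, deriv (fun t => mker ℝ n (t - s)) t = deriv (mker ℝ n) (t - s) := fun t =>
        deriv_comp_sub_const (mker ℝ n) s t
      have h5 := frozen_test (ρ := fun t => mker ℝ n (t - s)) hθ hθ0
        ((contDiff_mker n).comp (contDiff_id.sub contDiff_const)) (fun t => mker_nonneg n _)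
        h1 h2 (by simpa only [hd] using h3) hs
      simpa only [hd] using h5
    have hInt := integral_nonpos_of_ae hae
    rw [integral_sub (hβ₀.integrable n).integral_prod_left hJ.integral_prod_left, hI] at hInt
    linarith
  have e5 : ∫ t in Ioo 0 T, θ t * (L t t + inner ℝ (v t) (dw t))
      = (∫ t in Ioo 0 T, θ t * L t t) + ∫ t in Ioo 0 T, θ t * inner ℝ (v t) (dw t) := by
    rw [← integral_add hL.integrable_diag hβ₂.integrable_diag]
    simp only [mul_add]
  rw [integral_sub hL.integrable_diag hβ₁.integrable_diag] at hfin
  rw [e5]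
  linarith

/-! ### The energy identity for the test functions -/

/-- `½ ‖w‖²` has the derivative `(w, dw)` almost everywhere, but integration by parts needs absolute
continuity. This is inherited from `J = ∫ ‖dw‖`: the increments of `½ ‖w‖²` are at most `C` times
those of `J`, with `C` a bound for `‖w‖`. -/
theorem energy_identity {T : ℝ} (hT : 0 < T) {V : Type*} [NormedAddCommGroup V]
    [InnerProductSpace ℝ V] [CompleteSpace V] {w dw : ℝ → V} (hdw : IntegrableOn dw (Ioo 0 T))
    (hwdw : ∀ t ∈ Icc 0 T, w t = w 0 + ∫ τ in (0 : ℝ)..t, dw τ) {θ : ℝ → ℝ}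
    (hθ : IsTimeTest T θ) :
    ∫ t in Ioo 0 T, deriv θ t * (1 / 2 * ‖w t‖ ^ 2)
      = -∫ t in Ioo 0 T, θ t * inner ℝ (w t) (dw t) := by
  have hI : IntervalIntegrable dw volume 0 T :=
    (intervalIntegrable_iff_integrableOn_Ioo_of_le hT.le).2 hdw
  have hsub : ∀ {a b : ℝ}, a ∈ Icc 0 T → b ∈ Icc 0 T → IntervalIntegrable dw volume a b :=
    fun ha hb => hI.mono_set (by
      rw [uIcc_of_le hT.le]
      exact (convex_Icc 0 T).ordConnected.uIcc_subset ha hb)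
  have h0 : (0 : ℝ) ∈ Icc 0 T := left_mem_Icc.2 hT.le
  set J : ℝ → ℝ := fun x => ∫ τ in (0 : ℝ)..x, ‖dw τ‖ with hJ
  have hJac : AbsolutelyContinuousOnInterval J 0 T :=
    hI.norm.absolutelyContinuousOnInterval_intervalIntegral (c := 0) (by simp)
  have hdist : ∀ {a b : ℝ}, a ∈ Icc 0 T → b ∈ Icc 0 T → ‖w a - w b‖ ≤ dist (J a) (J b) := by
    intro a b ha hb
    rw [hwdw a ha, hwdw b hb, add_sub_add_left_eq_sub,
      intervalIntegral.integral_interval_sub_left (hsub h0 ha) (hsub h0 hb), Real.dist_eq, hJ,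
      intervalIntegral.integral_interval_sub_left (hsub h0 ha).norm (hsub h0 hb).norm]
    exact intervalIntegral.norm_integral_le_abs_integral_norm
  set C : ℝ := ‖w 0‖ + J T with hC
  have hJmono : ∀ {a : ℝ}, a ∈ Icc 0 T → dist (J a) (J 0) ≤ J T := by
    intro a ha
    have h1 : J 0 = 0 := intervalIntegral.integral_same
    have h2 : 0 ≤ J a := intervalIntegral.integral_nonneg ha.1 fun _ _ => norm_nonneg _
    have h3 : J T - J a = ∫ τ in a..T, ‖dw τ‖ :=
      intervalIntegral.integral_interval_sub_left (hsub h0 (right_mem_Icc.2 hT.le)).norm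
        (hsub h0 ha).norm
    have h4 : 0 ≤ ∫ τ in a..T, ‖dw τ‖ :=
      intervalIntegral.integral_nonneg ha.2 fun _ _ => norm_nonneg _
    rw [h1, Real.dist_eq, sub_zero, abs_of_nonneg h2]
    linarith
  have hbound : ∀ {a : ℝ}, a ∈ Icc 0 T → ‖w a‖ ≤ C := by
    intro a ha
    have h1 := hdist ha h0
    have h2 : ‖w a‖ ≤ ‖w 0‖ + ‖w a - w 0‖ := by
      have := norm_add_le (w 0) (w a - w 0)
      rwa [add_sub_cancel] at this
    linarith [hJmono ha]
  set N : ℝ → ℝ := fun t => 1 / 2 * ‖w t‖ ^ 2 with hN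
  have hNdist : ∀ {a b : ℝ}, a ∈ Icc 0 T → b ∈ Icc 0 T →
      dist (N a) (N b) ≤ C * dist (J a) (J b) := by
    intro a b ha hb
    have h1 := hdist ha hb
    have h2 := hbound ha
    have h3 := hbound hb
    have h4 : |‖w a‖ - ‖w b‖| ≤ ‖w a - w b‖ := abs_norm_sub_norm_le _ _
    have e : N a - N b = 1 / 2 * (‖w a‖ + ‖w b‖) * (‖w a‖ - ‖w b‖) := by
      simp only [hN]
      ring
    rw [Real.dist_eq, e, abs_mul, abs_of_nonneg (by positivity)]
    exact mul_le_mul (by linarith) (h4.trans h1) (abs_nonneg _) ((norm_nonneg _).trans h2)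
  have hNac : AbsolutelyContinuousOnInterval N 0 T := by
    rw [absolutelyContinuousOnInterval_iff] at hJac ⊢
    have hC0 : 0 ≤ C := (norm_nonneg _).trans (hbound h0)
    intro ε hε
    -- `C + 1` instead of `C`, since `C` may vanish.
    obtain ⟨δ, hδ, h⟩ := hJac (ε / (C + 1)) (by positivity)
    refine ⟨δ, hδ, fun E hE hEδ => ?_⟩
    have h2 := h E hE hEδ
    have h3 : ∑ i ∈ Finset.range E.1, dist (N (E.2 i).1) (N (E.2 i).2)
        ≤ C * ∑ i ∈ Finset.range E.1, dist (J (E.2 i).1) (J (E.2 i).2) := by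
      rw [Finset.mul_sum]
      refine Finset.sum_le_sum fun i hi => ?_
      have h4 := hE.1 i hi
      rw [uIcc_of_le hT.le] at h4
      exact hNdist h4.1 h4.2
    have h5 : C * ∑ i ∈ Finset.range E.1, dist (J (E.2 i).1) (J (E.2 i).2)
        ≤ C * (ε / (C + 1)) := by gcongr
    have h6 : C * (ε / (C + 1)) < ε := by
      rw [mul_div_assoc', div_lt_iff₀ (by positivity)]
      nlinarith
    linarith
  have hθac : AbsolutelyContinuousOnInterval θ 0 T :=
    (hθ.smooth.of_le (by simp)).contDiffOn.absolutelyContinuousOnInterval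
  have h := hθac.integral_mul_deriv_eq_deriv_mul hNac
  have hder : ∫ t in (0 : ℝ)..T, θ t * deriv N t
      = ∫ t in (0 : ℝ)..T, θ t * inner ℝ (w t) (dw t) := by
    refine intervalIntegral.integral_congr_ae ?_
    -- `w` is a primitive only on `[0, T]`, so a two-sided derivative is available only in the
    -- interior.
    have hne : ∀ᵐ t : ℝ, t ≠ T := by simp [ae_iff, measure_singleton]
    filter_upwards [hI.ae_hasDerivAt_integral, hne] with t ht htT htm
    rw [uIoc_of_le hT.le] at htm
    have htm' : t ∈ Ioo 0 T := ⟨htm.1, lt_of_le_of_ne htm.2 htT⟩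
    have h1 : HasDerivAt (fun x => w 0 + ∫ τ in (0 : ℝ)..x, dw τ) (dw t) t :=
      (ht (by rw [uIcc_of_le hT.le]; exact Ioc_subset_Icc_self htm) 0 (by simp)).const_add _
    have h2 : HasDerivAt w (dw t) t := by
      refine h1.congr_of_eventuallyEq ?_
      filter_upwards [Ioo_mem_nhds htm'.1 htm'.2] with x hx
      exact hwdw x (Ioo_subset_Icc_self hx)
    have h3 : HasDerivAt N (1 / 2 * (2 * inner ℝ (w t) (dw t))) t := h2.norm_sq.const_mul _
    rw [h3.deriv]
    ring
  rw [hder, hθ.eq_zero (by simp), hθ.eq_zero (by simp)] at h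
  rw [← integral_Ioc_eq_integral_Ioo, ← integral_Ioc_eq_integral_Ioo,
    ← intervalIntegral.integral_of_le hT.le, ← intervalIntegral.integral_of_le hT.le, h]
  rw [zero_mul, zero_mul, sub_zero, zero_sub, neg_neg]

/-! ### The rates are affine in the test function -/

section Rates

variable {d : ℕ} {Ω : Set (Vec d)} {ν T : ℝ} {K : L2sol Ω → ENNReal}

/-- The linear part of the rate, as a function of the test function at a fixed time. -/
def linRate (ν : ℝ) (h : L2Mat Ω) (M : Lp (Mat d) 1 (volume.restrict Ω)) (g : L2 Ω)
    (u : L2sol Ω) : ℝ :=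
  inner ℝ (vgrad ν u) h + (∫ x in Ω, inner ℝ (grad u x) (M x)) + inner ℝ (u : L2 Ω) g

/-- Separates what involves only the solution from what is linear in the test function `w` and its
gradient `B`; the data of `IsRate` are read off here. -/
theorem affine_form {E F : Type*} [NormedAddCommGroup E] [InnerProductSpace ℝ E]
    [NormedAddCommGroup F] [InnerProductSpace ℝ F] (ν m : ℝ) (v w z g : E) (A B g₁ : F)
    (hz : z = v - w) :
    ν * inner ℝ A (A - B) + m - (inner ℝ g z + inner ℝ g₁ (A - B))
      = (ν * inner ℝ A A - inner ℝ g v - inner ℝ g₁ A)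
        + (inner ℝ B (g₁ - ν • A) + m + inner ℝ w g) := by
  subst hz
  simp only [inner_sub_right, real_inner_smul_right]
  rw [real_inner_comm A B, real_inner_comm g₁ B, real_inner_comm g w]
  ring

theorem formRate_eq (v w : L2sol Ω) (A B : L2Mat Ω)
    (G : Lp (Mat d) ⊤ (volume.restrict Ω)) (g : L2 Ω) (g₁ : L2Mat Ω) :
    formRate ν v A w B G g g₁
      = (ν * inner ℝ A A - inner ℝ g (v : L2 Ω) - inner ℝ g₁ A)
        + (inner ℝ B (g₁ - ν • A) + matPair Ω G (tensor Ω v v) + inner ℝ (w : L2 Ω) g) :=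
  affine_form ν _ (v : L2 Ω) (w : L2 Ω) _ g A B g₁ (Submodule.coe_sub _ v w)

theorem integral_grad_eq_matPair (hΩ : IsOpen Ω) (hΩb : Bornology.IsBounded Ω) {u : L2sol Ω}
    {G : Lp (Mat d) ⊤ (volume.restrict Ω)} (h : HasWeakGrad Ω (u : L2 Ω) G)
    (M : Lp (Mat d) 1 (volume.restrict Ω)) :
    ∫ x in Ω, inner ℝ (grad u x) (M x) = matPair Ω G M := by
  rw [matPair_eq]
  refine integral_congr_ae ?_
  filter_upwards [grad_ae_eq hΩ hΩb h] with x hx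
  rw [hx]

/-- The data `c, h, M, g` of the rates: up to the term with the time derivative of the test
function they are affine in the test function. -/
structure IsRate (ν T : ℝ) (K : L2sol Ω → ENNReal) (f : Force Ω ν T) (v : ℝ → L2sol Ω)
    (c : ℝ → ℝ) (h : ℝ → L2Mat Ω) (M : ℝ → Lp (Mat d) 1 (volume.restrict Ω)) (g : ℝ → L2 Ω) :
    Prop where
  integrable_const : IntegrableOn c (Ioo 0 T)
  memLp_visc : MemLp h 2 (timeMeas T)
  memLp_conv : MemLp M ⊤ (timeMeas T)
  integrable_force : IntegrableOn g (Ioo 0 T)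
  relRate_eq : ∀ (ξ : ℝ → ℝ) (p : TestFun ν T K), ∀ᵐ t ∂timeMeas T,
    relRate f v ξ p t = c t + linRate ν (h t) (M t) (g t) (p.u t)
      + inner ℝ (p.du t) (v t - p.u t) - (K (p.u t)).toReal * ξ t
  reduced_eq : ∀ (ξ : ℝ → ℝ) (φ : SolField Ω), ∀ᵐ t ∂timeMeas T,
    ν * inner ℝ (grad (v t)) (grad (v t) - φ.gradL2)
        + (∫ x in Ω, ∑ i, ∑ j,
            ((v t : L2 Ω) x i * (v t : L2 Ω) x j) * gradField φ.toFun x (i, j))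
        - f.pair t (v t - φ.toL2sol)
        + (K φ.toL2sol).toReal * (1 / 2 * ‖v t‖ ^ 2 - energy v ξ t)
      = c t + linRate ν (h t) (M t) (g t) φ.toL2sol - (K φ.toL2sol).toReal * ξ t

theorem memLp_vgrad {v : ℝ → L2sol Ω} (hv : MemX ν T v) :
    MemLp (fun t => vgrad ν (v t)) 2 (timeMeas T) := by
  by_cases hν : 0 < ν
  · have e : (fun t => vgrad ν (v t)) = fun t => grad (v t) :=
      funext fun t => vgrad_of_pos hν _
    rw [e]
    exact hv.grad_memLp hν
  · have e : (fun t => vgrad ν (v t)) = fun _ => (0 : L2Mat Ω) :=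
      funext fun t => vgrad_of_not_pos hν _
    rw [e]
    exact MemLp.zero'

theorem memLp_coe {v : ℝ → L2sol Ω} {p : ENNReal} (hv : MemLp v p (timeMeas T)) :
    MemLp (fun t => (v t : L2 Ω)) p (timeMeas T) :=
  hv.continuousLinearMap_comp (L2sol Ω).subtypeL

theorem integrable_bilin {X Y Z : Type*} [NormedAddCommGroup X] [NormedSpace ℝ X]
    [NormedAddCommGroup Y] [NormedSpace ℝ Y] [NormedAddCommGroup Z] [NormedSpace ℝ Z]
    {α : Type*} [MeasurableSpace α] {μ : Measure α} (B : X →L[ℝ] Y →L[ℝ] Z) {p q : ENNReal}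
    [p.HolderConjugate q] {a : α → X} {b : α → Y} (ha : MemLp a p μ) (hb : MemLp b q μ) :
    Integrable (fun t => B (a t) (b t)) μ :=
  memLp_one_iff_integrable.1 (B.memLp_of_bilin 1 ha hb)

theorem memLp_top_bilin {X Y Z : Type*} [NormedAddCommGroup X] [NormedSpace ℝ X]
    [NormedAddCommGroup Y] [NormedSpace ℝ Y] [NormedAddCommGroup Z] [NormedSpace ℝ Z]
    {α : Type*} [MeasurableSpace α] {μ : Measure α} (B : X →L[ℝ] Y →L[ℝ] Z)
    {a : α → X} {b : α → Y} (ha : MemLp a ⊤ μ) (hb : MemLp b ⊤ μ) :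
    MemLp (fun t => B (a t) (b t)) ⊤ μ :=
  B.memLp_of_bilin ⊤ ha hb

/-- The same expansion by `affine_form` as for the relative rate, so that both inequalities are
governed by identical data. -/
theorem reducedRate_eq (hΩ : IsOpen Ω) (hΩb : Bornology.IsBounded Ω) (hν : 0 ≤ ν)
    (f : Force Ω ν T) {t : ℝ} {v : L2sol Ω} (hv : 0 < ν → MemH10sol v)
    {g : L2 Ω} {g₁ : L2Mat Ω} (φ : SolField Ω)
    (hf : ∀ z : L2sol Ω, (0 < ν → ((z : L2 Ω), grad z) ∈ H10 Ω) →
        f.pair t z = inner ℝ g (z : L2 Ω) + inner ℝ g₁ (vgrad ν z)) :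
    ν * inner ℝ (grad v) (grad v - φ.gradL2)
        + (∫ x in Ω, ∑ i, ∑ j, ((v : L2 Ω) x i * (v : L2 Ω) x j) * gradField φ.toFun x (i, j))
        - f.pair t (v - φ.toL2sol)
      = (ν * inner ℝ (vgrad ν v) (vgrad ν v) - inner ℝ g (v : L2 Ω) - inner ℝ g₁ (vgrad ν v))
        + linRate ν (g₁ - ν • vgrad ν v) (tensor Ω v v) g φ.toL2sol := by
  have hgφ := φ.grad_toL2sol hΩ hΩb
  have hconv : ∫ x in Ω, ∑ i, ∑ j,
      ((v : L2 Ω) x i * (v : L2 Ω) x j) * gradField φ.toFun x (i, j)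
      = ∫ x in Ω, inner ℝ (grad φ.toL2sol x) (tensor Ω v v x) := by
    rw [hgφ]
    refine integral_congr_ae ?_
    have h1 : φ.gradL2 =ᵐ[volume.restrict Ω] gradField φ.toFun := φ.memLp_grad.coeFn_toLp
    filter_upwards [coeFn_tensor (v : L2 Ω) (v : L2 Ω), h1] with x hx h2
    rw [hx, inner_outer, h2]
    refine Finset.sum_congr rfl fun i _ => Finset.sum_congr rfl fun j _ => ?_
    ring
  have hlin : linRate ν (g₁ - ν • vgrad ν v) (tensor Ω v v) g φ.toL2sol
      = inner ℝ (vgrad ν φ.toL2sol) (g₁ - ν • vgrad ν v)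
        + (∫ x in Ω, inner ℝ (grad φ.toL2sol x) (tensor Ω v v x))
        + inner ℝ (φ.toL2sol : L2 Ω) g := rfl
  have hz : 0 < ν → (((v - φ.toL2sol : L2sol Ω) : L2 Ω), grad (v - φ.toL2sol)) ∈ H10 Ω := by
    intro hpos
    rw [(hv hpos).grad_sub hΩ hΩb (φ.memH10sol hΩ hΩb)]
    exact (hv hpos).sub_mem_H10 (φ.memH10sol hΩ hΩb)
  have hpair := hf _ hz
  have haff := affine_form ν (∫ x in Ω, inner ℝ (grad φ.toL2sol x) (tensor Ω v v x)) (v : L2 Ω)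
    (φ.toL2sol : L2 Ω) ((v - φ.toL2sol : L2sol Ω) : L2 Ω) g (vgrad ν v) (vgrad ν φ.toL2sol) g₁
    (Submodule.coe_sub _ v φ.toL2sol)
  have hsub : inner ℝ g₁ (vgrad ν (v - φ.toL2sol))
      = inner ℝ g₁ (vgrad ν v - vgrad ν φ.toL2sol) := by
    refine congrArg (inner ℝ g₁) ?_
    by_cases hpos : 0 < ν
    · exact ((vgrad_of_pos hpos _).trans ((hv hpos).grad_sub hΩ hΩb (φ.memH10sol hΩ hΩb))).trans
        (congrArg₂ (· - ·) (vgrad_of_pos hpos v) (vgrad_of_pos hpos _)).symm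
    · exact (vgrad_of_not_pos hpos _).trans ((sub_self (0 : L2Mat Ω)).symm.trans
        (congrArg₂ (· - ·) (vgrad_of_not_pos hpos v) (vgrad_of_not_pos hpos _)).symm)
  have hvisc : ν * inner ℝ (grad v) (grad v - φ.gradL2)
      = ν * inner ℝ (vgrad ν v) (vgrad ν v - vgrad ν φ.toL2sol) := by
    rcases hν.eq_or_lt with h0 | hpos
    · rw [← h0, zero_mul, zero_mul]
    · refine congrArg (ν * ·) ?_
      exact congrArg₂ (fun x y => inner ℝ x (x - y)) (vgrad_of_pos hpos v).symm
        (((vgrad_of_pos hpos _).trans hgφ).symm)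
  have arith : ∀ {a m p b m' q r s x l A₁ A₃ : ℝ}, a = b → m = m' → p = q + r → r = s →
      b + m' - (q + s) = x + (A₁ + m' + A₃) → l = A₁ + m' + A₃ → a + m - p = x + l := by
    intros
    subst_vars
    linarith
  exact arith hvisc hconv hpair hsub haff hlin

theorem exists_isRate (hΩ : IsOpen Ω) (hΩb : Bornology.IsBounded Ω) (hν : 0 ≤ ν)
    (K : L2sol Ω → ENNReal) (f : Force Ω ν T) {v : ℝ → L2sol Ω} (hv : MemX ν T v) :
    ∃ c h M g, IsRate ν T K f v c h M g := by
  obtain ⟨g, g₁, hg, hg₁, hf⟩ := f.exists_repr hν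
  have hA := memLp_vgrad hv
  have hvc := memLp_coe hv.bounded
  have hv10 : ∀ᵐ t ∂timeMeas T, 0 < ν → MemH10sol (v t) := by
    by_cases hpos : 0 < ν
    · exact (hv.memH10sol hpos).mono fun t ht _ => ht
    · exact Eventually.of_forall fun t h => absurd h hpos
  -- From `affine_form`: `c` collects the terms without test function, `g₁ - ν ∇v` and `v ⊗ v` pair
  -- with its gradient, `g` with the field itself. The classes `L²(L²)`, `L^∞(L¹)`, `L¹(L²)` of the
  -- last three match the continuity requirements of admissibility.
  refine ⟨fun t => ν * inner ℝ (vgrad ν (v t)) (vgrad ν (v t)) - inner ℝ (g t) (v t : L2 Ω)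
    - inner ℝ (g₁ t) (vgrad ν (v t)), fun t => g₁ t - ν • vgrad ν (v t),
    fun t => tensor Ω (v t) (v t), g, ?_, hg₁.sub (hA.const_smul ν),
    memLp_top_bilin (tensor Ω) hvc hvc, hg, fun ξ p => ?_, fun ξ φ => ?_⟩
  · have i1 := integrable_bilin (innerB (L2Mat Ω)) hA hA
    have i2 := integrable_bilin (innerB (L2 Ω)) (memLp_one_iff_integrable.2 hg) hvc
    have i3 := integrable_bilin (innerB (L2Mat Ω)) hg₁ hA
    exact ((i1.const_mul ν).sub i2).sub i3
  · obtain ⟨U, G, -, -, hUG⟩ := p.memY.memL1W1inf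
    have hp10 : ∀ᵐ t ∂timeMeas T, 0 < ν → MemH10sol (p.u t) := by
      by_cases hpos : 0 < ν
      · exact (p.memY.memX.memH10sol hpos).mono fun t ht _ => ht
      · exact Eventually.of_forall fun t h => absurd h hpos
    filter_upwards [hUG, hv10, hp10] with t ht h1 h2
    have hW : IsW1inf (p.u t : L2 Ω) (U t) (G t) := ⟨ht.1, ht.2⟩
    have e1 := relForm_add_sysOp hΩ hΩb hν K f (dw := p.du t) h1 h2 hW (hf t)
    have e2 := formRate_eq (ν := ν) (v t) (p.u t) (vgrad ν (v t)) (vgrad ν (p.u t)) (G t) (g t)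
      (g₁ t)
    have e3 := integral_grad_eq_matPair hΩ hΩb ht.2 (tensor Ω (v t) (v t))
    have e4 : relRate f v ξ p t = relForm ν K (v t) (p.u t)
        + sysOp f t (p.u t) (p.du t) (v t - p.u t)
        - (K (p.u t)).toReal * (relEnergy (v t) (p.u t) + ξ t) := rfl
    have e5 : linRate ν (g₁ t - ν • vgrad ν (v t)) (tensor Ω (v t) (v t)) (g t) (p.u t)
        = inner ℝ (vgrad ν (p.u t)) (g₁ t - ν • vgrad ν (v t))
          + (∫ x in Ω, inner ℝ (grad (p.u t) x) (tensor Ω (v t) (v t) x))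
          + inner ℝ (p.u t : L2 Ω) (g t) := rfl
    have arith : ∀ {R F S k r x fr i c a m m' b l : ℝ}, F + S = fr + i + k * r →
        fr = c + (a + m + b) → m' = m → R = F + S - k * (r + x) → l = a + m' + b →
        R = c + l + i - k * x := by
      intros
      subst_vars
      linarith
    exact arith e1 e2 e3 e4 e5
  · filter_upwards [hv10] with t h1
    have e1 := reducedRate_eq hΩ hΩb hν f h1 φ (hf t)
    have arith : ∀ {a b c k n x : ℝ}, a = b + c → a + k * (n - (n + x)) = b + c - k * x := by
      intros
      subst_vars
      ring
    exact arith e1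

end Rates

/-! ### The weak form common to the inequalities -/

theorem WeakNonpos.congr_rate {T : ℝ} {F g g' : ℝ → ℝ} (h : g =ᵐ[timeMeas T] g') :
    WeakNonpos T F g ↔ WeakNonpos T F g' := by
  have e : ∀ θ : ℝ → ℝ, ∫ t in Ioo 0 T, θ t * g t = ∫ t in Ioo 0 T, θ t * g' t := fun θ =>
    integral_congr_ae (h.mono fun t ht => congrArg (θ t * ·) ht)
  simp only [WeakNonpos, e]

section Rates

variable {d : ℕ} {Ω : Set (Vec d)} {ν T : ℝ} {K : L2sol Ω → ENNReal} {f : Force Ω ν T}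
  {v : ℝ → L2sol Ω} {ξ : ℝ → ℝ} {c : ℝ → ℝ} {h : ℝ → L2Mat Ω}
  {M : ℝ → Lp (Mat d) 1 (volume.restrict Ω)} {g : ℝ → L2 Ω}

theorem memLp_top_norm_sq {V : Type*} [NormedAddCommGroup V] [InnerProductSpace ℝ V]
    {a : ℝ → V} (ha : MemLp a ⊤ (timeMeas T)) (r : ℝ) :
    MemLp (fun t => r * ‖a t‖ ^ 2) ⊤ (timeMeas T) := by
  have h1 := (memLp_top_bilin (innerB V) ha ha).const_mul r
  have e : (fun t => r * ‖a t‖ ^ 2) = fun t => r * innerB V (a t) (a t) :=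
    funext fun t => congrArg (r * ·) (real_inner_self_eq_norm_sq _).symm
  rwa [e]

theorem memLp_top_energy (hv : MemLp v ⊤ (timeMeas T)) (hξ : MemLp ξ ⊤ (timeMeas T)) :
    MemLp (energy v ξ) ⊤ (timeMeas T) :=
  (memLp_top_norm_sq hv (1 / 2)).add hξ

theorem memLp_top_relEnergy {u : ℝ → L2sol Ω} (hv : MemLp v ⊤ (timeMeas T))
    (hu : MemLp u ⊤ (timeMeas T)) (hξ : MemLp ξ ⊤ (timeMeas T)) :
    MemLp (fun t => relEnergy (v t) (u t) + ξ t) ⊤ (timeMeas T) :=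
  (memLp_top_norm_sq (hv.sub hu) (1 / 2)).add hξ

theorem memLp_top_reducedEnergy {u : ℝ → L2sol Ω} (hv : MemLp v ⊤ (timeMeas T))
    (hu : MemLp u ⊤ (timeMeas T)) (hξ : MemLp ξ ⊤ (timeMeas T)) :
    MemLp (fun t => energy v ξ t - inner ℝ (v t) (u t)) ⊤ (timeMeas T) :=
  (memLp_top_energy hv hξ).sub (memLp_top_bilin (innerB (L2sol Ω)) hv hu)

/-- The rate of the reduced inequality for the test function `u`. -/
def frozenRate (ν : ℝ) (K : L2sol Ω → ENNReal) (ξ c : ℝ → ℝ) (h : ℝ → L2Mat Ω)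
    (M : ℝ → Lp (Mat d) 1 (volume.restrict Ω)) (g : ℝ → L2 Ω) (u : L2sol Ω) (t : ℝ) : ℝ :=
  c t + linRate ν (h t) (M t) (g t) u - (K u).toReal * ξ t

/-- Hölder's inequality in time for each of the three pairings. The convective integral is replaced
by the continuous form `matPair`, which also settles measurability in time. -/
theorem IsRate.integrable_linRate (H : IsRate ν T K f v c h M g) (hΩ : IsOpen Ω)
    (hΩb : Bornology.IsBounded Ω) (p : TestFun ν T K) :
    Integrable (fun t => linRate ν (h t) (M t) (g t) (p.u t)) (timeMeas T) := by
  obtain ⟨U, G, -, hG, hUG⟩ := p.memY.memL1W1inf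
  have i1 := integrable_bilin (innerB (L2Mat Ω)) (memLp_vgrad p.memY.memX) H.memLp_visc
  have i2 := integrable_bilin (matPair Ω) (memLp_one_iff_integrable.2 hG) H.memLp_conv
  have i3 := integrable_bilin (innerB (L2 Ω)) (memLp_coe p.memY.memX.bounded)
    (memLp_one_iff_integrable.2 H.integrable_force)
  refine ((i1.add i2).add i3).congr ?_
  filter_upwards [hUG] with t ht
  exact congrArg₂ (· + ·) (congrArg (_ + ·) (integral_grad_eq_matPair hΩ hΩb ht.2 (M t)).symm) rfl

theorem IsRate.integrable_frozenRate (H : IsRate ν T K f v c h M g) (hΩ : IsOpen Ω)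
    (hΩb : Bornology.IsBounded Ω) (hξ : MemLp ξ ⊤ (timeMeas T)) (p : TestFun ν T K) :
    Integrable (fun t => frozenRate ν K ξ c h M g (p.u t) t) (timeMeas T) :=
  (Integrable.add H.integrable_const (H.integrable_linRate hΩ hΩb p)).sub
    (integrable_bilin (ContinuousLinearMap.mul ℝ ℝ)
      (memLp_one_iff_integrable.2 p.integrable_K) hξ)

theorem TestFun.integrable_du (p : TestFun ν T K) : Integrable p.du (timeMeas T) :=
  p.memY.deriv_memLp.integrable one_le_two

theorem TestFun.integrable_inner_du (p : TestFun ν T K) {a : ℝ → L2sol Ω}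
    (ha : MemLp a ⊤ (timeMeas T)) :
    Integrable (fun t => inner ℝ (a t) (p.du t)) (timeMeas T) :=
  integrable_bilin (innerB (L2sol Ω)) ha (memLp_one_iff_integrable.2 p.integrable_du)

theorem IsRate.relRate_ae_eq (H : IsRate ν T K f v c h M g) (ξ : ℝ → ℝ) (p : TestFun ν T K) :
    relRate f v ξ p =ᵐ[timeMeas T] fun t => frozenRate ν K ξ c h M g (p.u t) t
      + inner ℝ (v t) (p.du t) - inner ℝ (p.u t) (p.du t) := by
  filter_upwards [H.relRate_eq ξ p] with t ht
  have e1 : inner ℝ (p.du t) (v t - p.u t)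
      = inner ℝ (v t) (p.du t) - inner ℝ (p.u t) (p.du t) :=
    (inner_sub_right _ _ _).trans
      (congrArg₂ (· - ·) (real_inner_comm _ _) (real_inner_comm _ _))
  have e2 : frozenRate ν K ξ c h M g (p.u t) t
      = c t + linRate ν (h t) (M t) (g t) (p.u t) - (K (p.u t)).toReal * ξ t := rfl
  have arith : ∀ {r l i k a b z : ℝ}, r = l + i - k → i = a - b → z = l - k →
      r = z + a - b := by
    intros
    subst_vars
    ring
  exact arith ht e1 e2

theorem IsRate.integrable_relRate (H : IsRate ν T K f v c h M g) (hΩ : IsOpen Ω)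
    (hΩb : Bornology.IsBounded Ω) (hv : MemLp v ⊤ (timeMeas T)) (hξ : MemLp ξ ⊤ (timeMeas T))
    (p : TestFun ν T K) : IntegrableOn (relRate f v ξ p) (Ioo 0 T) :=
  (((H.integrable_frozenRate hΩ hΩb hξ p).add (p.integrable_inner_du hv)).sub
    (p.integrable_inner_du p.memY.memX.bounded)).congr (H.relRate_ae_eq ξ p).symm

/-- The weak form of the reduced inequality, for time-dependent test functions. -/
def weakForm (K : L2sol Ω → ENNReal) (v : ℝ → L2sol Ω) (ξ c : ℝ → ℝ) (h : ℝ → L2Mat Ω)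
    (M : ℝ → Lp (Mat d) 1 (volume.restrict Ω)) (g : ℝ → L2 Ω) (θ : ℝ → ℝ)
    (p : TestFun ν T K) : ℝ :=
  -(∫ t in Ioo 0 T, deriv θ t * (energy v ξ t - inner ℝ (v t) (p.u t)))
    + ∫ t in Ioo 0 T, θ t * (frozenRate ν K ξ c h M g (p.u t) t + inner ℝ (v t) (p.du t))

theorem relEnergy_eq {V : Type*} [NormedAddCommGroup V] [InnerProductSpace ℝ V] (v u : V) (x : ℝ) :
    1 / 2 * ‖v - u‖ ^ 2 + x = (1 / 2 * ‖v‖ ^ 2 + x - inner ℝ v u) + 1 / 2 * ‖u‖ ^ 2 := by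
  rw [norm_sub_sq_real]
  ring

/-- Expanding the square gives `ℛ(v | u) + ξ = (E - (v, u)) + ½ ‖u‖²`. By the energy identity the
derivative of the last summand cancels the term `-(u, du)` of the rate. -/
theorem IsRate.weak_eq_weakForm (H : IsRate ν T K f v c h M g) (hΩ : IsOpen Ω)
    (hΩb : Bornology.IsBounded Ω) (hT : 0 < T) (hv : MemLp v ⊤ (timeMeas T))
    (hξ : MemLp ξ ⊤ (timeMeas T)) (p : TestFun ν T K) {θ : ℝ → ℝ} (hθ : IsTimeTest T θ) :
    -(∫ t in Ioo 0 T, deriv θ t * (relEnergy (v t) (p.u t) + ξ t))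
        + ∫ t in Ioo 0 T, θ t * relRate f v ξ p t
      = weakForm K v ξ c h M g θ p := by
  have hu := p.memY.memX.bounded
  have hid := energy_identity hT p.integrable_du p.memY.eq_integral hθ
  have i1 : Integrable (fun t => deriv θ t * (energy v ξ t - inner ℝ (v t) (p.u t)))
      (timeMeas T) := hθ.integrable_deriv_mul ((memLp_top_reducedEnergy hv hu hξ).integrable le_top)
  have i2 : Integrable (fun t => deriv θ t * (1 / 2 * ‖p.u t‖ ^ 2)) (timeMeas T) :=
    hθ.integrable_deriv_mul ((memLp_top_norm_sq hu (1 / 2)).integrable le_top)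
  have i3 : Integrable (fun t => θ t * (frozenRate ν K ξ c h M g (p.u t) t
      + inner ℝ (v t) (p.du t))) (timeMeas T) :=
    hθ.integrable_mul ((H.integrable_frozenRate hΩ hΩb hξ p).add (p.integrable_inner_du hv))
  have i4 : Integrable (fun t => θ t * inner ℝ (p.u t) (p.du t)) (timeMeas T) :=
    hθ.integrable_mul (p.integrable_inner_du hu)
  have e1 : ∫ t in Ioo 0 T, deriv θ t * (relEnergy (v t) (p.u t) + ξ t)
      = (∫ t in Ioo 0 T, deriv θ t * (energy v ξ t - inner ℝ (v t) (p.u t)))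
        + ∫ t in Ioo 0 T, deriv θ t * (1 / 2 * ‖p.u t‖ ^ 2) := by
    refine Eq.trans (integral_congr_ae (Eventually.of_forall fun t => ?_)) (integral_add i1 i2)
    exact (congrArg (deriv θ t * ·) (relEnergy_eq (v t) (p.u t) (ξ t))).trans (mul_add _ _ _)
  have e2 : ∫ t in Ioo 0 T, θ t * relRate f v ξ p t
      = (∫ t in Ioo 0 T, θ t * (frozenRate ν K ξ c h M g (p.u t) t + inner ℝ (v t) (p.du t)))
        - ∫ t in Ioo 0 T, θ t * inner ℝ (p.u t) (p.du t) := by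
    refine Eq.trans (integral_congr_ae ?_) (integral_sub i3 i4)
    filter_upwards [H.relRate_ae_eq ξ p] with t ht
    exact (congrArg (θ t * ·) ht).trans (mul_sub _ _ _)
  have arith : ∀ {a b x y z w W : ℝ}, a = x + y → b = z - w → y = -w → W = -x + z →
      -a + b = W := by
    intros
    subst_vars
    ring
  exact arith e1 e2 hid rfl

theorem IsRate.local_iff (H : IsRate ν T K f v c h M g) (hΩ : IsOpen Ω)
    (hΩb : Bornology.IsBounded Ω) (hT : 0 < T) (hv : MemLp v ⊤ (timeMeas T))
    (hξ : MemLp ξ ⊤ (timeMeas T)) :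
    LocalInequality K f v ξ ↔ ∀ (p : TestFun ν T K) (θ : ℝ → ℝ), IsTimeTest T θ →
      (∀ t, 0 ≤ θ t) → weakForm K v ξ c h M g θ p ≤ 0 := by
  refine forall_congr' fun p => ?_
  rw [derivAddNonpos_iff_weakNonpos hT (memLp_top_relEnergy hv p.memY.memX.bounded hξ)
    (H.integrable_relRate hΩ hΩb hv hξ p)]
  refine forall_congr' fun θ => forall_congr' fun hθ => imp_congr_right fun _ => ?_
  rw [H.weak_eq_weakForm hΩ hΩb hT hv hξ p hθ]

/-- Once the rate is integrable, both formulations reduce to the same weak inequality, separately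
for each test function. -/
theorem IsRate.relative_iff_local (H : IsRate ν T K f v c h M g) (hΩ : IsOpen Ω)
    (hΩb : Bornology.IsBounded Ω) (hT : 0 < T) (hv : MemLp v ⊤ (timeMeas T))
    (hξ : MemLp ξ ⊤ (timeMeas T)) :
    RelativeEnergyInequality K f v ξ ↔ LocalInequality K f v ξ := by
  refine forall_congr' fun p => ?_
  have hF := memLp_top_relEnergy hv p.memY.memX.bounded hξ
  have hg := H.integrable_relRate hΩ hΩb hv hξ p
  rw [derivAddNonpos_iff_weakNonpos hT hF hg, ← limNonpos_iff_weakNonpos hT hF hg]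
  exact and_iff_right hg

/-! ### Test functions which do not depend on time -/

theorem TestField.continuous_gradField (φ : TestField Ω) : Continuous (gradField φ.toFun) := by
  have h := φ.smooth.continuous_fderiv (by simp)
  unfold gradField
  fun_prop

theorem TestField.hasCompactSupport_gradField (φ : TestField Ω) :
    HasCompactSupport (gradField φ.toFun) := by
  refine (φ.compactSupp.fderiv (𝕜 := ℝ)).mono fun x hx => ?_
  contrapose! hx
  simp only [Function.mem_support, ne_eq, not_not] at hx ⊢
  ext ij
  simp [gradField, hx]

theorem memLp_top_of_hasCompactSupport {E F : Type*} [NormedAddCommGroup E] [MeasurableSpace E]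
    [BorelSpace E] [NormedAddCommGroup F] [SecondCountableTopology F] {μ : Measure E} {η : E → F}
    (hη : Continuous η) (hc : HasCompactSupport η) : MemLp η ⊤ μ := by
  obtain ⟨C, hC⟩ := hη.bounded_above_of_compact_support hc
  exact memLp_top_of_bound hη.aestronglyMeasurable C (Eventually.of_forall hC)

theorem memL1W1inf_const (φ : SolField Ω) : MemL1W1inf T fun _ => φ.toL2sol := by
  have h1 : MemLp φ.toFun ⊤ (volume.restrict Ω) :=
    memLp_top_of_hasCompactSupport φ.smooth.continuous φ.compactSupp
  have h2 : MemLp (gradField φ.toFun) ⊤ (volume.restrict Ω) :=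
    memLp_top_of_hasCompactSupport φ.continuous_gradField φ.hasCompactSupport_gradField
  have h3 : φ.toL2 =ᵐ[volume.restrict Ω] φ.toFun := φ.memLp.coeFn_toLp
  exact ⟨fun _ => h1.toLp, fun _ => h2.toLp, integrable_const _, integrable_const _,
    Eventually.of_forall fun t => ⟨h1.coeFn_toLp.trans h3.symm,
      φ.hasWeakGrad.congr h3.symm h2.coeFn_toLp.symm⟩⟩

/-- The partial derivative of a test field. -/
def TestField.partialDeriv (φ : TestField Ω) (j : Fin d) : TestField Ω where
  toFun x := fderiv ℝ φ.toFun x (EuclideanSpace.single j 1)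
  smooth := (φ.smooth.fderiv_right (by simp)).clm_apply contDiff_const
  compactSupp := (φ.compactSupp.fderiv (𝕜 := ℝ)).comp_left
    (g := fun L : Vec d →L[ℝ] Vec d => L (EuclideanSpace.single j 1)) rfl
  supp_subset := (tsupport_fderiv_apply_subset ℝ _).trans φ.supp_subset

/-- The second derivatives of a test field. -/
def secondDeriv (φ : TestField Ω) (x : Vec d) : Tens d :=
  WithLp.toLp 2 fun ijk => gradField (φ.partialDeriv ijk.2.1).toFun x (ijk.1, ijk.2.2)

theorem memLp_secondDeriv (φ : TestField Ω) : MemLp (secondDeriv φ) 2 (volume.restrict Ω) := by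
  refine Continuous.memLp_of_hasCompactSupport ?_ ?_
  · refine (PiLp.continuous_toLp 2 _).comp (continuous_pi fun ijk => ?_)
    exact (EuclideanSpace.proj (ijk.1, ijk.2.2) : Mat d →L[ℝ] ℝ).continuous.comp
      (φ.partialDeriv ijk.2.1).continuous_gradField
  · refine HasCompactSupport.of_support_subset_isCompact φ.compactSupp.isCompact fun x hx => ?_
    by_contra hx'
    refine hx (PiLp.ext fun ijk => ?_)
    have h1 : x ∉ tsupport (φ.partialDeriv ijk.2.1).toFun := fun h =>
      hx' (tsupport_fderiv_apply_subset ℝ _ h)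
    have h2 : fderiv ℝ (φ.partialDeriv ijk.2.1).toFun x = 0 :=
      image_eq_zero_of_notMem_tsupport fun h => h1 (tsupport_fderiv_subset ℝ h)
    change fderiv ℝ (φ.partialDeriv ijk.2.1).toFun x (EuclideanSpace.single ijk.2.2 1) ijk.1 = 0
    rw [h2]
    rfl

theorem memL2H2_const (hΩ : IsOpen Ω) (hΩb : Bornology.IsBounded Ω) (φ : SolField Ω) :
    MemL2H2 T fun _ => φ.toL2sol := by
  refine ⟨fun _ => (memLp_secondDeriv φ.toTestField).toLp, memLp_const _,
    Eventually.of_forall fun t i j k η h1 h2 h3 => ?_⟩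
  have key := (φ.partialDeriv j).hasWeakGrad i k η h1 h2 h3
  have e1 : grad φ.toL2sol =ᵐ[volume.restrict Ω] gradField φ.toFun := by
    rw [φ.grad_toL2sol hΩ hΩb]
    exact φ.memLp_grad.coeFn_toLp
  refine (integral_congr_ae ?_).trans (key.trans (congrArg Neg.neg (integral_congr_ae ?_)))
  · filter_upwards [e1] with x hx
    rw [hx]
    rfl
  · filter_upwards [(memLp_secondDeriv φ.toTestField).coeFn_toLp] with x hx
    rw [hx]
    rfl

/-- The zero field. -/
def SolField.zero (Ω : Set (Vec d)) : SolField Ω where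
  toFun _ := 0
  smooth := contDiff_const
  compactSupp := HasCompactSupport.zero
  supp_subset := by simp [tsupport]
  div_free := by simp

theorem isC1Curve_const (φ : SolField Ω) :
    IsC1Curve T (fun _ => φ) fun _ => SolField.zero Ω where
  common_supp := ⟨_, φ.compactSupp.isCompact, φ.supp_subset, fun _ _ => Subset.rfl⟩
  hasDeriv m x t _ := by
    have e : iteratedFDeriv ℝ m (SolField.zero Ω).toFun x = 0 := by
      change iteratedFDeriv ℝ m (fun _ => (0 : Vec d)) x = 0
      simp
    rw [e]
    exact hasDerivWithinAt_const _ _ _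
  cont m := ((φ.smooth.continuous_iteratedFDeriv (by exact_mod_cast le_top)).comp
    continuous_snd).continuousOn
  cont_deriv m := (((SolField.zero Ω).smooth.continuous_iteratedFDeriv (by exact_mod_cast le_top)).comp
    continuous_snd).continuousOn

/-- A smooth compactly supported solenoidal field as a test function which does not depend on
time. -/
def TestFun.const (hΩ : IsOpen Ω) (hΩb : Bornology.IsBounded Ω) (hK : IsAdmissible ν T K)
    (φ : SolField Ω) : TestFun ν T K where
  u _ := φ.toL2sol
  du _ := 0
  memY :=
    { memX := ⟨memLp_top_const _, fun _ => Eventually.of_forall fun _ => φ.memH10sol hΩ hΩb,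
        fun _ => memLp_const _⟩
      memL2H2 := fun _ => memL2H2_const hΩ hΩb φ
      memL1W1inf := memL1W1inf_const φ
      deriv_memLp := MemLp.zero'
      eq_integral := fun t _ => by
        rw [intervalIntegral.integral_zero, add_zero] }
  memDom := hK.curve_memDom _ _ (isC1Curve_const φ)

theorem IsRate.reduced_iff (H : IsRate ν T K f v c h M g) (hΩ : IsOpen Ω)
    (hΩb : Bornology.IsBounded Ω) (hT : 0 < T) (hK : IsAdmissible ν T K)
    (hv : MemLp v ⊤ (timeMeas T)) (hξ : MemLp ξ ⊤ (timeMeas T)) :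
    ReducedInequality K f v ξ ↔ ∀ φ : SolField Ω,
      WeakNonpos T (fun t => energy v ξ t - inner ℝ (v t) φ.toL2sol)
        (frozenRate ν K ξ c h M g φ.toL2sol) := by
  refine forall_congr' fun φ => ?_
  have e : _ =ᵐ[timeMeas T] frozenRate ν K ξ c h M g φ.toL2sol := H.reduced_eq ξ φ
  -- Viewing `φ` as a time-independent test function supplies the integrability of the rate.
  have hi := H.integrable_frozenRate hΩ hΩb hξ (TestFun.const hΩ hΩb hK φ)
  rw [derivAddNonpos_iff_weakNonpos hT (memLp_top_reducedEnergy hv (memLp_top_const _) hξ)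
    (hi.congr (EventuallyEq.symm e))]
  exact WeakNonpos.congr_rate e

theorem weakNonpos_of_weakForm (hΩ : IsOpen Ω) (hΩb : Bornology.IsBounded Ω)
    (hK : IsAdmissible ν T K) (φ : SolField Ω)
    (hQ : ∀ θ, IsTimeTest T θ → (∀ t, 0 ≤ θ t) →
      weakForm K v ξ c h M g θ (TestFun.const hΩ hΩb hK φ) ≤ 0) :
    WeakNonpos T (fun t => energy v ξ t - inner ℝ (v t) φ.toL2sol)
        (frozenRate ν K ξ c h M g φ.toL2sol) := by
  intro θ hθ hθ0
  have h1 := hQ θ hθ hθ0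
  have e : ∫ t in Ioo 0 T, θ t * (frozenRate ν K ξ c h M g φ.toL2sol t
        + inner ℝ (v t) (0 : L2sol Ω))
      = ∫ t in Ioo 0 T, θ t * frozenRate ν K ξ c h M g φ.toL2sol t := by
    refine integral_congr_ae (Eventually.of_forall fun t => ?_)
    exact congrArg (θ t * ·) ((congrArg (_ + ·) (inner_zero_right _)).trans (add_zero _))
  exact (congrArg (-(∫ t in Ioo 0 T, deriv θ t * (energy v ξ t - inner ℝ (v t) φ.toL2sol)) + ·)
    e).symm.le.trans h1

end Rates

/-! ### Time-dependent smooth test functions -/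

theorem mollifies_mul_bilin {T : ℝ} {X Y : Type*} [NormedAddCommGroup X] [NormedSpace ℝ X]
    [CompleteSpace X] [NormedAddCommGroup Y] [NormedSpace ℝ Y] (B : X →L[ℝ] Y →L[ℝ] ℝ)
    {θ : ℝ → ℝ} (hθ : MemLp θ ⊤ (timeMeas T)) {a : ℝ → X} {b : ℝ → Y}
    (ha : MemLp a ⊤ (timeMeas T)) (hb : Integrable b (timeMeas T)) :
    Mollifies T fun s t => θ t * B (a s) (b t) := by
  have h := mollifies_bilin B ha (integrable_bilin (ContinuousLinearMap.lsmul ℝ ℝ) hθ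
    (memLp_one_iff_integrable.2 hb))
  have e : (fun s t => θ t * B (a s) (b t)) = fun s t => B (a s)
      (ContinuousLinearMap.lsmul ℝ ℝ (θ t) (b t)) := by
    ext s t
    rw [ContinuousLinearMap.lsmul_apply, map_smul, smul_eq_mul]
  rwa [e]

/-- The variant with the bounded factor at time `t`. It serves where only integrability in `s` is
known: the gradient in `L¹(0,T; L^∞)` and `K`. -/
theorem mollifies_mul_bilin' {T : ℝ} {X Y : Type*} [NormedAddCommGroup X] [NormedSpace ℝ X]
    [NormedAddCommGroup Y] [NormedSpace ℝ Y] [CompleteSpace Y] (B : X →L[ℝ] Y →L[ℝ] ℝ)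
    {θ : ℝ → ℝ} (hθ : MemLp θ ⊤ (timeMeas T)) {a : ℝ → X} {b : ℝ → Y}
    (ha : Integrable a (timeMeas T)) (hb : MemLp b ⊤ (timeMeas T)) :
    Mollifies T fun s t => θ t * B (a s) (b t) := by
  have h := (mollifies_bilin B.flip (memLp_top_bilin (ContinuousLinearMap.lsmul ℝ ℝ) hθ hb)
    ha).swap
  have e : (fun s t => θ t * B (a s) (b t)) = fun s t => B.flip
      (ContinuousLinearMap.lsmul ℝ ℝ (θ t) (b t)) (a s) := by
    ext s t
    rw [ContinuousLinearMap.lsmul_apply, ContinuousLinearMap.flip_apply, map_smul, smul_eq_mul]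
  rwa [e]

section Rates

variable {d : ℕ} {Ω : Set (Vec d)} {ν T : ℝ} {K : L2sol Ω → ENNReal} {f : Force Ω ν T}
  {v : ℝ → L2sol Ω} {ξ : ℝ → ℝ} {c : ℝ → ℝ} {h : ℝ → L2Mat Ω}
  {M : ℝ → Lp (Mat d) 1 (volume.restrict Ω)} {g : ℝ → L2 Ω}

/-- The gradient as a linear function of the derivative. -/
def gradMap (d : ℕ) : (Vec d →L[ℝ] Vec d) →L[ℝ] Mat d :=
  LinearMap.toContinuousLinearMap
    { toFun := fun L => WithLp.toLp 2 fun ij => L (EuclideanSpace.single ij.2 1) ij.1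
      map_add' := fun _ _ => rfl
      map_smul' := fun _ _ => rfl }

theorem gradField_eq_gradMap (φ : Vec d → Vec d) (x : Vec d) :
    gradField φ x = gradMap d (fderiv ℝ φ x) := rfl

/-- The derivatives are jointly continuous on the compact product of `[0, T]` with a common support,
and vanish off that support. -/
theorem IsC1Curve.exists_grad_bound {w w' : ℝ → SolField Ω} (hw : IsC1Curve T w w') :
    ∃ C, 0 ≤ C ∧ ∀ t ∈ Icc 0 T, ∀ x, ‖gradField (w t).toFun x‖ ≤ C := by
  obtain ⟨S, hS, -, hSw⟩ := hw.common_supp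
  obtain ⟨C, hC⟩ := (isCompact_Icc.prod hS).exists_bound_of_continuousOn
    ((hw.cont 1).mono (prod_mono_right (subset_univ S)))
  refine ⟨‖gradMap d‖ * max C 0, by positivity, fun t ht x => ?_⟩
  rw [gradField_eq_gradMap]
  refine (gradMap d).le_of_opNorm_le_of_le le_rfl ?_
  by_cases hx : x ∈ S
  · have h1 := hC (t, x) ⟨ht, hx⟩
    simp only [norm_iteratedFDeriv_one] at h1
    exact h1.trans (le_max_left _ _)
  · have h1 : fderiv ℝ (w t).toFun x = 0 :=
      image_eq_zero_of_notMem_tsupport fun h => hx (hSw t ht (tsupport_fderiv_subset ℝ h))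
    rw [h1, norm_zero]
    exact le_max_right _ _

/-- In the doubled viscous term the datum `h` is only square integrable in time, so for
`mollifies_bilin` the gradient of the test function must be the bounded factor. Smooth curves
provide this bound. -/
theorem memLp_top_vgrad_curve (hΩ : IsOpen Ω) (hΩb : Bornology.IsBounded Ω)
    {w w' : ℝ → SolField Ω} (hw : IsC1Curve T w w') {p : TestFun ν T K}
    (hp : ∀ t ∈ Icc 0 T, p.u t = (w t).toL2sol) :
    MemLp (fun t => vgrad ν (p.u t)) ⊤ (timeMeas T) := by
  have := isFiniteMeasure_restrict hΩb
  obtain ⟨C, hC0, hC⟩ := hw.exists_grad_bound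
  have hb : ∀ t ∈ Icc 0 T, ‖(w t).gradL2‖
      ≤ (measureUnivNNReal (volume.restrict Ω) : ℝ) ^ (2 : ENNReal).toReal⁻¹ * C := by
    intro t ht
    refine Lp.norm_le_of_ae_bound hC0 ?_
    have h1 : (w t).gradL2 =ᵐ[volume.restrict Ω] gradField (w t).toFun :=
      (w t).memLp_grad.coeFn_toLp
    filter_upwards [h1] with x hx
    rw [hx]
    exact hC t ht x
  refine memLp_top_of_bound (memLp_vgrad p.memY.memX).1
    ((measureUnivNNReal (volume.restrict Ω) : ℝ) ^ (2 : ENNReal).toReal⁻¹ * C) ?_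
  filter_upwards [ae_restrict_mem measurableSet_Ioo] with t ht
  have ht' := Ioo_subset_Icc_self ht
  by_cases hν : 0 < ν
  · have e : vgrad ν (p.u t) = (w t).gradL2 :=
      (vgrad_of_pos hν _).trans ((congrArg grad (hp t ht')).trans ((w t).grad_toL2sol hΩ hΩb))
    exact (congrArg norm e).le.trans (hb t ht')
  · exact ((congrArg norm (vgrad_of_not_pos hν (p.u t))).trans norm_zero).le.trans
      ((norm_nonneg _).trans (hb t ht'))

/-- The rate, with the time of the test function separated from the time of the solution. -/
def doubledRate (ν : ℝ) (K : L2sol Ω → ENNReal) (ξ c : ℝ → ℝ) (h : ℝ → L2Mat Ω)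
    (M : ℝ → Lp (Mat d) 1 (volume.restrict Ω)) (g : ℝ → L2 Ω) (u : ℝ → L2sol Ω)
    (G : ℝ → Lp (Mat d) ⊤ (volume.restrict Ω)) (s t : ℝ) : ℝ :=
  c t + (inner ℝ (vgrad ν (u s)) (h t) + matPair Ω (G s) (M t) + inner ℝ (u s : L2 Ω) (g t))
    - (K (u s)).toReal * ξ t

theorem frozenRate_eq_doubledRate (hΩ : IsOpen Ω) (hΩb : Bornology.IsBounded Ω)
    {u : ℝ → L2sol Ω} {G : ℝ → Lp (Mat d) ⊤ (volume.restrict Ω)} {s : ℝ}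
    (hG : HasWeakGrad Ω (u s : L2 Ω) (G s)) (t : ℝ) :
    frozenRate ν K ξ c h M g (u s) t = doubledRate ν K ξ c h M g u G s t := by
  have e1 := integral_grad_eq_matPair hΩ hΩb hG (M t)
  have e2 : frozenRate ν K ξ c h M g (u s) t = c t + (inner ℝ (vgrad ν (u s)) (h t)
      + (∫ x in Ω, inner ℝ (grad (u s) x) (M t x)) + inner ℝ (u s : L2 Ω) (g t))
      - (K (u s)).toReal * ξ t := rfl
  have e3 : doubledRate ν K ξ c h M g u G s t = c t + (inner ℝ (vgrad ν (u s)) (h t)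
      + matPair Ω (G s) (M t) + inner ℝ (u s : L2 Ω) (g t)) - (K (u s)).toReal * ξ t := rfl
  have arith : ∀ {F D c a m m' b k : ℝ}, m = m' → F = c + (a + m + b) - k →
      D = c + (a + m' + b) - k → F = D := by
    intros
    subst_vars
    rfl
  exact arith e1 e2 e3

/-- Term by term one factor is bounded in time and the other integrable: the test function is
bounded in the viscous and force terms, the data `M` and `ξ` in the convective term and the one with
`K`. -/
theorem IsRate.mollifies_doubledRate (H : IsRate ν T K f v c h M g)
    (hξ : MemLp ξ ⊤ (timeMeas T)) {p : TestFun ν T K}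
    {G : ℝ → Lp (Mat d) ⊤ (volume.restrict Ω)} (hG : Integrable G (timeMeas T))
    (hp : MemLp (fun t => vgrad ν (p.u t)) ⊤ (timeMeas T)) {θ : ℝ → ℝ}
    (hθ : MemLp θ ⊤ (timeMeas T)) :
    Mollifies T fun s t => θ t * doubledRate ν K ξ c h M g p.u G s t := by
  have m1 := mollifies_mul_bilin (ContinuousLinearMap.mul ℝ ℝ) hθ
    (memLp_top_const (1 : ℝ)) H.integrable_const
  have m2 := mollifies_mul_bilin (innerB (L2Mat Ω)) hθ hp (H.memLp_visc.integrable one_le_two)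
  have m3 := mollifies_mul_bilin' (matPair Ω) hθ hG H.memLp_conv
  have m4 := mollifies_mul_bilin (innerB (L2 Ω)) hθ (memLp_coe p.memY.memX.bounded)
    H.integrable_force
  have m5 := mollifies_mul_bilin' (ContinuousLinearMap.mul ℝ ℝ) hθ p.integrable_K hξ
  have arith : ∀ {x c a m b k z : ℝ}, z = c + (a + m + b) - k →
      x * z = x * (1 * c) + ((x * a + x * m) + x * b) - x * k := by
    intros
    subst_vars
    ring
  have e : (fun s t => θ t * doubledRate ν K ξ c h M g p.u G s t) = fun s t =>
      θ t * ContinuousLinearMap.mul ℝ ℝ 1 (c t)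
        + ((θ t * innerB (L2Mat Ω) (vgrad ν (p.u s)) (h t) + θ t * matPair Ω (G s) (M t))
          + θ t * innerB (L2 Ω) (p.u s) (g t))
        - θ t * ContinuousLinearMap.mul ℝ ℝ (K (p.u s)).toReal (ξ t) := by
    ext s t
    exact arith rfl
  rw [e]
  exact (m1.add ((m2.add m3).add m4)).sub m5

/-- Every value along the curve is a smooth solenoidal field, so the reduced inequality applies to
it frozen at time `s`; `weak_of_frozen` then restores the motion of the test function. -/
theorem IsRate.weakForm_nonpos_of_curve (H : IsRate ν T K f v c h M g) (hΩ : IsOpen Ω)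
    (hΩb : Bornology.IsBounded Ω) (hT : 0 < T) (hv : MemLp v ⊤ (timeMeas T))
    (hξ : MemLp ξ ⊤ (timeMeas T))
    (hred : ∀ φ : SolField Ω, WeakNonpos T (fun t => energy v ξ t - inner ℝ (v t) φ.toL2sol)
      (frozenRate ν K ξ c h M g φ.toL2sol))
    {w w' : ℝ → SolField Ω} (hw : IsC1Curve T w w') {p : TestFun ν T K}
    (hp : ∀ t ∈ Icc 0 T, p.u t = (w t).toL2sol) {θ : ℝ → ℝ} (hθ : IsTimeTest T θ)
    (hθ0 : ∀ t, 0 ≤ θ t) : weakForm K v ξ c h M g θ p ≤ 0 := by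
  obtain ⟨U, G, -, hG, hUG⟩ := p.memY.memL1W1inf
  have hmol := H.mollifies_doubledRate hξ hG (memLp_top_vgrad_curve hΩ hΩb hw hp)
    hθ.memLp_top
  have hfrozen : ∀ᵐ s ∂timeMeas T, WeakNonpos T
      (fun t => energy v ξ t - inner ℝ (v t) (p.u s)) (doubledRate ν K ξ c h M g p.u G s) := by
    filter_upwards [hUG, ae_restrict_mem measurableSet_Ioo] with s hs hsT
    have e := hp s (Ioo_subset_Icc_self hsT)
    have h1 := hred (w s)
    rw [← e] at h1
    have e2 : frozenRate ν K ξ c h M g (p.u s) = doubledRate ν K ξ c h M g p.u G s :=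
      funext fun t => frozenRate_eq_doubledRate hΩ hΩb hs.2 t
    rwa [e2] at h1
  have key := weak_of_frozen hT (memLp_top_energy hv hξ) hv p.memY.memX.bounded p.integrable_du
    p.memY.eq_integral hθ hθ0 hmol hfrozen
  refine le_of_eq_of_le (congrArg₂ (· + ·) rfl (integral_congr_ae ?_)) key
  filter_upwards [hUG] with t ht
  exact congrArg (fun z => θ t * (z + inner ℝ (v t) (p.du t)))
    (frozenRate_eq_doubledRate hΩ hΩb ht.2 t)

/-! ### Density -/

/-- Integration against a bounded function is continuous on `L¹`. This makes continuity of `K` into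
`L¹(0, T)` usable for the term with weight `θ ξ`. -/
theorem continuous_integral_mul_toL1 {X : Type*} [TopologicalSpace X] {k : X → ℝ → ℝ}
    (hk : ∀ p, Integrable (k p) (timeMeas T)) (hc : Continuous fun p => (hk p).toL1)
    {b : ℝ → ℝ} (hb : MemLp b ⊤ (timeMeas T)) :
    Continuous fun p => ∫ t in Ioo 0 T, b t * k p t := by
  have e : (fun p => ∫ t in Ioo 0 T, b t * k p t) = fun p =>
      (ContinuousLinearMap.mul ℝ ℝ).lpPairing (timeMeas T) ⊤ 1 hb.toLp (hk p).toL1 := by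
    ext p
    rw [ContinuousLinearMap.lpPairing_eq_integral]
    refine integral_congr_ae ?_
    filter_upwards [hb.coeFn_toLp, (hk p).coeFn_toL1] with t h1 h2
    rw [h1, h2]
    rfl
  rw [e]
  exact (ContinuousLinearMap.continuous _).comp hc

theorem integral_affine {α : Type*} [MeasurableSpace α] {μ : Measure α} {a b c d e i : α → ℝ}
    (ha : Integrable a μ) (hb : Integrable b μ) (hc : Integrable c μ) (hd : Integrable d μ)
    (he : Integrable e μ) (hi : Integrable i μ) :
    ∫ t, (a t + (b t + c t + d t) - e t + i t) ∂μ
      = (∫ t, a t ∂μ) + ((∫ t, b t ∂μ) + (∫ t, c t ∂μ) + ∫ t, d t ∂μ) - (∫ t, e t ∂μ)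
        + ∫ t, i t ∂μ := by
  have h1 : Integrable (fun t => b t + c t) μ := hb.add hc
  have h2 : Integrable (fun t => b t + c t + d t) μ := h1.add hd
  have h3 : Integrable (fun t => a t + (b t + c t + d t)) μ := ha.add h2
  have h4 : Integrable (fun t => a t + (b t + c t + d t) - e t) μ := h3.sub he
  rw [integral_add h4 hi, integral_sub h3 he, integral_add ha h2, integral_add h1 hd,
    integral_add hb hc]

theorem integral_mul_inner_comm {V : Type*} [NormedAddCommGroup V] [InnerProductSpace ℝ V]
    (θ : ℝ → ℝ) (a b : ℝ → V) (μ : Measure ℝ) :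
    ∫ t, θ t * innerB V (a t) (b t) ∂μ = ∫ t, inner ℝ (b t) (θ t • a t) ∂μ := by
  congr 1
  ext t
  rw [innerB_apply, real_inner_smul_right, real_inner_comm]

theorem integral_mul_inner {V : Type*} [NormedAddCommGroup V] [InnerProductSpace ℝ V]
    (θ : ℝ → ℝ) (a b : ℝ → V) (μ : Measure ℝ) :
    ∫ t, θ t * innerB V (a t) (b t) ∂μ = ∫ t, inner ℝ (a t) (θ t • b t) ∂μ := by
  congr 1
  ext t
  rw [innerB_apply, real_inner_smul_right]

theorem integral_mul_integral_inner (θ : ℝ → ℝ) (u : ℝ → L2sol Ω)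
    (M : ℝ → Lp (Mat d) 1 (volume.restrict Ω)) :
    ∫ t in Ioo 0 T, θ t * ∫ x in Ω, inner ℝ (grad (u t) x) (M t x)
      = ∫ t in Ioo 0 T, ∫ x in Ω, inner ℝ (grad (u t) x) ((θ t • M t) x) := by
  refine integral_congr_ae (Eventually.of_forall fun t => ?_)
  refine (integral_const_mul _ _).symm.trans (integral_congr_ae ?_)
  filter_upwards [Lp.coeFn_smul (θ t) (M t)] with x hx
  rw [hx, Pi.smul_apply, real_inner_smul_right]

/-- Each summand is now either independent of `p` or of the type whose continuity admissibility
provides, with `θ` or its derivative absorbed into the fixed factor. -/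
theorem IsRate.weakForm_eq (H : IsRate ν T K f v c h M g) (hΩ : IsOpen Ω)
    (hΩb : Bornology.IsBounded Ω) (hv : MemLp v ⊤ (timeMeas T)) (hξ : MemLp ξ ⊤ (timeMeas T))
    {θ : ℝ → ℝ} (hθ : IsTimeTest T θ) (p : TestFun ν T K) :
    weakForm K v ξ c h M g θ p
      = (∫ t in Ioo 0 T, θ t * c t) - (∫ t in Ioo 0 T, deriv θ t * energy v ξ t)
        + (∫ t in Ioo 0 T, inner ℝ (p.u t : L2 Ω) (deriv θ t • (v t : L2 Ω)))
        + (∫ t in Ioo 0 T, inner ℝ (vgrad ν (p.u t)) (θ t • h t))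
        + (∫ t in Ioo 0 T, ∫ x in Ω, inner ℝ (grad (p.u t) x) ((θ t • M t) x))
        + (∫ t in Ioo 0 T, inner ℝ (p.u t : L2 Ω) (θ t • g t))
        - (∫ t in Ioo 0 T, (θ t * ξ t) * (K (p.u t)).toReal)
        + ∫ t in Ioo 0 T, inner ℝ (p.du t) (θ t • v t) := by
  obtain ⟨U, G, -, hG, hUG⟩ := p.memY.memL1W1inf
  have hu := p.memY.memX.bounded
  have iE : Integrable (fun t => deriv θ t * energy v ξ t) (timeMeas T) :=
    hθ.integrable_deriv_mul ((memLp_top_energy hv hξ).integrable le_top)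
  have iv : Integrable (fun t => deriv θ t * innerB (L2sol Ω) (v t) (p.u t)) (timeMeas T) :=
    hθ.integrable_deriv_mul ((memLp_top_bilin (innerB (L2sol Ω)) hv hu).integrable le_top)
  have ic : Integrable (fun t => θ t * c t) (timeMeas T) := hθ.integrable_mul H.integrable_const
  have ih : Integrable (fun t => θ t * innerB (L2Mat Ω) (vgrad ν (p.u t)) (h t)) (timeMeas T) :=
    hθ.integrable_mul
      (integrable_bilin (innerB (L2Mat Ω)) (memLp_vgrad p.memY.memX) H.memLp_visc)
  have iM : Integrable (fun t => θ t * ∫ x in Ω, inner ℝ (grad (p.u t) x) (M t x))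
      (timeMeas T) := by
    refine hθ.integrable_mul ((integrable_bilin (matPair Ω) (memLp_one_iff_integrable.2 hG)
      H.memLp_conv).congr ?_)
    filter_upwards [hUG] with t ht
    exact (integral_grad_eq_matPair hΩ hΩb ht.2 (M t)).symm
  have ig : Integrable (fun t => θ t * innerB (L2 Ω) (p.u t) (g t)) (timeMeas T) :=
    hθ.integrable_mul (integrable_bilin (innerB (L2 Ω)) (memLp_coe hu)
      (memLp_one_iff_integrable.2 H.integrable_force))
  have ik : Integrable (fun t => θ t * ((K (p.u t)).toReal * ξ t)) (timeMeas T) :=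
    hθ.integrable_mul (integrable_bilin (ContinuousLinearMap.mul ℝ ℝ)
      (memLp_one_iff_integrable.2 p.integrable_K) hξ)
  have id : Integrable (fun t => θ t * innerB (L2sol Ω) (v t) (p.du t)) (timeMeas T) :=
    hθ.integrable_mul (p.integrable_inner_du hv)
  have e1 : ∫ t in Ioo 0 T, deriv θ t * (energy v ξ t - inner ℝ (v t) (p.u t))
      = (∫ t in Ioo 0 T, deriv θ t * energy v ξ t)
        - ∫ t in Ioo 0 T, deriv θ t * innerB (L2sol Ω) (v t) (p.u t) := by
    rw [← integral_sub iE iv]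
    exact integral_congr_ae (Eventually.of_forall fun t => mul_sub _ _ _)
  have arith : ∀ {x c a m b k i z y : ℝ}, z = c + (a + m + b) - k → y = i →
      x * (z + y) = x * c + (x * a + x * m + x * b) - x * k + x * i := by
    intros
    subst_vars
    ring
  have e2 : ∫ t in Ioo 0 T, θ t * (frozenRate ν K ξ c h M g (p.u t) t + inner ℝ (v t) (p.du t))
      = (∫ t in Ioo 0 T, θ t * c t)
        + ((∫ t in Ioo 0 T, θ t * innerB (L2Mat Ω) (vgrad ν (p.u t)) (h t))
          + (∫ t in Ioo 0 T, θ t * ∫ x in Ω, inner ℝ (grad (p.u t) x) (M t x))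
          + ∫ t in Ioo 0 T, θ t * innerB (L2 Ω) (p.u t) (g t))
        - (∫ t in Ioo 0 T, θ t * ((K (p.u t)).toReal * ξ t))
        + ∫ t in Ioo 0 T, θ t * innerB (L2sol Ω) (v t) (p.du t) := by
    exact (integral_congr_ae (Eventually.of_forall fun t => arith rfl rfl)).trans
      (integral_affine ic ih iM ig ik id)
  have f1 := integral_mul_inner_comm (deriv θ) (fun t => (v t : L2 Ω)) (fun t => (p.u t : L2 Ω))
    (timeMeas T)
  have f2 := integral_mul_inner θ (fun t => vgrad ν (p.u t)) h (timeMeas T)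
  have f3 := integral_mul_integral_inner (T := T) θ p.u M
  have f4 := integral_mul_inner θ (fun t => (p.u t : L2 Ω)) g (timeMeas T)
  have f5 : ∫ t in Ioo 0 T, θ t * ((K (p.u t)).toReal * ξ t)
      = ∫ t in Ioo 0 T, (θ t * ξ t) * (K (p.u t)).toReal :=
    integral_congr_ae (Eventually.of_forall fun t => by simp only; ring)
  have f6 := integral_mul_inner_comm θ v p.du (timeMeas T)
  have arith' : ∀ {W a b x y z w k i x' y' z' w' k' i' A B : ℝ}, A = a - x →
      B = b + (y + z + w) - k + i → W = -A + B → x = x' → y = y' → z = z' → w = w' → k = k' →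
      i = i' → W = b - a + x' + y' + z' + w' - k' + i' := by
    intros
    subst_vars
    ring
  exact arith' e1 e2 rfl f1 f2 f3 f4 f5 f6

/-- Continuity of the weak form makes the test functions satisfying the inequality a closed set; it
contains the dense set of smooth curves. -/
theorem IsRate.weakForm_nonpos (H : IsRate ν T K f v c h M g) (hΩ : IsOpen Ω)
    (hΩb : Bornology.IsBounded Ω) (hT : 0 < T) (hK : IsAdmissible ν T K)
    (hv : MemLp v ⊤ (timeMeas T)) (hξ : MemLp ξ ⊤ (timeMeas T))
    (hred : ∀ φ : SolField Ω, WeakNonpos T (fun t => energy v ξ t - inner ℝ (v t) φ.toL2sol)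
      (frozenRate ν K ξ c h M g φ.toL2sol))
    {θ : ℝ → ℝ} (hθ : IsTimeTest T θ) (hθ0 : ∀ t, 0 ≤ θ t) (p : TestFun ν T K) :
    weakForm K v ξ c h M g θ p ≤ 0 := by
  obtain ⟨τ, hcK, hcg, hch, hcM, hcM2, hdense⟩ := hK.exists_topology
  have c1 := hcg (fun t => deriv θ t • (v t : L2 Ω)) (integrable_bilin
    (ContinuousLinearMap.lsmul ℝ ℝ) hθ.memLp_top_deriv
    (memLp_one_iff_integrable.2 ((memLp_coe hv).integrable le_top)))
  have c2 : Continuous fun p : TestFun ν T K =>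
      ∫ t in Ioo 0 T, inner ℝ (vgrad ν (p.u t)) (θ t • h t) := by
    by_cases hν : 0 < ν
    · have e : (fun p : TestFun ν T K => ∫ t in Ioo 0 T, inner ℝ (vgrad ν (p.u t)) (θ t • h t))
          = fun p => ∫ t in Ioo 0 T, inner ℝ (grad (p.u t)) (θ t • h t) :=
        funext fun p => integral_congr_ae (Eventually.of_forall fun t =>
          congrArg (inner ℝ · (θ t • h t)) (vgrad_of_pos hν _))
      rw [e]
      exact hcM2 hν _ (H.memLp_visc.smul (p := ⊤) hθ.memLp_top)
    -- Without viscosity `vgrad` is zero and the term is constant in `p`; continuity of the `L²`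
    -- gradient pairing is assumed only for `ν > 0`.
    · have e : (fun p : TestFun ν T K => ∫ t in Ioo 0 T, inner ℝ (vgrad ν (p.u t)) (θ t • h t))
          = fun _ => ∫ t in Ioo 0 T, inner ℝ (0 : L2Mat Ω) (θ t • h t) :=
        funext fun p => integral_congr_ae (Eventually.of_forall fun t =>
          congrArg (inner ℝ · (θ t • h t)) (vgrad_of_not_pos hν _))
      rw [e]
      exact continuous_const
  have c3 := hcM (fun t => θ t • M t)
    (memLp_top_bilin (ContinuousLinearMap.lsmul ℝ ℝ) hθ.memLp_top H.memLp_conv)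
  have c4 := hcg (fun t => θ t • g t) (integrable_bilin (ContinuousLinearMap.lsmul ℝ ℝ)
    hθ.memLp_top (memLp_one_iff_integrable.2 H.integrable_force))
  have c5 := continuous_integral_mul_toL1 (fun p : TestFun ν T K => p.integrable_K) hcK
    (memLp_top_bilin (ContinuousLinearMap.mul ℝ ℝ) hθ.memLp_top hξ)
  have c6 := hch (fun t => θ t • v t)
    ((memLp_top_bilin (ContinuousLinearMap.lsmul ℝ ℝ) hθ.memLp_top hv).mono_exponent le_top)
  have hc : Continuous fun p : TestFun ν T K => weakForm K v ξ c h M g θ p := by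
    rw [funext fun p => H.weakForm_eq hΩ hΩb hv hξ hθ p]
    exact (((((continuous_const.add c1).add c2).add c3).add c4).sub c5).add c6
  have hcl : IsClosed {p : TestFun ν T K | weakForm K v ξ c h M g θ p ≤ 0} :=
    isClosed_le hc continuous_const
  refine hcl.closure_subset_iff.2 ?_ (hdense p)
  rintro q ⟨w, w', hw, hq⟩
  exact H.weakForm_nonpos_of_curve hΩ hΩb hT hv hξ hred hw hq hθ hθ0

end Rates

end EnergyVariational

end

/-! ### The equivalence -/

theorem proposition2 (d : ℕ) (hd : 2 ≤ d) (Ω : Set (EnergyVariational.Vec d)) (hΩ : IsOpen Ω)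
    (hΩb : Bornology.IsBounded Ω) (T : ℝ) (hT : 0 < T) (ν : ℝ) (hν : 0 ≤ ν)
    (K : EnergyVariational.L2sol Ω → ENNReal) (hK : EnergyVariational.IsAdmissible ν T K)
    (f : EnergyVariational.Force Ω ν T)
    (v : ℝ → EnergyVariational.L2sol Ω) (hv : EnergyVariational.MemX ν T v)
    (ξ : ℝ → ℝ) (hξ : MemLp ξ ⊤ (volume.restrict (Ioo 0 T)))
    (hξ0 : ∀ᵐ t ∂(volume.restrict (Ioo 0 T)), 0 ≤ ξ t) :
    (EnergyVariational.RelativeEnergyInequality K f v ξ ↔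
      EnergyVariational.LocalInequality K f v ξ) ∧
    (EnergyVariational.RelativeEnergyInequality K f v ξ ↔
      EnergyVariational.ReducedInequality K f v ξ) := by
  obtain ⟨c, h, M, g, H⟩ := EnergyVariational.exists_isRate hΩ hΩb hν K f hv
  have h1 := H.relative_iff_local hΩ hΩb hT hv.bounded hξ
  have h2 := H.local_iff hΩ hΩb hT hv.bounded hξ
  have h3 := H.reduced_iff hΩ hΩb hT hK hv.bounded hξ
  -- Towards 3 the weak form is specialised to time-independent test functions; the converse is the
  -- doubling argument followed by density.
  refine ⟨h1, h1.trans (h2.trans (Iff.trans ⟨fun hQ φ => ?_, fun hred p θ hθ hθ0 => ?_⟩ h3.symm))⟩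
  · exact EnergyVariational.weakNonpos_of_weakForm hΩ hΩb hK φ fun θ hθ hθ0 => hQ _ θ hθ hθ0
  · exact H.weakForm_nonpos hΩ hΩb hT hK hv.bounded hξ hred hθ hθ0 p
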